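/- Fix $T>0$ and integers $1\le q\le p$, $m\ge1$. Consider, on $[0,T]$ and for iterations $k=0,1,2,\dots$, the system $$Y_k(s)=G_1(s)U_k(s)+G_2(s)D(s),$$ where capital letters denote Laplace transforms of the corresponding time functions (functions on $[0,T]$ being continued to $[0,\infty)$; the continuation does not matter on $[0,T]$ because multiplication by a rational function is causal). Here $u_k(t)\in\mathbb R^p$ is the input, $y_k(t)\in\mathbb R^q$ the output, $G_1$ and $G_2$ are real rational matrices of sizes $q\times p$ and $q\times m$, and $D$ is a real rational vector of size $m$. A rational matrix $G(s)$ is called proper if $\lim_{s\to\infty}G(s)$ exists and is nonzero, and strictly proper if this limit is $0$; $\rho$ denotes the spectral radius. Assume: * (C1) $G_1$ and $G_2$ are strictly proper; * (C2) $D(s)=d_0+\widehat D(s)$ with a constant vector $d_0\neq0$ and a strictly proper rational vector $\widehat D$; * (C3) $G_1$ has relative degree one, that is, $\lim_{s\to\infty}sG_1(s)$ exists and has full rank; * (C4) writing $G_1=[G_{11}\ \ G_{12}]$ with $G_{11}$ of size $q\times q$ and $\Phi_1=\mathcal L^{-1}[G_1]=[\Phi_{1,1}\ \ \Phi_{1,2}]$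 correspondingly, $\Phi_{1,1}(0)$ is nonsingular. Let $y_d\in C^1([0,T],\mathbb R^q)$ satisfy the initial condition $y_d(0)=y_k(0)$ (all outputs of the system have the same value at $t=0$), let $\Gamma(s)$ be a $p\times q$ real rational matrix, and apply the iterative learning control law $$U_{k+1}(s)=U_k(s)+\Gamma(s)E_k(s),\qquad e_k=y_d-y_k,\qquad k\ge0,$$ from an initial input $u_0\in C([0,T],\mathbb R^p)$. 1. The following are equivalent. * For every $u_0\in C([0,T],\mathbb R^p)$, all $u_k$ are continuous on $[0,T]$, $\lim_{k\to\infty}u_k(t)=u_\infty(t)$ for all $t\in[0,T]$ with some $u_\infty\in C([0,T],\mathbb R^p)$, and $\lim_{k\to\infty}y_k(t)=y_d(t)$ for all $t\in[0,T]$. * $s^{-1}\Gamma(s)$ and $G_1(s)\Gamma(s)$ are proper and $\rho\bigl(I-\lim_{s\to\infty}G_1(s)\Gamma(s)\bigr)<1$. 2. If $\lim_{s\to\infty}G_1(s)\Gamma(s)$ exists and $\rho\bigl(I-\lim_{s\to\infty}G_1(s)\Gamma(s)\bigr)<1$, then $G_1(s)\Gamma(s)$ is nonsingular, and $\mathcal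 U_{\rm ILC}=\mathcal U_d$, where $\mathcal U_{\rm ILC}$ is the set of all inputs $u_\infty$ on $[0,T]$ with $$U_\infty(s)=\Gamma(s)\left[G_1(s)\Gamma(s)\right]^{-1}\left[Y_d(s)-G_2(s)D(s)\right]+\widetilde\Gamma(s)U_0(s)\qquad(*)$$ for some (not necessarily continuous) initial input $u_0$, and $\mathcal U_d$ is the set of all desired inputs, i.e. of all inputs $u_d$ on $[0,T]$ with $G_1(s)U_d(s)=Y_d(s)-G_2(s)D(s)$. Here, with $\Gamma=\begin{bmatrix}\Gamma_1\\ \Gamma_2\end{bmatrix}$, $\Gamma_1$ of size $q\times q$, $$\widetilde\Gamma=\begin{bmatrix}G_{11}^{-1}G_{12}\Gamma_2(G_1\Gamma)^{-1}G_{11} & -G_{11}^{-1}G_{12}\left\{I-\Gamma_2(G_1\Gamma)^{-1}G_{12}\right\}\\ -\Gamma_2(G_1\Gamma)^{-1}G_{11} & I-\Gamma_2(G_1\Gamma)^{-1}G_{12}\end{bmatrix}.$$ 3. If the equivalent conditions in 1 hold, then for every continuous $u_0$ the convergence $u_k\to u_\infty$ and $y_k\to y_d$ is uniform on $[0,T]$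 and $u_\infty$ is given by $(*)$. If $q<p$, the learned input $u_\infty$ really depends on the initial input: two suitable continuous initial inputs lead to different $u_\infty$. The set of all inputs $u_\infty$ learned from continuous initial inputs is exactly the set of all continuous desired inputs. -/

import Mathlib

open Filter Topology Set
open scoped Matrix

noncomputable section

namespace ILC

/-! ### Real rational matrices -/

/-- The value at the real point `s` of a matrix of real rational functions. -/
def evalAt {ι κ : Type*} (G : Matrix ι κ (RatFunc ℝ)) (s : ℝ) : Matrix ι κ ℝ :=
  G.map (RatFunc.eval (RingHom.id ℝ) s)

/-- The value at the real point `s` of a vector of real rational functions. -/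
def evalVec {ι : Type*} (D : ι → RatFunc ℝ) (s : ℝ) : ι → ℝ :=
  fun i => RatFunc.eval (RingHom.id ℝ) s (D i)

/-- `lim_{s → ∞} G(s) = K`, entry by entry. -/
def HasLimitAtInfinity {ι κ : Type*} (G : Matrix ι κ (RatFunc ℝ)) (K : Matrix ι κ ℝ) : Prop :=
  ∀ i j, Tendsto (fun s : ℝ => evalAt G s i j) atTop (𝓝 (K i j))

/-- `G` is proper: `lim_{s → ∞} G(s)` exists and is not zero. -/
def IsProper {ι κ : Type*} (G : Matrix ι κ (RatFunc ℝ)) : Prop :=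
  ∃ K : Matrix ι κ ℝ, K ≠ 0 ∧ HasLimitAtInfinity G K

/-- `G` is strictly proper: `lim_{s → ∞} G(s) = 0`. -/
def IsStrictlyProper {ι κ : Type*} (G : Matrix ι κ (RatFunc ℝ)) : Prop :=
  HasLimitAtInfinity G 0

/-- `D(s) = d₀ + D̂(s)` with a nonzero constant vector `d₀` and a strictly proper vector `D̂`. -/
def IsImpulsePlusStrictlyProper {ι : Type*} (D : ι → RatFunc ℝ) : Prop :=
  ∃ (d₀ : ι → ℝ) (Dhat : ι → RatFunc ℝ), d₀ ≠ 0 ∧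
    (∀ i, Tendsto (fun s : ℝ => evalVec Dhat s i) atTop (𝓝 0)) ∧
    ∀ i, D i = RatFunc.C (d₀ i) + Dhat i

/-- `G` has relative degree one: `lim_{s → ∞} s G(s)` exists and has full rank. -/
def HasRelativeDegreeOne {ι κ : Type*} [Fintype ι] [Fintype κ]
    (G : Matrix ι κ (RatFunc ℝ)) : Prop :=
  ∃ K : Matrix ι κ ℝ, HasLimitAtInfinity ((RatFunc.X : RatFunc ℝ) • G) K ∧
    K.rank = min (Fintype.card ι) (Fintype.card κ)

/-! ### Laplace transforms -/

/-- The Laplace integral of `f` converges absolutely at some (hence at every larger) real point. -/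
def LaplaceTransformable (f : ℝ → ℝ) : Prop :=
  ∃ σ : ℝ, MeasureTheory.IntegrableOn (fun t => Real.exp (-(σ * t)) * f t) (Ioi 0) MeasureTheory.volume

/-- The Laplace transform `∫₀^∞ e^{-st} f(t) dt` at the real point `s`. Identities between
transforms and rational functions are required for all sufficiently large real `s`, which by
analyticity is the same as requiring them on a right half plane. -/
def laplaceTransform (f : ℝ → ℝ) (s : ℝ) : ℝ :=
  ∫ t in Ioi (0 : ℝ), Real.exp (-(s * t)) * f t

/-- `Φ = ℒ⁻¹[G]`: the function `Φ`, continuous on `[0, ∞)`, has Laplace transform `G(s)`. -/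
def IsImpulseResponse {ι κ : Type*} (G : Matrix ι κ (RatFunc ℝ)) (Φ : ℝ → Matrix ι κ ℝ) : Prop :=
  ∀ i j, ContinuousOn (fun t => Φ t i j) (Ici 0) ∧ LaplaceTransformable (fun t => Φ t i j) ∧
    ∀ᶠ s in atTop, laplaceTransform (fun t => Φ t i j) s = evalAt G s i j

/-- `F` is a Laplace transform of the signal `f`, which is given on `[0, T]`: it is the transform
of a transformable function on `[0, ∞)` that agrees with `f` on `[0, T]`. (Multiplication by a
rational function is causal, so the behaviour after `T` has no influence on `[0, T]`.) -/
def IsTransformOn {ι : Type*} (T : ℝ) (f : ℝ → ι → ℝ) (F : ℝ → ι → ℝ) : Prop :=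
  ∃ g : ℝ → ι → ℝ, (∀ i, LaplaceTransformable (fun t => g t i)) ∧ EqOn g f (Icc 0 T) ∧
    F = fun s i => laplaceTransform (fun t => g t i) s

/-! ### The system and the learning process -/

section System

variable {q m : ℕ} {κ : Type*} [Fintype κ]

/-- `y` is the (continuous) output on `[0, T]` of the system `Y = G₁ U + G₂ D` for the input `u`. -/
def IsOutput (T : ℝ) (G₁ : Matrix (Fin q) κ (RatFunc ℝ)) (G₂ : Matrix (Fin q) (Fin m) (RatFunc ℝ))
    (D : Fin m → RatFunc ℝ) (u : ℝ → κ → ℝ) (y : ℝ → Fin q → ℝ) : Prop :=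
  ContinuousOn y (Icc 0 T) ∧
    ∃ U Y, IsTransformOn T u U ∧ IsTransformOn T y Y ∧
      ∀ᶠ s in atTop, Y s = evalAt G₁ s *ᵥ U s + evalAt G₂ s *ᵥ evalVec D s

/-- The initial condition: `yd(0) = y(0)` for the outputs `y` of the system. -/
def InitialCondition (T : ℝ) (G₁ : Matrix (Fin q) κ (RatFunc ℝ))
    (G₂ : Matrix (Fin q) (Fin m) (RatFunc ℝ)) (D : Fin m → RatFunc ℝ) (yd : ℝ → Fin q → ℝ) : Prop :=
  ∀ u y, IsOutput T G₁ G₂ D u y → yd 0 = y 0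

/-- `u` is a desired input: `G₁ U = Yd - G₂ D`. -/
def IsDesiredInput (T : ℝ) (G₁ : Matrix (Fin q) κ (RatFunc ℝ))
    (G₂ : Matrix (Fin q) (Fin m) (RatFunc ℝ)) (D : Fin m → RatFunc ℝ) (yd : ℝ → Fin q → ℝ)
    (u : ℝ → κ → ℝ) : Prop :=
  ∃ U Yd, IsTransformOn T u U ∧ IsTransformOn T yd Yd ∧
    ∀ᶠ s in atTop, evalAt G₁ s *ᵥ U s = Yd s - evalAt G₂ s *ᵥ evalVec D s

/-- Inputs `u k` and outputs `y k` generated on `[0, T]` by the system under the updating law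
`U_{k+1} = U_k + Γ E_k`, where `e k = yd - y k`. -/
structure IsILCRun (T : ℝ) (G₁ : Matrix (Fin q) κ (RatFunc ℝ))
    (G₂ : Matrix (Fin q) (Fin m) (RatFunc ℝ)) (D : Fin m → RatFunc ℝ)
    (Γ : Matrix κ (Fin q) (RatFunc ℝ)) (yd : ℝ → Fin q → ℝ)
    (u : ℕ → ℝ → κ → ℝ) (y : ℕ → ℝ → Fin q → ℝ) : Prop where
  output : ∀ k, IsOutput T G₁ G₂ D (u k) (y k)
  update : ∀ k, ∃ U U' E, IsTransformOn T (u k) U ∧ IsTransformOn T (u (k + 1)) U' ∧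
    IsTransformOn T (fun t => yd t - y k t) E ∧
    ∀ᶠ s in atTop, U' s = U s + evalAt Γ s *ᵥ E s

/-- Started at the initial input `u₀`, the learning process has continuous inputs `u k` that
converge at every point of `[0, T]` to the continuous function `w`, and the tracking objective
`y k → yd` is accomplished at every point of `[0, T]`. -/
def IsLearnedInput (T : ℝ) (G₁ : Matrix (Fin q) κ (RatFunc ℝ))
    (G₂ : Matrix (Fin q) (Fin m) (RatFunc ℝ)) (D : Fin m → RatFunc ℝ)
    (Γ : Matrix κ (Fin q) (RatFunc ℝ)) (yd : ℝ → Fin q → ℝ) (u₀ w : ℝ → κ → ℝ) : Prop :=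
  ContinuousOn w (Icc 0 T) ∧
    ∃ u y, IsILCRun T G₁ G₂ D Γ yd u y ∧ EqOn (u 0) u₀ (Icc 0 T) ∧
      (∀ k, ContinuousOn (u k) (Icc 0 T)) ∧
      (∀ t ∈ Icc 0 T, Tendsto (fun k => u k t) atTop (𝓝 (w t))) ∧
      ∀ t ∈ Icc 0 T, Tendsto (fun k => y k t) atTop (𝓝 (yd t))

end System

/-! ### The learned input (`p = q + r` inputs, the first `q` of which form the first block) -/

section Learned

variable {q r m : ℕ}

/-- The block matrix `Γ̃` built from `G₁ = [G₁₁ G₁₂]` and `Γ = [Γ₁; Γ₂]`. -/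
def gammaTilde (G₁ : Matrix (Fin q) (Fin q ⊕ Fin r) (RatFunc ℝ))
    (Γ : Matrix (Fin q ⊕ Fin r) (Fin q) (RatFunc ℝ)) :
    Matrix (Fin q ⊕ Fin r) (Fin q ⊕ Fin r) (RatFunc ℝ) :=
  let G₁₁ := G₁.toCols₁
  let G₁₂ := G₁.toCols₂
  let Γ₂ := Γ.toRows₂
  Matrix.fromBlocks
    (G₁₁⁻¹ * G₁₂ * Γ₂ * (G₁ * Γ)⁻¹ * G₁₁) (-(G₁₁⁻¹ * G₁₂ * (1 - Γ₂ * (G₁ * Γ)⁻¹ * G₁₂)))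
    (-(Γ₂ * (G₁ * Γ)⁻¹ * G₁₁)) (1 - Γ₂ * (G₁ * Γ)⁻¹ * G₁₂)

/-- `W = Γ (G₁Γ)⁻¹ [Yd - G₂ D] + Γ̃ U₀` for the transforms of `w`, `yd` and `u₀`. -/
def LearnedInputFormula (T : ℝ) (G₁ : Matrix (Fin q) (Fin q ⊕ Fin r) (RatFunc ℝ))
    (G₂ : Matrix (Fin q) (Fin m) (RatFunc ℝ)) (D : Fin m → RatFunc ℝ)
    (Γ : Matrix (Fin q ⊕ Fin r) (Fin q) (RatFunc ℝ)) (yd : ℝ → Fin q → ℝ)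
    (u₀ w : ℝ → (Fin q ⊕ Fin r) → ℝ) : Prop :=
  ∃ U₀ W Yd, IsTransformOn T u₀ U₀ ∧ IsTransformOn T w W ∧ IsTransformOn T yd Yd ∧
    ∀ᶠ s in atTop, W s = evalAt (Γ * (G₁ * Γ)⁻¹) s *ᵥ (Yd s - evalAt G₂ s *ᵥ evalVec D s)
      + evalAt (gammaTilde G₁ Γ) s *ᵥ U₀ s

end Learned

end ILC

end

open ILC

/-!
# Iterative learning control of a plant of relative degree one

A rational function `g` with a finite limit at infinity acts on signals by a causal operator
(`act`): multiplication by the gain `g(∞)` plus convolution with the continuous impulse response of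
`g - g(∞)`, which exists by partial fractions (`exists_isKernel`). Transforms are compared only
modulo *negligible* functions (`Negl`), the rational multiples of transforms of signals that vanish
on `[0, T]`. This relation is stable under multiplication by arbitrary rational functions, proper
or not. Since the Laplace transform is injective
(`ae_eq_zero_of_forall_integral_exp_eq_zero`) and integration is injective on `[0, T]`, a
negligible transform comes from a signal that vanishes on `[0, T]` (`Negl.ae_eq_zero`). Thus
congruent transforms of continuous signals mean equal signals on `[0, T]` (`TransOn.eqOn`), and the
choice of the continuation after `T` is irrelevant.

Because the outputs and `yd` have the same initial value and `s G₁` has a finite limit at infinity,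
the tracking error is the integral of an *error rate* (`errRate`), which is continuous when the
input is. In terms of it the updating law reads `U_{k+1} ≡ U_k + s⁻¹ Γ E'_k`, and hence
`E'_{k+1} ≡ (1 - G₁ Γ) E'_k` (`TrackingData.cong_errRate_succ`). As the first block of
`lim s G₁(s)` is nonsingular, `s G₁` has a right inverse with a finite limit, so every continuous
function is the error rate of a continuous input (`TrackingData.exists_errRate_eqOn`).

*Sufficiency.* Let `M` be the limit of `G₁ Γ`. If `ρ(1 - M) < 1`, Gelfand's formula makes some power
`(1 - M) ^ n` small, and in a sup norm with a strong exponential weight the convolution part of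
`(1 - G₁ Γ) ^ n` is small as well. The error rates decay geometrically, and the inputs and outputs
converge uniformly (`TrackingData.exists_uniform_limit`). The limit input satisfies
`G₁ W ≡ Yd - G₂ D`. Moreover `Γ̃ = 1 - Γ (G₁ Γ)⁻¹ G₁` (`gammaTilde_eq`) annihilates `Γ`, so `Γ̃ U_k`
is invariant and `Γ̃ W ≡ Γ̃ U₀`. The sum `Γ (G₁ Γ)⁻¹ G₁ W + Γ̃ W` is the formula for the learned
input.

*Necessity.* If learning succeeds from every continuous initial input, a unit step as initial error
rate shows that `s⁻¹ Γ` has a finite limit (`TrackingData.hasFiniteLim_of_isLearnedInput`). Now let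
the initial error rate be a constant `c`. The increments `u_k(T) - u_0(T)` are bounded for every
initial error rate, so the uniform boundedness principle bounds these functionals. A step response
at time `t` is a limit of responses at time `T` to continuous signals, so the inputs are bounded on
the whole interval (`exists_step_response_bound`). By dominated convergence the limit input has
error rate zero. At `t = 0` only the gains act, whence `(1 - M) ^ k c → 0` for every `c`, that is,
`ρ(1 - M) < 1` (`TrackingData.spectralRadius_lt_one`).

*Desired inputs.* `G₁ Γ̃ = 0` shows that the formula yields desired inputs, and a desired input
reproduces itself when it is taken as the initial input (`setOf_learnedInputFormula_eq`,
`IsDesiredInput.isLearnedInput`). With more inputs than outputs the plant has nonzero continuous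
null inputs, so there are several continuous desired inputs, each of them learned from itself
(`TrackingData.exists_ne_desiredInput`).
-/

namespace ILC

open MeasureTheory

/-! ### Rational functions near infinity -/

/-- The value of the rational function `g` at the real point `s`. -/
noncomputable abbrev ev (g : RatFunc ℝ) (s : ℝ) : ℝ := RatFunc.eval (RingHom.id ℝ) s g

theorem eventually_eval_ne_zero {p : Polynomial ℝ} (hp : p ≠ 0) :
    ∀ᶠ s in (atTop : Filter ℝ), p.eval s ≠ 0 :=
  Polynomial.eventually_atTop_not_isRoot p hp

theorem eventually_denom_ne_zero (g : RatFunc ℝ) :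
    ∀ᶠ s in (atTop : Filter ℝ), Polynomial.eval₂ (RingHom.id ℝ) s g.denom ≠ 0 :=
  eventually_eval_ne_zero g.denom_ne_zero

theorem ev_add (g h : RatFunc ℝ) : ∀ᶠ s in atTop, ev (g + h) s = ev g s + ev h s := by
  filter_upwards [eventually_denom_ne_zero g, eventually_denom_ne_zero h] with s h1 h2
  exact RatFunc.eval_add _ _ h1 h2

theorem ev_mul (g h : RatFunc ℝ) : ∀ᶠ s in atTop, ev (g * h) s = ev g s * ev h s := by
  filter_upwards [eventually_denom_ne_zero g, eventually_denom_ne_zero h] with s h1 h2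
  exact RatFunc.eval_mul _ _ h1 h2

theorem ev_C (c s : ℝ) : ev (RatFunc.C c) s = c := by simp [ev]

theorem ev_neg (g : RatFunc ℝ) : ∀ᶠ s in atTop, ev (-g) s = -ev g s := by
  filter_upwards [ev_add g (-g)] with s h1
  rw [add_neg_cancel] at h1
  simp only [ev, RatFunc.eval_zero] at h1 ⊢
  linarith

theorem ev_sub (g h : RatFunc ℝ) : ∀ᶠ s in atTop, ev (g - h) s = ev g s - ev h s := by
  filter_upwards [ev_add g (-h), ev_neg h] with s h1 h2
  rw [sub_eq_add_neg, h1, h2, sub_eq_add_neg]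

theorem ev_inv (g : RatFunc ℝ) : ∀ᶠ s in atTop, ev g⁻¹ s = (ev g s)⁻¹ := by
  by_cases hg : g = 0
  · simp [hg, ev]
  · filter_upwards [ev_mul g g⁻¹] with s h1
    rw [mul_inv_cancel₀ hg] at h1
    simp only [ev, RatFunc.eval_one] at h1 ⊢
    exact eq_inv_of_mul_eq_one_right h1.symm

theorem ev_sum {α : Type*} (S : Finset α) (g : α → RatFunc ℝ) :
    ∀ᶠ s in atTop, ev (∑ a ∈ S, g a) s = ∑ a ∈ S, ev (g a) s := by
  classical
  induction S using Finset.induction_on with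
  | empty => simp [ev]
  | insert a S ha ih =>
    filter_upwards [ih, ev_add (g a) (∑ a ∈ S, g a)] with s h1 h2
    rw [Finset.sum_insert ha, Finset.sum_insert ha, h2, h1]

theorem ev_prod {α : Type*} (S : Finset α) (g : α → RatFunc ℝ) :
    ∀ᶠ s in atTop, ev (∏ a ∈ S, g a) s = ∏ a ∈ S, ev (g a) s := by
  classical
  induction S using Finset.induction_on with
  | empty => simp [ev]
  | insert a S ha ih =>
    filter_upwards [ih, ev_mul (g a) (∏ a ∈ S, g a)] with s h1 h2
    rw [Finset.prod_insert ha, Finset.prod_insert ha, h2, h1]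

theorem ev_ne_zero {g : RatFunc ℝ} (hg : g ≠ 0) : ∀ᶠ s in atTop, ev g s ≠ 0 := by
  filter_upwards [ev_mul g g⁻¹] with s h1 h0
  rw [mul_inv_cancel₀ hg, h0] at h1
  simp [ev] at h1

section Matrices

variable {ι κ μ : Type*}

theorem evalAt_apply (A : Matrix ι κ (RatFunc ℝ)) (s : ℝ) (i : ι) (j : κ) :
    evalAt A s i j = ev (A i j) s := rfl

theorem evalAt_add [Finite ι] [Finite κ] (A B : Matrix ι κ (RatFunc ℝ)) :
    ∀ᶠ s in atTop, evalAt (A + B) s = evalAt A s + evalAt B s := by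
  filter_upwards [eventually_all.2 fun i => eventually_all.2 fun j => ev_add (A i j) (B i j)]
    with s h
  ext i j
  exact h i j

theorem evalAt_sub [Finite ι] [Finite κ] (A B : Matrix ι κ (RatFunc ℝ)) :
    ∀ᶠ s in atTop, evalAt (A - B) s = evalAt A s - evalAt B s := by
  filter_upwards [eventually_all.2 fun i => eventually_all.2 fun j => ev_sub (A i j) (B i j)]
    with s h
  ext i j
  exact h i j

theorem evalAt_smul [Finite ι] [Finite κ] (g : RatFunc ℝ) (A : Matrix ι κ (RatFunc ℝ)) :
    ∀ᶠ s in atTop, evalAt (g • A) s = ev g s • evalAt A s := by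
  filter_upwards [eventually_all.2 fun i => eventually_all.2 fun j => ev_mul g (A i j)]
    with s h
  ext i j
  exact h i j

theorem evalAt_zero (s : ℝ) : evalAt (0 : Matrix ι κ (RatFunc ℝ)) s = 0 := by
  ext i j
  simp [evalAt]

theorem evalAt_one [DecidableEq ι] (s : ℝ) : evalAt (1 : Matrix ι ι (RatFunc ℝ)) s = 1 := by
  ext i j
  by_cases h : i = j <;> simp [evalAt, Matrix.one_apply, h]

theorem evalAt_mul [Finite ι] [Fintype κ] [Finite μ] (A : Matrix ι κ (RatFunc ℝ))
    (B : Matrix κ μ (RatFunc ℝ)) :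
    ∀ᶠ s in atTop, evalAt (A * B) s = evalAt A s * evalAt B s := by
  filter_upwards [eventually_all.2 fun i => eventually_all.2 fun j =>
      ev_sum Finset.univ (fun k => A i k * B k j),
    eventually_all.2 fun i => eventually_all.2 fun k => eventually_all.2 fun j =>
      ev_mul (A i k) (B k j)] with s h1 h2
  ext i j
  simp only [evalAt_apply, Matrix.mul_apply, h1]
  exact Finset.sum_congr rfl fun k _ => h2 i k j

theorem evalAt_det [Fintype ι] [DecidableEq ι] (A : Matrix ι ι (RatFunc ℝ)) :
    ∀ᶠ s in atTop, ev A.det s = (evalAt A s).det := by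
  have hsign : ∀ (σ : Equiv.Perm ι) s,
      ev (((Equiv.Perm.sign σ : ℤˣ) : ℤ) : RatFunc ℝ) s = ((Equiv.Perm.sign σ : ℤˣ) : ℤ) := by
    intro σ s
    rw [← ev_C (((Equiv.Perm.sign σ : ℤˣ) : ℤ) : ℝ) s, map_intCast]
  filter_upwards [ev_sum Finset.univ
      (fun σ : Equiv.Perm ι => (((Equiv.Perm.sign σ : ℤˣ) : ℤ) : RatFunc ℝ) * ∏ i, A (σ i) i),
    eventually_all.2 fun σ : Equiv.Perm ι =>
      ev_mul (((Equiv.Perm.sign σ : ℤˣ) : ℤ) : RatFunc ℝ) (∏ i, A (σ i) i),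
    eventually_all.2 fun σ : Equiv.Perm ι => ev_prod Finset.univ fun i => A (σ i) i]
    with s h1 h2 h3
  rw [Matrix.det_apply', Matrix.det_apply', h1]
  refine Finset.sum_congr rfl fun σ _ => ?_
  rw [h2, h3, hsign]
  rfl

/-! ### Limits at infinity -/

theorem HasLimitAtInfinity.mul [Fintype κ] [Finite ι] [Finite μ] {A : Matrix ι κ (RatFunc ℝ)}
    {B : Matrix κ μ (RatFunc ℝ)} {K : Matrix ι κ ℝ} {L : Matrix κ μ ℝ}
    (hA : HasLimitAtInfinity A K) (hB : HasLimitAtInfinity B L) :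
    HasLimitAtInfinity (A * B) (K * L) := by
  intro i j
  have h : Tendsto (fun s => ∑ k, evalAt A s i k * evalAt B s k j) atTop (𝓝 ((K * L) i j)) := by
    rw [Matrix.mul_apply]
    exact tendsto_finsetSum _ fun k _ => (hA i k).mul (hB k j)
  refine h.congr' ?_
  filter_upwards [evalAt_mul A B] with s hs
  rw [hs, Matrix.mul_apply]

theorem HasLimitAtInfinity.sub [Finite ι] [Finite κ] {A B : Matrix ι κ (RatFunc ℝ)}
    {K L : Matrix ι κ ℝ} (hA : HasLimitAtInfinity A K) (hB : HasLimitAtInfinity B L) :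
    HasLimitAtInfinity (A - B) (K - L) := by
  intro i j
  refine ((hA i j).sub (hB i j)).congr' ?_
  filter_upwards [evalAt_sub A B] with s hs
  rw [hs, Matrix.sub_apply]

theorem HasLimitAtInfinity.add [Finite ι] [Finite κ] {A B : Matrix ι κ (RatFunc ℝ)}
    {K L : Matrix ι κ ℝ} (hA : HasLimitAtInfinity A K) (hB : HasLimitAtInfinity B L) :
    HasLimitAtInfinity (A + B) (K + L) := by
  intro i j
  refine ((hA i j).add (hB i j)).congr' ?_
  filter_upwards [evalAt_add A B] with s hs
  rw [hs, Matrix.add_apply]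

theorem HasLimitAtInfinity.one [DecidableEq ι] :
    HasLimitAtInfinity (1 : Matrix ι ι (RatFunc ℝ)) 1 := by
  intro i j
  simp only [evalAt_one]
  exact tendsto_const_nhds

theorem HasLimitAtInfinity.pow [Fintype ι] [DecidableEq ι] {A : Matrix ι ι (RatFunc ℝ)}
    {K : Matrix ι ι ℝ} (hA : HasLimitAtInfinity A K) (n : ℕ) :
    HasLimitAtInfinity (A ^ n) (K ^ n) := by
  induction n with
  | zero => simpa using HasLimitAtInfinity.one
  | succ n ih => simpa [pow_succ] using ih.mul hA

theorem HasLimitAtInfinity.tendsto {A : Matrix ι κ (RatFunc ℝ)} {K : Matrix ι κ ℝ}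
    (hA : HasLimitAtInfinity A K) : Tendsto (evalAt A) atTop (𝓝 K) :=
  tendsto_pi_nhds.2 fun i => tendsto_pi_nhds.2 fun j => hA i j

/-- A square rational matrix with a nonsingular limit is nonsingular over the rational functions. -/
theorem HasLimitAtInfinity.isUnit_det [Fintype ι] [DecidableEq ι] {A : Matrix ι ι (RatFunc ℝ)}
    {K : Matrix ι ι ℝ} (hA : HasLimitAtInfinity A K) (hK : IsUnit K.det) : IsUnit A.det := by
  rw [isUnit_iff_ne_zero] at hK ⊢
  intro h0
  have h1 : Tendsto (fun s => (evalAt A s).det) atTop (𝓝 K.det) :=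
    (continuous_id.matrix_det.tendsto K).comp hA.tendsto
  have h2 : Tendsto (fun _ : ℝ => (0 : ℝ)) atTop (𝓝 K.det) := by
    refine h1.congr' ?_
    filter_upwards [evalAt_det A] with s hs
    rw [← hs, h0]
    simp [ev]
  exact hK (tendsto_nhds_unique h2 tendsto_const_nhds)

theorem HasLimitAtInfinity.inv [Fintype ι] [DecidableEq ι] {A : Matrix ι ι (RatFunc ℝ)}
    {K : Matrix ι ι ℝ} (hA : HasLimitAtInfinity A K) (hK : IsUnit K.det) :
    HasLimitAtInfinity A⁻¹ K⁻¹ := by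
  have hu := hA.isUnit_det hK
  have h1 : Tendsto (fun s => (evalAt A s).det) atTop (𝓝 K.det) :=
    (continuous_id.matrix_det.tendsto K).comp hA.tendsto
  have h2 : Tendsto (fun s => (evalAt A s).adjugate) atTop (𝓝 K.adjugate) :=
    (continuous_id.matrix_adjugate.tendsto K).comp hA.tendsto
  have h3 : Tendsto (fun s => (evalAt A s)⁻¹) atTop (𝓝 K⁻¹) := by
    simp only [Matrix.inv_def, Ring.inverse_eq_inv']
    exact (h1.inv₀ hK.ne_zero).smul h2
  intro i j
  refine ((tendsto_pi_nhds.1 (tendsto_pi_nhds.1 h3 i)) j).congr' ?_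
  filter_upwards [evalAt_mul A A⁻¹] with s hs
  rw [Matrix.mul_nonsing_inv _ hu, evalAt_one] at hs
  rw [Matrix.inv_eq_right_inv hs.symm]

end Matrices

/-! ### Proper rational functions -/

/-- `g` has the finite limit `c` at infinity. -/
def HasLim (g : RatFunc ℝ) (c : ℝ) : Prop := Tendsto (ev g) atTop (𝓝 c)

/-- `g` has some finite limit at infinity; unlike in `IsProper`, the limit `0` is allowed. -/
def HasFiniteLim (g : RatFunc ℝ) : Prop := ∃ c, HasLim g c

theorem HasLim.mul {g h : RatFunc ℝ} {c d : ℝ} (hg : HasLim g c) (hh : HasLim h d) :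
    HasLim (g * h) (c * d) :=
  (Tendsto.mul hg hh).congr' ((ev_mul g h).mono fun _ h => h.symm)

theorem HasLim.add {g h : RatFunc ℝ} {c d : ℝ} (hg : HasLim g c) (hh : HasLim h d) :
    HasLim (g + h) (c + d) :=
  (Tendsto.add hg hh).congr' ((ev_add g h).mono fun _ h => h.symm)

theorem HasLim.sub {g h : RatFunc ℝ} {c d : ℝ} (hg : HasLim g c) (hh : HasLim h d) :
    HasLim (g - h) (c - d) :=
  (Tendsto.sub hg hh).congr' ((ev_sub g h).mono fun _ h => h.symm)

theorem HasLim.const (c : ℝ) : HasLim (RatFunc.C c) c := by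
  unfold HasLim
  simp only [funext (ev_C c)]
  exact tendsto_const_nhds

theorem HasLim.sum {α : Type*} {S : Finset α} {g : α → RatFunc ℝ} {c : α → ℝ}
    (h : ∀ a ∈ S, HasLim (g a) (c a)) : HasLim (∑ a ∈ S, g a) (∑ a ∈ S, c a) :=
  (tendsto_finsetSum S h).congr' ((ev_sum S g).mono fun _ h => h.symm)

theorem ev_X_inv (s : ℝ) (hs : s ≠ 0) : ev (RatFunc.X : RatFunc ℝ)⁻¹ s = s⁻¹ := by
  have h := RatFunc.eval_mul (f := RingHom.id ℝ) (a := s) (x := (RatFunc.X : RatFunc ℝ))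
    (y := (RatFunc.X : RatFunc ℝ)⁻¹) (by simp) ?_
  · rw [mul_inv_cancel₀ RatFunc.X_ne_zero, RatFunc.eval_one, RatFunc.eval_X] at h
    exact eq_inv_of_mul_eq_one_right h.symm
  · intro h0
    have hd : (RatFunc.X : RatFunc ℝ)⁻¹.denom ∣ (Polynomial.X : Polynomial ℝ) := by
      have := RatFunc.denom_div_dvd (1 : Polynomial ℝ) (Polynomial.X : Polynomial ℝ)
      simpa using this
    obtain ⟨w, hw⟩ := hd
    apply hs
    have := congrArg (Polynomial.eval₂ (RingHom.id ℝ) s) hw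
    rw [Polynomial.eval₂_mul, h0, zero_mul, Polynomial.eval₂_X] at this
    exact this

theorem ev_X_inv_eventually : ∀ᶠ s in atTop, ev (RatFunc.X : RatFunc ℝ)⁻¹ s = s⁻¹ := by
  filter_upwards [eventually_gt_atTop 0] with s hs using ev_X_inv s hs.ne'

theorem HasLim.X_inv : HasLim (RatFunc.X : RatFunc ℝ)⁻¹ 0 :=
  tendsto_inv_atTop_zero.congr' (ev_X_inv_eventually.mono fun _ h => h.symm)

theorem ev_eq_div (g : RatFunc ℝ) (s : ℝ) : ev g s = g.num.eval s / g.denom.eval s := rfl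

/-- The reciprocal of a rational function without a finite limit is strictly proper. -/
theorem hasLim_inv_of_not_hasFiniteLim {g : RatFunc ℝ} (hg : ¬ HasFiniteLim g) :
    HasLim g⁻¹ 0 := by
  have hdeg : g.denom.degree < g.num.degree := by
    by_contra! hle
    apply hg
    rcases hle.lt_or_eq with hlt | heq
    · exact ⟨0, Polynomial.div_tendsto_atTop_zero_of_degree_lt _ _ hlt⟩
    · exact ⟨_, Polynomial.div_tendsto_atTop_leadingCoeff_div_of_degree_eq _ _ heq⟩
  have h := Polynomial.div_tendsto_atTop_zero_of_degree_lt _ _ hdeg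
  refine h.congr' ?_
  filter_upwards [ev_inv g] with s hs
  rw [hs, ev_eq_div, inv_div]

/-- A strictly proper rational function has relative degree at least one. -/
theorem HasLim.X_mul {g : RatFunc ℝ} (hg : HasLim g 0) : HasFiniteLim (RatFunc.X * g) := by
  have hdeg : g.num.degree < g.denom.degree :=
    (Polynomial.div_tendsto_atTop_zero_iff_degree_lt _ _ g.denom_ne_zero).1 hg
  have hd : (Polynomial.X * g.num).degree ≤ g.denom.degree := by
    by_cases h0 : g.num = 0
    · simp [h0]
    rw [Polynomial.degree_mul, Polynomial.degree_X]
    rw [Polynomial.degree_eq_natDegree h0, Polynomial.degree_eq_natDegree g.denom_ne_zero] at *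
    norm_cast at *
    omega
  have hev : ∀ᶠ s in atTop, (Polynomial.X * g.num).eval s / g.denom.eval s
      = ev (RatFunc.X * g) s := by
    filter_upwards [ev_mul RatFunc.X g] with s hs
    rw [hs, ev_eq_div g]
    simp [ev, mul_div_assoc]
  rcases hd.lt_or_eq with hlt | heq
  · exact ⟨0, (Polynomial.div_tendsto_atTop_zero_of_degree_lt _ _ hlt).congr' hev⟩
  · exact ⟨_, (Polynomial.div_tendsto_atTop_leadingCoeff_div_of_degree_eq _ _ heq).congr' hev⟩

/-- Every rational function becomes proper after division by a power of `s`. -/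
theorem exists_X_inv_pow_mul (g : RatFunc ℝ) :
    ∃ n : ℕ, HasFiniteLim ((RatFunc.X : RatFunc ℝ)⁻¹ ^ n * g) := by
  refine ⟨g.num.natDegree + 1, 0, ?_⟩
  have hd : g.num.degree < (Polynomial.X ^ (g.num.natDegree + 1) * g.denom).degree := by
    rw [Polynomial.degree_mul, Polynomial.degree_X_pow,
      Polynomial.degree_eq_natDegree g.denom_ne_zero]
    refine lt_of_le_of_lt Polynomial.degree_le_natDegree ?_
    norm_cast
    omega
  refine (Polynomial.div_tendsto_atTop_zero_of_degree_lt _ _ hd).congr' ?_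
  have hX : ∀ᶠ s in atTop, ev ((RatFunc.X : RatFunc ℝ)⁻¹ ^ (g.num.natDegree + 1)) s
      = s⁻¹ ^ (g.num.natDegree + 1) := by
    filter_upwards [ev_prod (Finset.range (g.num.natDegree + 1))
      (fun _ => (RatFunc.X : RatFunc ℝ)⁻¹), ev_X_inv_eventually] with s h1 h2
    simpa [h2] using h1
  filter_upwards [ev_mul ((RatFunc.X : RatFunc ℝ)⁻¹ ^ (g.num.natDegree + 1)) g, hX] with s h1 h2
  rw [h1, h2, ev_eq_div]
  simp [div_eq_mul_inv]
  ring

/-! ### The Laplace transform -/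

theorem LaplaceTransformable.integrableOn {f : ℝ → ℝ} (hf : LaplaceTransformable f) :
    ∀ᶠ s in atTop, IntegrableOn (fun t => Real.exp (-(s * t)) * f t) (Ioi 0) := by
  obtain ⟨σ, hσ⟩ := hf
  filter_upwards [eventually_ge_atTop σ] with s hs
  have h : IntegrableOn (fun t => Real.exp (-((s - σ) * t)) * (Real.exp (-(σ * t)) * f t))
      (Ioi 0) := by
    refine Integrable.bdd_mul (c := 1) hσ (by fun_prop) ?_
    filter_upwards [ae_restrict_mem measurableSet_Ioi] with t ht
    rw [Real.norm_eq_abs, Real.abs_exp, Real.exp_le_one_iff]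
    have := mul_nonneg (sub_nonneg.2 hs) (le_of_lt ht)
    linarith
  refine h.congr_fun (fun t _ => ?_) measurableSet_Ioi
  simp only
  rw [← mul_assoc, ← Real.exp_add]
  ring_nf

theorem LaplaceTransformable.add {f g : ℝ → ℝ} (hf : LaplaceTransformable f)
    (hg : LaplaceTransformable g) : LaplaceTransformable (fun t => f t + g t) := by
  obtain ⟨s, h1, h2⟩ := (hf.integrableOn.and hg.integrableOn).exists
  refine ⟨s, (h1.add h2).congr_fun (fun t _ => ?_) measurableSet_Ioi⟩
  simp [mul_add]

theorem LaplaceTransformable.const_mul {f : ℝ → ℝ} (hf : LaplaceTransformable f) (c : ℝ) :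
    LaplaceTransformable (fun t => c * f t) := by
  obtain ⟨s, h1⟩ := hf
  refine ⟨s, IntegrableOn.congr_fun (Integrable.const_mul h1 c) (fun t _ => ?_) measurableSet_Ioi⟩
  simp only
  ring

theorem LaplaceTransformable.congr_ae {f g : ℝ → ℝ} (hf : LaplaceTransformable f)
    (h : f =ᵐ[volume.restrict (Ioi 0)] g) : LaplaceTransformable g := by
  obtain ⟨s, h1⟩ := hf
  refine ⟨s, Integrable.congr h1 ?_⟩
  filter_upwards [h] with t ht
  rw [ht]

theorem laplaceTransform_congr_ae {f g : ℝ → ℝ}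
    (h : f =ᵐ[volume.restrict (Ioi 0)] g) : laplaceTransform f = laplaceTransform g := by
  ext s
  refine integral_congr_ae ?_
  filter_upwards [h] with t ht
  rw [ht]

theorem laplaceTransform_add {f g : ℝ → ℝ} (hf : LaplaceTransformable f)
    (hg : LaplaceTransformable g) : ∀ᶠ s in atTop,
      laplaceTransform (fun t => f t + g t) s = laplaceTransform f s + laplaceTransform g s := by
  filter_upwards [hf.integrableOn, hg.integrableOn] with s h1 h2
  simp only [laplaceTransform, mul_add]
  exact integral_add h1 h2

theorem laplaceTransform_const_mul (f : ℝ → ℝ) (c s : ℝ) :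
    laplaceTransform (fun t => c * f t) s = c * laplaceTransform f s := by
  simp only [laplaceTransform]
  rw [← integral_const_mul]
  congr 1
  ext t
  ring

theorem laplaceTransformable_of_integrableOn {f : ℝ → ℝ} (hf : IntegrableOn f (Ioi 0)) :
    LaplaceTransformable f := ⟨0, by simpa using hf⟩

theorem LaplaceTransformable.intervalIntegrable {f : ℝ → ℝ} (hf : LaplaceTransformable f)
    {a b : ℝ} (ha : 0 ≤ a) (hb : 0 ≤ b) : IntervalIntegrable f volume a b := by
  wlog hab : a ≤ b generalizing a b
  · exact (this hb ha (le_of_not_ge hab)).symm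
  rw [intervalIntegrable_iff_integrableOn_Ioc_of_le hab]
  obtain ⟨s, h1⟩ := hf
  have h2 : IntegrableOn (fun t => Real.exp (-(s * t)) * f t) (Icc a b) := by
    rw [integrableOn_Icc_iff_integrableOn_Ioc]
    exact h1.mono_set fun t ht => lt_of_le_of_lt ha ht.1
  have h3 := IntegrableOn.continuousOn_mul (g := fun t => Real.exp (s * t))
    (K := Icc a b) (by fun_prop) h2 isCompact_Icc
  refine (h3.mono_set Ioc_subset_Icc_self).congr_fun (fun t _ => ?_) measurableSet_Ioc
  simp only
  rw [← mul_assoc, ← Real.exp_add]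
  simp

/-- The convolution `∫₀ᵗ κ(t - τ) f(τ) dτ` of a kernel and a signal on the half-line. -/
noncomputable def conv (κ f : ℝ → ℝ) (t : ℝ) : ℝ := ∫ τ in (0 : ℝ)..t, κ (t - τ) * f τ

theorem exp_mul_conv (κ f : ℝ → ℝ) (s t : ℝ) :
    Real.exp (-(s * t)) * conv κ f t = ∫ τ in (0 : ℝ)..t,
      (Real.exp (-(s * τ)) * f τ) * (Real.exp (-(s * (t - τ))) * κ (t - τ)) := by
  rw [conv, ← intervalIntegral.integral_const_mul]
  congr 1
  ext τ
  have : Real.exp (-(s * t)) = Real.exp (-(s * τ)) * Real.exp (-(s * (t - τ))) := by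
    rw [← Real.exp_add]; ring_nf
  rw [this]; ring

theorem LaplaceTransformable.conv {κ f : ℝ → ℝ} (hκ : LaplaceTransformable κ)
    (hf : LaplaceTransformable f) : LaplaceTransformable (conv κ f) := by
  obtain ⟨s, h1, h2⟩ := (hf.integrableOn.and hκ.integrableOn).exists
  refine ⟨s, ?_⟩
  have h := (integrable_posConvolution h1 h2 (ContinuousLinearMap.mul ℝ ℝ)).integrableOn
    (s := Ioi 0)
  refine h.congr_fun (fun t ht => ?_) measurableSet_Ioi
  simp only [posConvolution, indicator_of_mem ht, ContinuousLinearMap.mul_apply']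
  rw [exp_mul_conv]

theorem laplaceTransform_conv {κ f : ℝ → ℝ} (hκ : LaplaceTransformable κ)
    (hf : LaplaceTransformable f) : ∀ᶠ s in atTop,
      laplaceTransform (conv κ f) s = laplaceTransform κ s * laplaceTransform f s := by
  filter_upwards [hκ.integrableOn, hf.integrableOn] with s h1 h2
  have h := integral_posConvolution h2 h1 (ContinuousLinearMap.mul ℝ ℝ)
  simp only [ContinuousLinearMap.mul_apply'] at h
  rw [laplaceTransform, laplaceTransform, laplaceTransform, mul_comm (∫ _ in _, _), ← h]
  congr 1
  ext t
  rw [exp_mul_conv]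

/-- A continuous kernel turns a locally integrable signal into a continuous one. -/
theorem continuousOn_conv {κ f : ℝ → ℝ} (hκ : Continuous κ) {T : ℝ} (hT : 0 ≤ T)
    (hf : IntervalIntegrable f volume 0 T) : ContinuousOn (conv κ f) (Icc 0 T) := by
  rw [intervalIntegrable_iff_integrableOn_Ioc_of_le hT] at hf
  obtain ⟨C, hC⟩ := (isCompact_Icc (a := -T) (b := T)).exists_bound_of_continuousOn hκ.continuousOn
  set F : ℝ → ℝ → ℝ := fun t τ => (Iio t).indicator (fun τ => κ (t - τ) * f τ) τ
  have heq : EqOn (conv κ f) (fun t => ∫ τ in Ioc 0 T, F t τ) (Icc 0 T) := by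
    intro t ht
    simp only [conv, F]
    rw [intervalIntegral.integral_of_le ht.1, integral_indicator measurableSet_Iio,
      Measure.restrict_restrict measurableSet_Iio, integral_Ioc_eq_integral_Ioo]
    congr 2
    ext τ
    simp only [mem_Ioo, mem_inter_iff, mem_Iio, mem_Ioc]
    constructor
    · rintro ⟨h1, h2⟩; exact ⟨h2, h1, (h2.trans_le ht.2).le⟩
    · rintro ⟨h2, h1, _⟩; exact ⟨h1, h2⟩
  refine ContinuousOn.congr ?_ heq
  intro t ht
  refine continuousWithinAt_of_dominated (bound := fun τ => C * ‖f τ‖) ?_ ?_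
    (hf.norm.const_mul C) ?_
  · refine Eventually.of_forall fun t => AEStronglyMeasurable.indicator ?_ measurableSet_Iio
    exact (by fun_prop : Continuous fun τ => κ (t - τ)).aestronglyMeasurable.mul hf.1
  · filter_upwards [self_mem_nhdsWithin] with t ht
    filter_upwards [ae_restrict_mem measurableSet_Ioc] with τ hτ
    by_cases h : τ ∈ Iio t
    · simp only [F, indicator_of_mem h, norm_mul]
      gcongr
      exact hC _ ⟨by linarith [ht.1, hτ.2], by linarith [ht.2, hτ.1]⟩
    · simp only [F, indicator_of_notMem h, norm_zero]
      have := (norm_nonneg (κ 0)).trans (hC 0 ⟨by linarith, hT⟩)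
      positivity
  · -- the integrand is continuous in `t` off the diagonal only
    have hne : ∀ᵐ τ ∂(volume.restrict (Ioc 0 T)), τ ≠ t :=
      ae_restrict_of_ae (Measure.ae_ne volume t)
    filter_upwards [hne] with τ hτ
    refine ContinuousAt.continuousWithinAt ?_
    rcases hτ.lt_or_gt with h | h
    · have : (fun x => κ (x - τ) * f τ) =ᶠ[𝓝 t] fun x => F x τ := by
        filter_upwards [lt_mem_nhds h] with x hx
        simp only [F, indicator_of_mem (mem_Iio.2 hx)]
      refine ContinuousAt.congr ?_ this
      fun_prop
    · have : (fun _ => (0 : ℝ)) =ᶠ[𝓝 t] fun x => F x τ := by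
        filter_upwards [gt_mem_nhds h] with x hx
        simp only [F, indicator_of_notMem (notMem_Iio.2 hx.le)]
      exact ContinuousAt.congr continuousAt_const this

/-! ### Uniqueness of the Laplace transform -/

/-- A function on the half-line all of whose moments against `e^{-nt}` vanish is zero almost
everywhere: by the Weierstrass theorem in the variable `e^{-t} ∈ [0, 1]` it is orthogonal to every
test function. -/
theorem ae_eq_zero_of_forall_integral_exp_eq_zero {f : ℝ → ℝ} (hf : IntegrableOn f (Ioi 0))
    (h : ∀ n : ℕ, ∫ t in Ioi (0 : ℝ), Real.exp (-t) ^ n * f t = 0) :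
    f =ᵐ[volume.restrict (Ioi 0)] 0 := by
  have hpoly : ∀ p : Polynomial ℝ,
      IntegrableOn (fun t => p.eval (Real.exp (-t)) * f t) (Ioi 0) ∧
      ∫ t in Ioi (0 : ℝ), p.eval (Real.exp (-t)) * f t = 0 := by
    intro p
    induction p using Polynomial.induction_on' with
    | add p q hp hq =>
      simp only [Polynomial.eval_add, add_mul]
      refine ⟨hp.1.add hq.1, ?_⟩
      rw [integral_add hp.1 hq.1, hp.2, hq.2, add_zero]
    | monomial n a =>
      simp only [Polynomial.eval_monomial, mul_assoc]
      refine ⟨Integrable.const_mul (Integrable.bdd_mul (c := 1) hf (by fun_prop) ?_) a, ?_⟩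
      · filter_upwards [ae_restrict_mem measurableSet_Ioi] with t ht
        rw [norm_pow, Real.norm_eq_abs, Real.abs_exp]
        exact pow_le_one₀ (Real.exp_nonneg _) (Real.exp_le_one_iff.2 (neg_nonpos.2 (le_of_lt ht)))
      · rw [integral_const_mul, h, mul_zero]
  have key := isOpen_Ioi.ae_eq_zero_of_integral_contDiff_smul_eq_zero
    (U := Ioi (0 : ℝ)) (f := f) (μ := volume) hf.locallyIntegrableOn ?_
  · filter_upwards [ae_restrict_of_ae key, ae_restrict_mem measurableSet_Ioi] with t h1 h2 using h1 h2
  intro g hg hgc hgs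
  have hgcont := hg.continuous
  have hg0 : g 0 = 0 := by
    by_contra hne
    exact lt_irrefl (0 : ℝ) (hgs (subset_tsupport _ hne))
  -- `g(-log x)`, which `Real.log 0 = 0` and `g 0 = 0` extend continuously to `x = 0`
  have hφ : ContinuousOn (fun x => g (-Real.log x)) (Icc 0 1) := by
    intro x hx
    rcases hx.1.eq_or_lt with h0 | h0
    · subst h0
      refine ContinuousAt.continuousWithinAt ?_
      rw [continuousAt_iff_punctured_nhds]
      simp only [Real.log_zero, neg_zero, hg0]
      have h1 : Tendsto (fun x => -Real.log x) (𝓝[≠] 0) atTop :=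
        tendsto_neg_atBot_atTop.comp Real.tendsto_log_nhdsNE_zero
      obtain ⟨R, hR⟩ := hgc.isCompact.isBounded.bddAbove
      refine tendsto_const_nhds.congr' ?_
      filter_upwards [h1.eventually_gt_atTop R] with x hx
      exact (image_eq_zero_of_notMem_tsupport fun hm => absurd (hR hm) (not_le.2 hx)).symm
    · exact (hgcont.continuousAt.comp ((Real.continuousAt_log h0.ne').neg)).continuousWithinAt
  have hint : IntegrableOn (fun t => g t * f t) (Ioi 0) := by
    obtain ⟨C, hC⟩ := hgc.exists_bound_of_continuous hgcont
    exact Integrable.bdd_mul (c := C) hf (by fun_prop) (Eventually.of_forall hC)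
  have hsupp : ∫ t, g t • f t = ∫ t in Ioi (0 : ℝ), g t * f t := by
    simp only [smul_eq_mul]
    rw [setIntegral_eq_integral_of_forall_compl_eq_zero]
    intro t ht
    rw [image_eq_zero_of_notMem_tsupport fun h => ht (hgs h), zero_mul]
  rw [hsupp]
  have hbound : ∀ ε > 0, |∫ t in Ioi (0 : ℝ), g t * f t|
      ≤ ε * ∫ t in Ioi (0 : ℝ), |f t| := by
    intro ε hε
    obtain ⟨p, hp⟩ := exists_polynomial_near_of_continuousOn 0 1 _ hφ ε hε
    have h1 : ∫ t in Ioi (0 : ℝ), g t * f t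
        = ∫ t in Ioi (0 : ℝ), (g t * f t - p.eval (Real.exp (-t)) * f t) := by
      rw [integral_sub hint (hpoly p).1, (hpoly p).2, sub_zero]
    rw [h1, ← integral_const_mul, ← Real.norm_eq_abs]
    refine norm_integral_le_of_norm_le (hf.norm.const_mul ε) ?_
    filter_upwards [ae_restrict_mem measurableSet_Ioi] with t ht
    rw [← sub_mul, norm_mul, ← Real.norm_eq_abs (f t)]
    gcongr
    have := hp (Real.exp (-t)) ⟨(Real.exp_pos _).le, Real.exp_le_one_iff.2 (neg_nonpos.2 (le_of_lt ht))⟩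
    rw [Real.log_exp, neg_neg, abs_sub_comm] at this
    exact this.le
  have h0 : |∫ t in Ioi (0 : ℝ), g t * f t| ≤ 0 := by
    have ht : Tendsto (fun ε : ℝ => ε * ∫ t in Ioi (0 : ℝ), |f t|) (𝓝[>] 0)
        (𝓝 (0 * ∫ t in Ioi (0 : ℝ), |f t|)) :=
      (tendsto_nhdsWithin_of_tendsto_nhds tendsto_id).mul_const _
    rw [zero_mul] at ht
    exact ge_of_tendsto ht (by filter_upwards [self_mem_nhdsWithin] with ε hε using hbound ε hε)
  exact abs_nonpos_iff.1 h0

theorem ae_eq_zero_of_laplaceTransform {f : ℝ → ℝ} (hf : LaplaceTransformable f)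
    (h : ∀ᶠ s in atTop, laplaceTransform f s = 0) : f =ᵐ[volume.restrict (Ioi 0)] 0 := by
  obtain ⟨σ, hσ⟩ := eventually_atTop.1 (h.and hf.integrableOn)
  have := ae_eq_zero_of_forall_integral_exp_eq_zero (hσ σ le_rfl).2 fun n => ?_
  · filter_upwards [this] with t ht
    simpa using ht
  · refine Eq.trans (integral_congr_ae (Eventually.of_forall fun t => ?_)) (hσ (σ + n) (by simp)).1
    simp only
    rw [← mul_assoc, ← Real.exp_nat_mul, ← Real.exp_add]
    ring_nf

theorem ae_eq_of_laplaceTransform_eq {f g : ℝ → ℝ} (hf : LaplaceTransformable f)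
    (hg : LaplaceTransformable g) (h : laplaceTransform f =ᶠ[atTop] laplaceTransform g) :
    f =ᵐ[volume.restrict (Ioi 0)] g := by
  have h1 := ae_eq_zero_of_laplaceTransform (hf.add (hg.const_mul (-1))) ?_
  · filter_upwards [h1] with t ht
    simp only [Pi.zero_apply] at ht
    linarith
  · filter_upwards [laplaceTransform_add hf (hg.const_mul (-1)), h] with s h1 h2
    rw [h1, laplaceTransform_const_mul, h2]
    ring

/-! ### Impulse responses of rational functions -/

/-- `κ` is a continuous impulse response of the rational function `g`. -/
structure IsKernel (g : RatFunc ℝ) (κ : ℝ → ℝ) : Prop where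
  continuous : Continuous κ
  transformable : LaplaceTransformable κ
  eventually_eq : ∀ᶠ s in atTop, ev g s = laplaceTransform κ s

theorem IsKernel.add {g h : RatFunc ℝ} {κ l : ℝ → ℝ} (hg : IsKernel g κ) (hh : IsKernel h l) :
    IsKernel (g + h) (fun t => κ t + l t) where
  continuous := hg.continuous.add hh.continuous
  transformable := hg.transformable.add hh.transformable
  eventually_eq := by
    filter_upwards [ev_add g h, hg.eventually_eq, hh.eventually_eq,
      laplaceTransform_add hg.transformable hh.transformable] with s h1 h2 h3 h4
    rw [h1, h2, h3, h4]

theorem IsKernel.const_mul {g : RatFunc ℝ} {κ : ℝ → ℝ} (hg : IsKernel g κ) (c : ℝ) :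
    IsKernel (RatFunc.C c * g) (fun t => c * κ t) where
  continuous := hg.continuous.const_mul c
  transformable := hg.transformable.const_mul c
  eventually_eq := by
    filter_upwards [ev_mul (RatFunc.C c) g, hg.eventually_eq] with s h1 h2
    rw [h1, h2, laplaceTransform_const_mul, ev_C]

theorem continuous_conv {κ f : ℝ → ℝ} (hκ : Continuous κ) (hf : Continuous f) :
    Continuous (conv κ f) := by
  unfold conv
  exact intervalIntegral.continuous_parametric_intervalIntegral_of_continuous (by fun_prop)
    continuous_id

theorem IsKernel.mul {g h : RatFunc ℝ} {κ l : ℝ → ℝ} (hg : IsKernel g κ) (hh : IsKernel h l) :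
    IsKernel (g * h) (conv κ l) where
  continuous := continuous_conv hg.continuous hh.continuous
  transformable := hg.transformable.conv hh.transformable
  eventually_eq := by
    filter_upwards [ev_mul g h, hg.eventually_eq, hh.eventually_eq,
      laplaceTransform_conv hg.transformable hh.transformable] with s h1 h2 h3 h4
    rw [h1, h2, h3, h4]

theorem isKernel_zero : IsKernel 0 (fun _ => 0) where
  continuous := continuous_const
  transformable := ⟨0, by simp⟩
  eventually_eq := by simp [ev, laplaceTransform]

/-- The real part of `c e^{zt}` is an impulse response of the real part of `c / (s - z)`. -/
theorem isKernel_re_exp {g : RatFunc ℝ} (c z : ℂ)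
    (hg : ∀ᶠ s : ℝ in atTop, ev g s = (c / (s - z)).re) :
    IsKernel g (fun t => (c * Complex.exp (z * t)).re) := by
  have key : ∀ s t : ℝ, Real.exp (-(s * t)) * (c * Complex.exp (z * t)).re
      = RCLike.re (c * Complex.exp ((z - s) * t)) := by
    intro s t
    rw [RCLike.re_to_complex, ← Complex.re_ofReal_mul, Complex.ofReal_exp, mul_left_comm,
      ← Complex.exp_add]
    congr 3
    push_cast
    ring
  have hint : ∀ s : ℝ, z.re < s →
      IntegrableOn (fun t : ℝ => c * Complex.exp ((z - s) * t)) (Ioi 0) := fun s hs =>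
    (integrableOn_exp_mul_complex_Ioi (a := z - s) (by simpa using hs) 0).const_mul c
  refine ⟨by fun_prop, ⟨z.re + 1, ?_⟩, ?_⟩
  · simp only [key]
    exact (hint _ (by linarith)).re
  · filter_upwards [hg, eventually_gt_atTop z.re] with s h1 h2
    rw [h1, laplaceTransform]
    simp only [key]
    rw [integral_re (hint s h2), integral_const_mul,
      integral_exp_mul_complex_Ioi (a := z - s) (by simpa using h2) 0, RCLike.re_to_complex]
    congr 1
    have : (z : ℂ) - s ≠ 0 := by
      intro h0
      have := congrArg Complex.re h0
      simp at this
      linarith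
    have h' : (s : ℂ) - z ≠ 0 := by rwa [← neg_ne_zero, neg_sub]
    field_simp
    simp
    ring

theorem ev_div_algebraMap (p r : Polynomial ℝ) : ∀ᶠ s in atTop,
    ev (algebraMap _ (RatFunc ℝ) p / algebraMap _ (RatFunc ℝ) r) s = p.eval s / r.eval s := by
  rw [div_eq_mul_inv]
  filter_upwards [ev_mul (algebraMap _ (RatFunc ℝ) p) (algebraMap _ (RatFunc ℝ) r)⁻¹,
    ev_inv (algebraMap _ (RatFunc ℝ) r)] with s h1 h2
  rw [h1, h2, ← div_eq_mul_inv]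
  simp [ev, RatFunc.eval_algebraMap]

open Polynomial in
/-- Every strictly proper rational function has a continuous impulse response. The denominator
splits into linear and quadratic factors; dividing the numerator with remainder by one of them
reduces the claim to partial fractions and to products, that is, convolutions. -/
theorem exists_isKernel_of_degree_lt (r : ℝ[X]) : ∀ p : ℝ[X], p.degree < r.degree →
    ∃ κ, IsKernel (algebraMap _ (RatFunc ℝ) p / algebraMap _ (RatFunc ℝ) r) κ := by
  induction hn : r.natDegree using Nat.strong_induction_on generalizing r with
  | _ n ih =>
  subst hn
  intro p hp
  have hr : r ≠ 0 := by rintro rfl; simp at hp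
  by_cases hr0 : r.degree = 0
  · rw [hr0, Nat.WithBot.lt_zero_iff, degree_eq_bot] at hp
    rw [hp, map_zero, zero_div]
    exact ⟨_, isKernel_zero⟩
  obtain ⟨z, hz⟩ : ∃ z : ℂ, aeval z r = 0 := IsAlgClosed.exists_aeval_eq_zero _ r hr0
  -- a monic factor of degree one or two, whose partial fractions have impulse responses
  obtain ⟨d, hdm, hd0, hdr, hbase⟩ : ∃ d : ℝ[X], d.Monic ∧ 0 < d.natDegree ∧ d ∣ r ∧
      ∀ a : ℝ[X], a.degree < d.degree →
        ∃ κ, IsKernel (algebraMap _ (RatFunc ℝ) a / algebraMap _ (RatFunc ℝ) d) κ := by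
    by_cases him : z.im = 0
    · refine ⟨X - C z.re, monic_X_sub_C _, by simp, ?_, fun a ha => ?_⟩
      · have hzr : z = (z.re : ℂ) := by apply Complex.ext <;> simp [him]
        rw [dvd_iff_isRoot, IsRoot]
        rw [hzr] at hz
        have : aeval ((algebraMap ℝ ℂ) z.re) r = 0 := hz
        rw [aeval_algebraMap_apply] at this
        simpa using this
      · rw [degree_X_sub_C] at ha
        have ha' : a = C (a.coeff 0) := eq_C_of_degree_le_zero (Nat.WithBot.lt_one_iff_le_zero.1 ha)
        refine ⟨_, isKernel_re_exp (a.coeff 0 : ℂ) (z.re : ℂ) ?_⟩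
        filter_upwards [ev_div_algebraMap a (X - C z.re)] with s hs
        rw [hs, ha']
        simp only [eval_C, eval_sub, eval_X, coeff_C_zero]
        rw [← Complex.ofReal_sub, ← Complex.ofReal_div, Complex.ofReal_re]
    · have hform : (X ^ 2 - C (2 * z.re) * X + C (‖z‖ ^ 2) : ℝ[X])
          = C 1 * X ^ 2 + C (-(2 * z.re)) * X + C (‖z‖ ^ 2) := by
        simp [sub_eq_add_neg]
      have hdeg : (X ^ 2 - C (2 * z.re) * X + C (‖z‖ ^ 2) : ℝ[X]).natDegree = 2 := by
        rw [hform]; exact natDegree_quadratic one_ne_zero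
      refine ⟨_, ?_, ?_, r.quadratic_dvd_of_aeval_eq_zero_im_ne_zero hz him, fun a ha => ?_⟩
      · rw [Monic, hform]; exact leadingCoeff_quadratic one_ne_zero
      · rw [hdeg]; norm_num
      · have ha1 : a.natDegree ≤ 1 := by
          refine natDegree_le_iff_coeff_eq_zero.2 fun N hN => coeff_eq_zero_of_degree_lt ?_
          refine ha.trans_le (degree_le_natDegree.trans ?_)
          rw [hdeg]
          exact_mod_cast hN
        obtain ⟨b, e, hab⟩ := exists_eq_X_add_C_of_natDegree_le_one ha1
        refine ⟨_, isKernel_re_exp (⟨b, (-e - b * z.re) / z.im⟩ : ℂ) z ?_⟩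
        filter_upwards [ev_div_algebraMap a (X ^ 2 - C (2 * z.re) * X + C (‖z‖ ^ 2))] with s hs
        rw [hs, hab]
        simp only [eval_add, eval_sub, eval_mul, eval_pow, eval_C, eval_X, Complex.div_re,
          Complex.normSq_apply, Complex.sub_re, Complex.sub_im, Complex.ofReal_re,
          Complex.ofReal_im, zero_sub, neg_mul_neg]
        rw [← Complex.normSq_eq_norm_sq, Complex.normSq_apply, ← add_div]
        congr 1
        · field_simp; ring
        · ring
  obtain ⟨r₁, rfl⟩ := hdr
  have hd : d ≠ 0 := hdm.ne_zero
  have hr₁ : r₁ ≠ 0 := right_ne_zero_of_mul hr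
  have hdegr : (d * r₁).natDegree = d.natDegree + r₁.natDegree := natDegree_mul hd hr₁
  -- division with remainder by the factor
  set p₁ := p /ₘ d with hp₁
  set a := p %ₘ d with ha
  have hpa : p = a + d * p₁ := (modByMonic_add_div p d).symm
  have hadeg : a.degree < d.degree := degree_modByMonic_lt p hdm
  have hp₁deg : p₁.degree < r₁.degree := by
    by_cases h0 : p₁ = 0
    · rw [h0, degree_zero]; exact bot_lt_iff_ne_bot.2 (degree_ne_bot.2 hr₁)
    have hpne : p ≠ 0 := by
      intro hp0
      apply h0
      rw [hp₁, hp0, zero_divByMonic]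
    have h1 := natDegree_divByMonic p hdm
    have h2 := natDegree_lt_natDegree hpne hp
    rw [degree_eq_natDegree h0, degree_eq_natDegree hr₁]
    have h3 : d.natDegree ≤ p.natDegree := by
      by_contra! hlt
      exact h0 ((divByMonic_eq_zero_iff hdm).2 (degree_lt_degree hlt))
    rw [← hp₁] at h1
    norm_cast
    omega
  have hr₁' : algebraMap ℝ[X] (RatFunc ℝ) r₁ ≠ 0 := RatFunc.algebraMap_ne_zero hr₁
  have hd' : algebraMap ℝ[X] (RatFunc ℝ) d ≠ 0 := RatFunc.algebraMap_ne_zero hd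
  obtain ⟨κ₁, h₁⟩ := ih r₁.natDegree (by omega) r₁ rfl p₁ hp₁deg
  obtain ⟨κ₂, h₂⟩ := hbase a hadeg
  have hsplit : algebraMap ℝ[X] (RatFunc ℝ) p / algebraMap _ (RatFunc ℝ) (d * r₁)
      = algebraMap _ (RatFunc ℝ) p₁ / algebraMap _ (RatFunc ℝ) r₁
        + algebraMap _ (RatFunc ℝ) a / algebraMap _ (RatFunc ℝ) d
          * (algebraMap ℝ[X] (RatFunc ℝ) 1 / algebraMap _ (RatFunc ℝ) r₁) := by
    rw [hpa, map_add, map_mul, map_mul, map_one]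
    field_simp
    ring
  rw [hsplit]
  by_cases hc : r₁.degree ≤ 0
  · have hC : algebraMap ℝ[X] (RatFunc ℝ) 1 / algebraMap _ (RatFunc ℝ) r₁
        = RatFunc.C (r₁.coeff 0)⁻¹ := by
      rw [eq_C_of_degree_le_zero hc, map_one, one_div, map_inv₀, coeff_C_zero]
      rfl
    rw [hC, mul_comm (_ / _) (RatFunc.C _)]
    exact ⟨_, h₁.add (h₂.const_mul _)⟩
  · push Not at hc
    obtain ⟨κ₃, h₃⟩ := ih r₁.natDegree (by omega) r₁ rfl 1 (by rwa [degree_one])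
    exact ⟨_, h₁.add (h₂.mul h₃)⟩

theorem exists_isKernel {g : RatFunc ℝ} (hg : HasLim g 0) : ∃ κ, IsKernel g κ := by
  have hdeg : g.num.degree < g.denom.degree :=
    (Polynomial.div_tendsto_atTop_zero_iff_degree_lt _ _ g.denom_ne_zero).1 hg
  obtain ⟨κ, h⟩ := exists_isKernel_of_degree_lt _ _ hdeg
  rw [RatFunc.num_div_denom] at h
  exact ⟨κ, h⟩

/-! ### Proper rational functions as causal operators -/

/-- The limit of a rational function at infinity (a junk value if there is none). -/
noncomputable def gain (g : RatFunc ℝ) : ℝ := limUnder atTop (ev g)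

theorem HasLim.gain_eq {g : RatFunc ℝ} {c : ℝ} (hg : HasLim g c) : gain g = c := hg.limUnder_eq

theorem HasFiniteLim.hasLim_gain {g : RatFunc ℝ} (hg : HasFiniteLim g) : HasLim g (gain g) := by
  obtain ⟨c, hc⟩ := hg
  rwa [hc.gain_eq]

open Classical in
/-- The impulse response of the strictly proper part `g - g(∞)` of a rational function with a
finite limit at infinity. -/
noncomputable def kernel (g : RatFunc ℝ) : ℝ → ℝ :=
  if h : ∃ κ, IsKernel (g - RatFunc.C (gain g)) κ then h.choose else 0

theorem HasFiniteLim.isKernel {g : RatFunc ℝ} (hg : HasFiniteLim g) :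
    IsKernel (g - RatFunc.C (gain g)) (kernel g) := by
  have h : ∃ κ, IsKernel (g - RatFunc.C (gain g)) κ := by
    refine exists_isKernel ?_
    simpa using hg.hasLim_gain.sub (HasLim.const (gain g))
  rw [kernel, dif_pos h]
  exact h.choose_spec

/-- The causal operator on signals given by multiplying the transform by `g`: the direct gain
`g(∞)` plus convolution with the impulse response of `g - g(∞)`. -/
noncomputable def act (g : RatFunc ℝ) (f : ℝ → ℝ) (t : ℝ) : ℝ :=
  gain g * f t + conv (kernel g) f t

theorem LaplaceTransformable.act {g : RatFunc ℝ} (hg : HasFiniteLim g) {f : ℝ → ℝ}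
    (hf : LaplaceTransformable f) : LaplaceTransformable (act g f) :=
  (hf.const_mul _).add (hg.isKernel.transformable.conv hf)

theorem laplaceTransform_act {g : RatFunc ℝ} (hg : HasFiniteLim g) {f : ℝ → ℝ}
    (hf : LaplaceTransformable f) :
    ∀ᶠ s in atTop, laplaceTransform (act g f) s = ev g s * laplaceTransform f s := by
  have hk := hg.isKernel
  filter_upwards [laplaceTransform_add (hf.const_mul (gain g)) (hk.transformable.conv hf),
    laplaceTransform_conv hk.transformable hf, hk.eventually_eq,
    ev_sub g (RatFunc.C (gain g))] with s h1 h2 h3 h4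
  have h5 : laplaceTransform (act g f) s
    = laplaceTransform (fun t => gain g * f t + conv (kernel g) f t) s := rfl
  rw [h5, h1, h2, ← h3, h4, laplaceTransform_const_mul, ev_C]
  ring

theorem act_congr {g : RatFunc ℝ} {f f' : ℝ → ℝ} {T : ℝ} (h : EqOn f f' (Icc 0 T)) :
    EqOn (act g f) (act g f') (Icc 0 T) := by
  intro t ht
  simp only [act, conv]
  rw [h ht]
  congr 1
  refine intervalIntegral.integral_congr fun τ hτ => ?_
  rw [uIcc_of_le ht.1] at hτ
  rw [h ⟨hτ.1, hτ.2.trans ht.2⟩]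

theorem conv_eq_zero_of_ae {κ f : ℝ → ℝ} {t : ℝ} (ht : 0 ≤ t)
    (h : ∀ᵐ τ ∂volume.restrict (Ioc 0 t), f τ = 0) : conv κ f t = 0 := by
  rw [conv, intervalIntegral.integral_of_le ht]
  refine integral_eq_zero_of_ae ?_
  filter_upwards [h] with τ hτ
  simp [hτ]

theorem act_ae_eq_zero {g : RatFunc ℝ} {f : ℝ → ℝ} {T : ℝ}
    (h : ∀ᵐ τ ∂volume.restrict (Ioc 0 T), f τ = 0) :
    ∀ᵐ τ ∂volume.restrict (Ioc 0 T), act g f τ = 0 := by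
  filter_upwards [h, ae_restrict_mem measurableSet_Ioc] with t ht hmem
  rw [act, ht, conv_eq_zero_of_ae hmem.1.le, mul_zero, add_zero]
  exact ae_restrict_of_ae_restrict_of_subset (Ioc_subset_Ioc_right hmem.2) h

theorem continuousOn_act {g : RatFunc ℝ} (hg : HasFiniteLim g) {f : ℝ → ℝ} {T : ℝ} (hT : 0 ≤ T)
    (hf : ContinuousOn f (Icc 0 T)) : ContinuousOn (act g f) (Icc 0 T) := by
  refine (continuousOn_const.mul hf).add (continuousOn_conv hg.isKernel.continuous hT ?_)
  exact hf.intervalIntegrable_of_Icc hT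

/-- A strictly proper rational function turns an integrable signal into a continuous one. -/
theorem continuousOn_act_of_hasLim_zero {g : RatFunc ℝ} (hg : HasLim g 0) {f : ℝ → ℝ} {T : ℝ}
    (hT : 0 ≤ T) (hf : IntervalIntegrable f volume 0 T) :
    ContinuousOn (act g f) (Icc 0 T) := by
  have h : act g f = conv (kernel g) f := by
    ext t
    simp [act, hg.gain_eq]
  rw [h]
  exact continuousOn_conv (HasFiniteLim.isKernel ⟨0, hg⟩).continuous hT hf

theorem act_apply_zero (g : RatFunc ℝ) (f : ℝ → ℝ) : act g f 0 = gain g * f 0 := by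
  simp [act, conv]

/-! ### Transforms of signals on `[0, T]` -/

/-- `F` agrees for large `s` with the transform of an extension of the scalar signal `f` given on
`[0, T]`; the scalar form of `IsTransformOn`, with the equality of functions replaced by equality
near infinity. -/
def TransOn (T : ℝ) (f F : ℝ → ℝ) : Prop :=
  ∃ g, LaplaceTransformable g ∧ EqOn g f (Icc 0 T) ∧ F =ᶠ[atTop] laplaceTransform g

/-- `F` is a rational multiple of the transform of a signal that vanishes on `[0, T]`. Such
functions are negligible: by causality they carry no information on `[0, T]`. The rational factor
makes the class stable under multiplication by rational functions, proper or not. -/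
def Negl (T : ℝ) (F : ℝ → ℝ) : Prop :=
  ∃ (g : RatFunc ℝ) (f : ℝ → ℝ), LaplaceTransformable f ∧
    (∀ᵐ t ∂volume.restrict (Ioc 0 T), f t = 0) ∧ F =ᶠ[atTop] fun s => ev g s * laplaceTransform f s

variable {T : ℝ}

theorem hasFiniteLim_X_inv_pow (n : ℕ) : HasFiniteLim ((RatFunc.X : RatFunc ℝ)⁻¹ ^ n) := by
  induction n with
  | zero => exact ⟨1, by simpa using HasLim.const 1⟩
  | succ n ih =>
    obtain ⟨c, hc⟩ := ih
    exact ⟨_, by simpa [pow_succ] using hc.mul HasLim.X_inv⟩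

theorem HasFiniteLim.mul {g h : RatFunc ℝ} (hg : HasFiniteLim g) (hh : HasFiniteLim h) :
    HasFiniteLim (g * h) := by
  obtain ⟨c, hc⟩ := hg
  obtain ⟨d, hd⟩ := hh
  exact ⟨_, hc.mul hd⟩

theorem Negl.congr {F F' : ℝ → ℝ} (h : Negl T F) (hF : F =ᶠ[atTop] F') : Negl T F' := by
  obtain ⟨g, f, hf, h0, h1⟩ := h
  exact ⟨g, f, hf, h0, hF.symm.trans h1⟩

theorem negl_zero : Negl T (fun _ => 0) :=
  ⟨0, fun _ => 0, isKernel_zero.transformable, Eventually.of_forall fun _ => rfl, by simp [ev]⟩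

theorem Negl.mul {F : ℝ → ℝ} (h : Negl T F) (g : RatFunc ℝ) : Negl T (fun s => ev g s * F s) := by
  obtain ⟨g', f, hf, h0, h1⟩ := h
  refine ⟨g * g', f, hf, h0, ?_⟩
  filter_upwards [h1, ev_mul g g'] with s h1 h2
  rw [h1, h2, mul_assoc]

/-- The rational factor of a negligible function may be taken to be `s ^ n`, `n` large. -/
theorem Negl.exists_pow {F : ℝ → ℝ} (h : Negl T F) : ∃ n : ℕ, ∀ m, n ≤ m → ∃ f,
    LaplaceTransformable f ∧ (∀ᵐ t ∂volume.restrict (Ioc 0 T), f t = 0) ∧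
    (fun s => ev ((RatFunc.X : RatFunc ℝ)⁻¹ ^ m) s * F s) =ᶠ[atTop] laplaceTransform f := by
  obtain ⟨g, f, hf, h0, h1⟩ := h
  obtain ⟨n, hn⟩ := exists_X_inv_pow_mul g
  refine ⟨n, fun m hm => ?_⟩
  have hm' : HasFiniteLim ((RatFunc.X : RatFunc ℝ)⁻¹ ^ m * g) := by
    obtain ⟨k, rfl⟩ := Nat.exists_eq_add_of_le hm
    rw [pow_add, mul_assoc, mul_left_comm]
    exact (hasFiniteLim_X_inv_pow k).mul hn
  refine ⟨_, hf.act hm', act_ae_eq_zero h0, ?_⟩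
  filter_upwards [h1, ev_mul ((RatFunc.X : RatFunc ℝ)⁻¹ ^ m) g, laplaceTransform_act hm' hf]
    with s h1 h2 h3
  rw [h1, h3, h2, mul_assoc]

theorem Negl.add {F F' : ℝ → ℝ} (h : Negl T F) (h' : Negl T F') :
    Negl T (fun s => F s + F' s) := by
  obtain ⟨n, hn⟩ := h.exists_pow
  obtain ⟨n', hn'⟩ := h'.exists_pow
  obtain ⟨f, hf, h0, h1⟩ := hn (max n n') (le_max_left _ _)
  obtain ⟨f', hf', h0', h1'⟩ := hn' (max n n') (le_max_right _ _)
  refine ⟨((RatFunc.X : RatFunc ℝ)⁻¹ ^ max n n')⁻¹, _, hf.add hf', ?_, ?_⟩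
  · filter_upwards [h0, h0'] with t h h'
    rw [h, h', add_zero]
  · filter_upwards [h1, h1', laplaceTransform_add hf hf', ev_inv ((RatFunc.X : RatFunc ℝ)⁻¹ ^ max n n'),
      ev_ne_zero (pow_ne_zero (max n n') (inv_ne_zero (RatFunc.X_ne_zero (K := ℝ))))] with
      s h1 h1' h2 h3 h4
    rw [h2, ← h1, ← h1', h3, ← mul_add, inv_mul_cancel_left₀ h4]

theorem Negl.neg {F : ℝ → ℝ} (h : Negl T F) : Negl T (fun s => -F s) := by
  refine (h.mul (RatFunc.C (-1))).congr (Eventually.of_forall fun s => ?_)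
  simp only [ev_C]
  ring

theorem Negl.sum {α : Type*} {S : Finset α} {F : α → ℝ → ℝ} (h : ∀ a ∈ S, Negl T (F a)) :
    Negl T (fun s => ∑ a ∈ S, F a s) := by
  classical
  induction S using Finset.induction_on with
  | empty => simpa using negl_zero
  | insert a S ha ih =>
    simp only [Finset.sum_insert ha]
    exact (h a (Finset.mem_insert_self a S)).add
      (ih fun b hb => h b (Finset.mem_insert_of_mem hb))

theorem isKernel_X_inv : IsKernel (RatFunc.X : RatFunc ℝ)⁻¹ (fun _ => 1) := by
  have h := isKernel_re_exp (g := (RatFunc.X : RatFunc ℝ)⁻¹) 1 0 (by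
    filter_upwards [ev_X_inv_eventually] with s hs
    rw [hs, sub_zero, one_div, ← Complex.ofReal_inv, Complex.ofReal_re])
  simpa using h

theorem act_X_inv {f : ℝ → ℝ} {t : ℝ} (ht : 0 ≤ t) :
    act (RatFunc.X : RatFunc ℝ)⁻¹ f t = ∫ τ in (0 : ℝ)..t, f τ := by
  have hk := HasFiniteLim.isKernel ⟨0, HasLim.X_inv⟩
  have hg : gain (RatFunc.X : RatFunc ℝ)⁻¹ = 0 := HasLim.X_inv.gain_eq
  rw [hg, map_zero, sub_zero] at hk
  have hae := ae_eq_of_laplaceTransform_eq hk.transformable isKernel_X_inv.transformable (by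
    filter_upwards [hk.eventually_eq, isKernel_X_inv.eventually_eq] with s h1 h2
    rw [← h1, ← h2])
  have heq : EqOn (kernel (RatFunc.X : RatFunc ℝ)⁻¹) (fun _ => 1) (Ioi 0) :=
    Measure.eqOn_open_of_ae_eq hae isOpen_Ioi hk.continuous.continuousOn continuousOn_const
  rw [act, hg, zero_mul, zero_add, conv, intervalIntegral.integral_of_le ht,
    intervalIntegral.integral_of_le ht, integral_Ioc_eq_integral_Ioo,
    integral_Ioc_eq_integral_Ioo]
  refine setIntegral_congr_fun measurableSet_Ioo fun τ hτ => ?_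
  rw [heq (sub_pos.2 hτ.2), one_mul]

/-- Integration is injective on signals on `[0, T]`. -/
theorem ae_eq_zero_of_act_X_inv {f : ℝ → ℝ} (hT : 0 ≤ T) (hf : LaplaceTransformable f)
    (h : ∀ᵐ t ∂volume.restrict (Ioc 0 T), act (RatFunc.X : RatFunc ℝ)⁻¹ f t = 0) :
    ∀ᵐ t ∂volume.restrict (Ioc 0 T), f t = 0 := by
  rcases hT.eq_or_lt with rfl | hT
  · simp
  have hX : HasFiniteLim (RatFunc.X : RatFunc ℝ)⁻¹ := ⟨0, HasLim.X_inv⟩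
  have hint := hf.intervalIntegrable le_rfl hT.le
  have hcont := continuousOn_act_of_hasLim_zero HasLim.X_inv hT.le hint
  have hzero : EqOn (act (RatFunc.X : RatFunc ℝ)⁻¹ f) (fun _ => 0) (Icc 0 T) := by
    refine Measure.eqOn_of_ae_eq (μ := volume) ?_ hcont continuousOn_const ?_
    · rw [← restrict_Ioc_eq_restrict_Icc]
      exact h
    · rw [interior_Icc, closure_Ioo hT.ne]
  -- cutting `f` off after `T` gives a function whose primitive vanishes on the whole half-line
  set f₁ : ℝ → ℝ := (Ioc 0 T).indicator f with hf₁
  rw [intervalIntegrable_iff_integrableOn_Ioc_of_le hT.le] at hint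
  have hf₁t : LaplaceTransformable f₁ := laplaceTransformable_of_integrableOn
    ((integrable_indicator_iff measurableSet_Ioc).2 hint).integrableOn
  have hprim : ∀ t ∈ Ioi (0 : ℝ), act (RatFunc.X : RatFunc ℝ)⁻¹ f₁ t = 0 := by
    intro t ht
    have hm : min t T ∈ Icc 0 T := ⟨le_min (le_of_lt ht) hT.le, min_le_right _ _⟩
    have h0 := hzero hm
    simp only at h0
    rw [act_X_inv hm.1, intervalIntegral.integral_of_le hm.1] at h0
    rw [act_X_inv (le_of_lt ht), intervalIntegral.integral_of_le (le_of_lt ht),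
      setIntegral_indicator measurableSet_Ioc, Ioc_inter_Ioc, max_self]
    exact h0
  have hLT : ∀ᶠ s in atTop, laplaceTransform f₁ s = 0 := by
    have h0 : laplaceTransform (act (RatFunc.X : RatFunc ℝ)⁻¹ f₁)
        = laplaceTransform (fun _ => 0) := by
      refine laplaceTransform_congr_ae ?_
      filter_upwards [ae_restrict_mem measurableSet_Ioi] with t ht using hprim t ht
    filter_upwards [laplaceTransform_act hX hf₁t,
      ev_ne_zero (inv_ne_zero (RatFunc.X_ne_zero (K := ℝ)))] with s h1 h2
    rw [h0] at h1
    simp only [laplaceTransform, mul_zero, integral_zero] at h1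
    exact (mul_eq_zero.1 h1.symm).resolve_left h2
  have := ae_eq_zero_of_laplaceTransform hf₁t hLT
  have hsub : volume.restrict (Ioc 0 T) ≤ volume.restrict (Ioi 0) :=
    Measure.restrict_mono Ioc_subset_Ioi_self le_rfl
  filter_upwards [ae_mono hsub this, ae_restrict_mem measurableSet_Ioc] with t h1 h2
  rwa [hf₁, indicator_of_mem h2] at h1

theorem ae_eq_zero_of_act_X_inv_pow {f : ℝ → ℝ} (hT : 0 ≤ T) (n : ℕ) (hf : LaplaceTransformable f)
    (h : ∀ᵐ t ∂volume.restrict (Ioc 0 T), act ((RatFunc.X : RatFunc ℝ)⁻¹ ^ n) f t = 0) :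
    ∀ᵐ t ∂volume.restrict (Ioc 0 T), f t = 0 := by
  have hsub : volume.restrict (Ioc 0 T) ≤ volume.restrict (Ioi 0) :=
    Measure.restrict_mono Ioc_subset_Ioi_self le_rfl
  induction n generalizing f with
  | zero =>
    have hl := laplaceTransform_act (hasFiniteLim_X_inv_pow 0) hf
    have := ae_eq_of_laplaceTransform_eq (hf.act (hasFiniteLim_X_inv_pow 0)) hf
      (by filter_upwards [hl] with s hs; rw [hs]; simp [ev])
    filter_upwards [h, ae_mono hsub this] with t h1 h2
    rw [← h2, h1]
  | succ n ih =>
    have hX : HasFiniteLim (RatFunc.X : RatFunc ℝ)⁻¹ := ⟨0, HasLim.X_inv⟩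
    refine ae_eq_zero_of_act_X_inv hT hf (ih (hf.act hX) ?_)
    have := ae_eq_of_laplaceTransform_eq (hf.act (hasFiniteLim_X_inv_pow (n + 1)))
      ((hf.act hX).act (hasFiniteLim_X_inv_pow n)) (by
        filter_upwards [laplaceTransform_act (hasFiniteLim_X_inv_pow (n + 1)) hf,
          laplaceTransform_act hX hf, laplaceTransform_act (hasFiniteLim_X_inv_pow n) (hf.act hX),
          ev_mul ((RatFunc.X : RatFunc ℝ)⁻¹ ^ n) (RatFunc.X : RatFunc ℝ)⁻¹] with s h1 h2 h3 h4
        rw [h1, h3, h2, pow_succ, h4, mul_assoc])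
    filter_upwards [h, ae_mono hsub this] with t h1 h2
    rw [← h2, h1]

/-- A negligible transform belongs to a signal that vanishes on `[0, T]`. -/
theorem Negl.ae_eq_zero {F f : ℝ → ℝ} (hT : 0 ≤ T) (h : Negl T F) (hf : LaplaceTransformable f)
    (hF : F =ᶠ[atTop] laplaceTransform f) : ∀ᵐ t ∂volume.restrict (Ioc 0 T), f t = 0 := by
  obtain ⟨n, hn⟩ := h.exists_pow
  obtain ⟨f', hf', h0, h1⟩ := hn n le_rfl
  refine ae_eq_zero_of_act_X_inv_pow hT n hf ?_
  have hsub : volume.restrict (Ioc 0 T) ≤ volume.restrict (Ioi 0) :=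
    Measure.restrict_mono Ioc_subset_Ioi_self le_rfl
  have := ae_eq_of_laplaceTransform_eq (hf.act (hasFiniteLim_X_inv_pow n)) hf' (by
    filter_upwards [h1, hF, laplaceTransform_act (hasFiniteLim_X_inv_pow n) hf] with s h1 h2 h3
    rw [h3, ← h1, h2])
  filter_upwards [h0, ae_mono hsub this] with t h1 h2
  rw [h2, h1]

theorem TransOn.congr {f F F' : ℝ → ℝ} (h : TransOn T f F) (hF : F =ᶠ[atTop] F') :
    TransOn T f F' := by
  obtain ⟨g, h1, h2, h3⟩ := h
  exact ⟨g, h1, h2, hF.symm.trans h3⟩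

theorem TransOn.congr_eqOn {f f' F : ℝ → ℝ} (h : TransOn T f F) (hf : EqOn f f' (Icc 0 T)) :
    TransOn T f' F := by
  obtain ⟨g, h1, h2, h3⟩ := h
  exact ⟨g, h1, h2.trans hf, h3⟩

theorem TransOn.add {f f' F F' : ℝ → ℝ} (h : TransOn T f F) (h' : TransOn T f' F') :
    TransOn T (fun t => f t + f' t) (fun s => F s + F' s) := by
  obtain ⟨g, h1, h2, h3⟩ := h
  obtain ⟨g', h1', h2', h3'⟩ := h'
  refine ⟨_, h1.add h1', fun t ht => by simp only [h2 ht, h2' ht], ?_⟩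
  filter_upwards [h3, h3', laplaceTransform_add h1 h1'] with s a b c
  rw [a, b, c]

theorem TransOn.const_mul {f F : ℝ → ℝ} (h : TransOn T f F) (c : ℝ) :
    TransOn T (fun t => c * f t) (fun s => c * F s) := by
  obtain ⟨g, h1, h2, h3⟩ := h
  refine ⟨_, h1.const_mul c, fun t ht => by simp only [h2 ht], ?_⟩
  filter_upwards [h3] with s a
  rw [a, laplaceTransform_const_mul]

theorem TransOn.sub {f f' F F' : ℝ → ℝ} (h : TransOn T f F) (h' : TransOn T f' F') :
    TransOn T (fun t => f t - f' t) (fun s => F s - F' s) := by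
  simpa [sub_eq_add_neg] using h.add (h'.const_mul (-1))

theorem transOn_zero : TransOn T (fun _ => 0) (fun _ => 0) :=
  ⟨fun _ => 0, isKernel_zero.transformable, fun _ _ => rfl, by
    filter_upwards with s; simp [laplaceTransform]⟩

theorem TransOn.sum {α : Type*} {S : Finset α} {f F : α → ℝ → ℝ}
    (h : ∀ a ∈ S, TransOn T (f a) (F a)) :
    TransOn T (fun t => ∑ a ∈ S, f a t) (fun s => ∑ a ∈ S, F a s) := by
  classical
  induction S using Finset.induction_on with
  | empty => simpa using transOn_zero
  | insert a S ha ih =>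
    simp only [Finset.sum_insert ha]
    exact (h a (Finset.mem_insert_self a S)).add
      (ih fun b hb => h b (Finset.mem_insert_of_mem hb))

theorem TransOn.act {f F : ℝ → ℝ} (h : TransOn T f F) {g : RatFunc ℝ} (hg : HasFiniteLim g) :
    TransOn T (act g f) (fun s => ev g s * F s) := by
  obtain ⟨k, h1, h2, h3⟩ := h
  refine ⟨_, h1.act hg, act_congr h2, ?_⟩
  filter_upwards [h3, laplaceTransform_act hg h1] with s a b
  rw [a, b]

theorem TransOn.negl_sub {f F F' : ℝ → ℝ} (h : TransOn T f F) (h' : TransOn T f F') :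
    Negl T (fun s => F s - F' s) := by
  obtain ⟨g, h1, h2, h3⟩ := h.sub h'
  refine ⟨1, g, h1, ?_, ?_⟩
  · filter_upwards [ae_restrict_mem measurableSet_Ioc] with t ht
    simpa using h2 (Ioc_subset_Icc_self ht)
  · filter_upwards [h3] with s hs
    simp [hs, ev]

theorem TransOn.intervalIntegrable {f F : ℝ → ℝ} (hT : 0 ≤ T) (h : TransOn T f F) :
    IntervalIntegrable f volume 0 T := by
  obtain ⟨g, h1, h2, -⟩ := h
  refine (h1.intervalIntegrable le_rfl hT).congr ?_
  rw [uIoc_of_le hT]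
  exact (h2.mono Ioc_subset_Icc_self)

/-- Replacing a transform by a congruent transform. -/
theorem TransOn.of_negl {f f' F F' : ℝ → ℝ} (hT : 0 ≤ T) (h : TransOn T f F)
    (h' : TransOn T f' F') (hN : Negl T (fun s => F s - F' s)) : TransOn T f F' := by
  obtain ⟨g, h1, h2, h3⟩ := h
  obtain ⟨g', h1', -, h3'⟩ := h'
  have hae := hN.ae_eq_zero hT (h1.add (h1'.const_mul (-1))) (by
    filter_upwards [h3, h3', laplaceTransform_add h1 (h1'.const_mul (-1))] with s a b c
    rw [a, b, c, laplaceTransform_const_mul]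
    ring)
  classical
  -- the new extension: `f` on `[0, T]`, and the given function after `T`
  have hmod : g' =ᵐ[volume.restrict (Ioi 0)] (Icc 0 T).piecewise f g' := by
    rw [ae_restrict_iff' measurableSet_Ioc] at hae
    rw [EventuallyEq, ae_restrict_iff' measurableSet_Ioi]
    filter_upwards [hae] with t ht ht0
    by_cases hm : t ∈ Icc 0 T
    · rw [piecewise_eq_of_mem _ _ _ hm, ← h2 hm]
      have := ht ⟨ht0, hm.2⟩
      linarith
    · rw [piecewise_eq_of_notMem _ _ _ hm]
  refine ⟨_, h1'.congr_ae hmod, fun t ht => piecewise_eq_of_mem _ _ _ ht, ?_⟩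
  rw [← laplaceTransform_congr_ae hmod]
  exact h3'

/-- Continuous signals with congruent transforms are equal on `[0, T]`. -/
theorem TransOn.eqOn {f f' F F' : ℝ → ℝ} (hT : 0 < T) (h : TransOn T f F)
    (h' : TransOn T f' F') (hN : Negl T (fun s => F s - F' s)) (hf : ContinuousOn f (Icc 0 T))
    (hf' : ContinuousOn f' (Icc 0 T)) : EqOn f f' (Icc 0 T) := by
  obtain ⟨g, h1, h2, h3⟩ := h.sub h'
  have hae := hN.ae_eq_zero hT.le h1 h3
  have hae' : f =ᵐ[volume.restrict (Icc 0 T)] f' := by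
    rw [← restrict_Ioc_eq_restrict_Icc]
    filter_upwards [hae, ae_restrict_mem measurableSet_Ioc] with t a b
    rw [h2 (Ioc_subset_Icc_self b)] at a
    linarith
  refine Measure.eqOn_of_ae_eq hae' hf hf' ?_
  rw [interior_Icc, closure_Ioo hT.ne]

theorem exists_transOn {f : ℝ → ℝ} (hf : ContinuousOn f (Icc 0 T)) :
    TransOn T f (laplaceTransform ((Icc 0 T).indicator f)) := by
  refine ⟨(Icc 0 T).indicator f, laplaceTransformable_of_integrableOn ?_,
    fun t ht => indicator_of_mem ht f, EventuallyEq.rfl⟩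
  exact ((integrable_indicator_iff measurableSet_Icc).2
    (hf.integrableOn_compact isCompact_Icc)).integrableOn

theorem transOn_one : TransOn T (fun _ => 1) (fun s => s⁻¹) := by
  refine ⟨_, isKernel_X_inv.transformable, fun t _ => rfl, ?_⟩
  filter_upwards [isKernel_X_inv.eventually_eq, ev_X_inv_eventually] with s h1 h2
  rw [← h1, h2]

variable {ι κ μ : Type*}

/-! ### Vector signals and rational matrices -/

/-- The vector form of `TransOn`. -/
def VecTransOn (T : ℝ) (f F : ℝ → ι → ℝ) : Prop :=
  ∀ i, TransOn T (fun t => f t i) (fun s => F s i)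

/-- `F` and `F'` differ by a negligible function; for transforms of signals this means that the
signals agree almost everywhere on `[0, T]`. -/
def Cong (T : ℝ) (F F' : ℝ → ι → ℝ) : Prop := ∀ i, Negl T (fun s => F s i - F' s i)

/-- The causal operator on vector signals given by a matrix of rational functions with finite
limits at infinity. -/
noncomputable def actVec [Fintype κ] (R : Matrix ι κ (RatFunc ℝ)) (f : ℝ → κ → ℝ) (t : ℝ) : ι → ℝ :=
  fun i => ∑ j, act (R i j) (fun τ => f τ j) t

theorem HasLimitAtInfinity.hasLim {R : Matrix ι κ (RatFunc ℝ)} {K : Matrix ι κ ℝ}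
    (h : HasLimitAtInfinity R K) (i : ι) (j : κ) : HasLim (R i j) (K i j) := h i j

theorem HasLimitAtInfinity.hasFiniteLim {R : Matrix ι κ (RatFunc ℝ)} {K : Matrix ι κ ℝ}
    (h : HasLimitAtInfinity R K) (i : ι) (j : κ) : HasFiniteLim (R i j) := ⟨_, h i j⟩

theorem Cong.symm {F F' : ℝ → ι → ℝ} (h : Cong T F F') : Cong T F' F := fun i =>
  (h i).neg.congr (Eventually.of_forall fun s => by simp)

theorem Cong.trans {F F' F'' : ℝ → ι → ℝ} (h : Cong T F F') (h' : Cong T F' F'') :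
    Cong T F F'' := fun i =>
  ((h i).add (h' i)).congr (Eventually.of_forall fun s => by simp)

theorem Cong.of_eventuallyEq {F F' : ℝ → ι → ℝ} (h : F =ᶠ[atTop] F') : Cong T F F' := fun i =>
  negl_zero.congr (by filter_upwards [h] with s hs; simp [hs])

theorem Cong.refl (F : ℝ → ι → ℝ) : Cong T F F := Cong.of_eventuallyEq EventuallyEq.rfl

theorem Cong.add {F F' G G' : ℝ → ι → ℝ} (h : Cong T F F') (h' : Cong T G G') :
    Cong T (fun s => F s + G s) (fun s => F' s + G' s) := fun i =>
  ((h i).add (h' i)).congr (Eventually.of_forall fun s => by simp; ring)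

theorem Cong.sub {F F' G G' : ℝ → ι → ℝ} (h : Cong T F F') (h' : Cong T G G') :
    Cong T (fun s => F s - G s) (fun s => F' s - G' s) := fun i =>
  ((h i).add (h' i).neg).congr (Eventually.of_forall fun s => by simp; ring)

theorem Cong.mulVec [Fintype κ] {F F' : ℝ → κ → ℝ} (h : Cong T F F')
    (R : Matrix ι κ (RatFunc ℝ)) :
    Cong T (fun s => evalAt R s *ᵥ F s) (fun s => evalAt R s *ᵥ F' s) := fun i => by
  refine (Negl.sum (S := Finset.univ) fun j _ => (h j).mul (R i j)).congr
    (Eventually.of_forall fun s => ?_)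
  simp only [Matrix.mulVec, dotProduct, evalAt_apply, ← Finset.sum_sub_distrib, mul_sub]

theorem VecTransOn.congr {f F F' : ℝ → ι → ℝ} (h : VecTransOn T f F) (hF : F =ᶠ[atTop] F') :
    VecTransOn T f F' := fun i =>
  (h i).congr (by filter_upwards [hF] with s hs; rw [hs])

theorem VecTransOn.congr_eqOn {f f' F : ℝ → ι → ℝ} (h : VecTransOn T f F)
    (hf : EqOn f f' (Icc 0 T)) : VecTransOn T f' F := fun i =>
  (h i).congr_eqOn fun t ht => by simp only [hf ht]

theorem VecTransOn.add {f f' F F' : ℝ → ι → ℝ} (h : VecTransOn T f F) (h' : VecTransOn T f' F') :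
    VecTransOn T (fun t => f t + f' t) (fun s => F s + F' s) := fun i => (h i).add (h' i)

theorem VecTransOn.sub {f f' F F' : ℝ → ι → ℝ} (h : VecTransOn T f F) (h' : VecTransOn T f' F') :
    VecTransOn T (fun t => f t - f' t) (fun s => F s - F' s) := fun i => (h i).sub (h' i)

theorem VecTransOn.mulVec [Fintype κ] {f F : ℝ → κ → ℝ} (h : VecTransOn T f F)
    {R : Matrix ι κ (RatFunc ℝ)} {K : Matrix ι κ ℝ} (hR : HasLimitAtInfinity R K) :
    VecTransOn T (actVec R f) (fun s => evalAt R s *ᵥ F s) := fun i =>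
  TransOn.sum (S := Finset.univ) fun j _ => (h j).act (hR.hasFiniteLim i j)

theorem VecTransOn.cong {f F F' : ℝ → ι → ℝ} (h : VecTransOn T f F) (h' : VecTransOn T f F') :
    Cong T F F' := fun i => (h i).negl_sub (h' i)

theorem VecTransOn.of_cong {f f' F F' : ℝ → ι → ℝ} (hT : 0 ≤ T) (h : VecTransOn T f F)
    (h' : VecTransOn T f' F') (hN : Cong T F F') : VecTransOn T f F' := fun i =>
  (h i).of_negl hT (h' i) (hN i)

theorem VecTransOn.eqOn {f f' F F' : ℝ → ι → ℝ} (hT : 0 < T) (h : VecTransOn T f F)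
    (h' : VecTransOn T f' F') (hN : Cong T F F') (hf : ContinuousOn f (Icc 0 T))
    (hf' : ContinuousOn f' (Icc 0 T)) : EqOn f f' (Icc 0 T) := by
  intro t ht
  ext i
  exact (h i).eqOn hT (h' i) (hN i) (continuousOn_pi.1 hf i) (continuousOn_pi.1 hf' i) ht

theorem exists_vecTransOn {f : ℝ → ι → ℝ} (hf : ContinuousOn f (Icc 0 T)) :
    ∃ F, VecTransOn T f F :=
  ⟨fun s i => laplaceTransform ((Icc 0 T).indicator fun t => f t i) s,
    fun i => exists_transOn (continuousOn_pi.1 hf i)⟩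

theorem IsTransformOn.vecTransOn {f F : ℝ → ι → ℝ} (h : IsTransformOn T f F) :
    VecTransOn T f F := by
  obtain ⟨g, h1, h2, rfl⟩ := h
  exact fun i => ⟨fun t => g t i, h1 i, fun t ht => by simp only [h2 ht], EventuallyEq.rfl⟩

theorem VecTransOn.exists_isTransformOn [Finite ι] {f F : ℝ → ι → ℝ} (h : VecTransOn T f F) :
    ∃ F', IsTransformOn T f F' ∧ F =ᶠ[atTop] F' := by
  choose g h1 h2 h3 using h
  refine ⟨_, ⟨fun t i => g i t, h1, fun t ht => funext fun i => h2 i ht, rfl⟩, ?_⟩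
  filter_upwards [eventually_all.2 h3] with s hs
  exact funext hs

theorem evalAt_mul_mulVec [Finite ι] [Fintype κ] [Fintype μ] (A : Matrix ι κ (RatFunc ℝ))
    (B : Matrix κ μ (RatFunc ℝ)) (F : ℝ → μ → ℝ) :
    (fun s => evalAt (A * B) s *ᵥ F s) =ᶠ[atTop] fun s => evalAt A s *ᵥ (evalAt B s *ᵥ F s) := by
  filter_upwards [evalAt_mul A B] with s hs
  rw [hs, Matrix.mulVec_mulVec]

theorem continuousOn_actVec [Fintype κ] {R : Matrix ι κ (RatFunc ℝ)} {K : Matrix ι κ ℝ}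
    (hR : HasLimitAtInfinity R K) (hT : 0 ≤ T) {f : ℝ → κ → ℝ} (hf : ContinuousOn f (Icc 0 T)) :
    ContinuousOn (actVec R f) (Icc 0 T) :=
  continuousOn_pi.2 fun i => continuousOn_finsetSum _ fun j _ =>
    continuousOn_act (hR.hasFiniteLim i j) hT (continuousOn_pi.1 hf j)

theorem continuousOn_actVec_of_isStrictlyProper [Fintype κ] {R : Matrix ι κ (RatFunc ℝ)}
    (hR : IsStrictlyProper R) (hT : 0 ≤ T) {f F : ℝ → κ → ℝ} (hf : VecTransOn T f F) :
    ContinuousOn (actVec R f) (Icc 0 T) :=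
  continuousOn_pi.2 fun i => continuousOn_finsetSum _ fun j _ =>
    continuousOn_act_of_hasLim_zero (hR i j) hT ((hf j).intervalIntegrable hT)

theorem actVec_apply_zero [Fintype κ] {R : Matrix ι κ (RatFunc ℝ)} {K : Matrix ι κ ℝ}
    (hR : HasLimitAtInfinity R K) (f : ℝ → κ → ℝ) : actVec R f 0 = K *ᵥ f 0 := by
  ext i
  simp only [actVec, act_apply_zero, Matrix.mulVec, dotProduct, (hR.hasLim i _).gain_eq]

theorem actVec_congr [Fintype κ] {R : Matrix ι κ (RatFunc ℝ)} {f f' : ℝ → κ → ℝ}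
    (h : EqOn f f' (Icc 0 T)) : EqOn (actVec R f) (actVec R f') (Icc 0 T) := by
  intro t ht
  ext i
  exact Finset.sum_congr rfl fun j _ => act_congr (fun τ hτ => by simp only [h hτ]) ht

/-! ### Estimates -/

/-- In the exponentially weighted sup norm with weight `e^{-lt}`, a convolution has norm
`O(1 / l)`. -/
theorem exists_conv_bound {k : ℝ → ℝ} (hk : Continuous k) (T : ℝ) : ∃ C, 0 ≤ C ∧
    ∀ l > 0, ∀ (f : ℝ → ℝ) (B : ℝ), 0 ≤ B → (∀ t ∈ Ioc 0 T, |f t| ≤ B * Real.exp (l * t)) →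
      ∀ t ∈ Icc 0 T, |conv k f t| ≤ C / l * (B * Real.exp (l * t)) := by
  obtain ⟨C, hC⟩ := (isCompact_Icc (a := (0 : ℝ)) (b := T)).exists_bound_of_continuousOn
    hk.continuousOn
  refine ⟨max C 0, le_max_right _ _, fun l hl f B hB hf t ht => ?_⟩
  have h1 : |conv k f t| ≤ ∫ τ in (0 : ℝ)..t, max C 0 * (B * Real.exp (l * τ)) := by
    rw [← Real.norm_eq_abs]
    refine intervalIntegral.norm_integral_le_of_norm_le ht.1 ?_
      (by apply Continuous.intervalIntegrable; fun_prop)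
    refine Eventually.of_forall fun τ hτ => ?_
    rw [norm_mul]
    refine mul_le_mul ((hC _ ⟨by linarith [hτ.2], by linarith [hτ.1, ht.2]⟩).trans
      (le_max_left _ _)) (hf τ ⟨hτ.1, hτ.2.trans ht.2⟩) (norm_nonneg _) (le_max_right _ _)
  refine h1.trans ?_
  rw [intervalIntegral.integral_const_mul, intervalIntegral.integral_const_mul,
    intervalIntegral.integral_comp_mul_left (fun x => Real.exp x) hl.ne', integral_exp,
    mul_zero, Real.exp_zero, smul_eq_mul, div_mul_eq_mul_div, mul_div_assoc]
  refine mul_le_mul_of_nonneg_left ?_ (le_max_right _ _)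
  rw [mul_div_assoc, div_eq_inv_mul]
  gcongr
  linarith

/-- An operator whose direct gain has row sums at most `1 / 2` is a contraction in a sufficiently
strong exponentially weighted sup norm. -/
theorem exists_weighted_contraction [Finite ι] [Fintype κ] {R : Matrix ι κ (RatFunc ℝ)}
    {K : Matrix ι κ ℝ} (hR : HasLimitAtInfinity R K) (hK : ∀ i, ∑ j, |K i j| ≤ 1 / 2) (T : ℝ) :
    ∃ l > 0, ∀ (f : ℝ → κ → ℝ) (B : ℝ), 0 ≤ B →
      (∀ t ∈ Icc 0 T, ∀ i, |f t i| ≤ B * Real.exp (l * t)) →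
      ∀ t ∈ Icc 0 T, ∀ i, |actVec R f t i| ≤ 3 / 4 * (B * Real.exp (l * t)) := by
  have hC := fun i j => exists_conv_bound (hR.hasFiniteLim i j).isKernel.continuous T
  choose C hC0 hC using hC
  have hl : ∀ᶠ l in atTop, ∀ i, (∑ j, C i j) / l ≤ 1 / 4 := by
    refine eventually_all.2 fun i => ?_
    exact (tendsto_const_nhds.div_atTop tendsto_id).eventually_le_const (by norm_num)
  obtain ⟨l, hl, hl0⟩ := (hl.and (eventually_gt_atTop 0)).exists
  refine ⟨l, hl0, fun f B hB hf t ht i => ?_⟩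
  have hE : 0 ≤ B * Real.exp (l * t) := mul_nonneg hB (Real.exp_nonneg _)
  calc |actVec R f t i|
      ≤ ∑ j, |act (R i j) (fun τ => f τ j) t| := Finset.abs_sum_le_sum_abs _ _
    _ ≤ ∑ j, (|K i j| * (B * Real.exp (l * t)) + C i j / l * (B * Real.exp (l * t))) := by
        refine Finset.sum_le_sum fun j _ => (abs_add_le _ _).trans (add_le_add ?_ ?_)
        · rw [(hR.hasLim i j).gain_eq, abs_mul]
          gcongr
          exact hf t ht j
        · exact hC i j l hl0 _ B hB (fun τ hτ => hf τ (Ioc_subset_Icc_self hτ) j) t ht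
    _ = (∑ j, |K i j| + (∑ j, C i j) / l) * (B * Real.exp (l * t)) := by
        rw [Finset.sum_add_distrib, ← Finset.sum_mul, ← Finset.sum_mul, ← Finset.sum_div, add_mul]
    _ ≤ 3 / 4 * (B * Real.exp (l * t)) := by
        refine mul_le_mul_of_nonneg_right ?_ hE
        linarith [hK i, hl i]

/-- A rational matrix with a finite limit at infinity acts boundedly in the sup norm. -/
theorem exists_actVec_bound [Finite ι] [Fintype κ] {R : Matrix ι κ (RatFunc ℝ)}
    {K : Matrix ι κ ℝ} (hR : HasLimitAtInfinity R K) (T : ℝ) :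
    ∃ C, 0 ≤ C ∧ ∀ (f : ℝ → κ → ℝ) (B : ℝ), 0 ≤ B → (∀ t ∈ Icc 0 T, ∀ i, |f t i| ≤ B) →
      ∀ t ∈ Icc 0 T, ∀ i, |actVec R f t i| ≤ C * B := by
  have hC := fun i j => exists_conv_bound (hR.hasFiniteLim i j).isKernel.continuous T
  choose C hC0 hC using hC
  cases nonempty_fintype ι
  set S : ℝ := ∑ i, ∑ j, (|K i j| + C i j * Real.exp T)
  have hnn : ∀ i j, 0 ≤ |K i j| + C i j * Real.exp T := fun i j =>
    add_nonneg (abs_nonneg _) (mul_nonneg (hC0 i j) (Real.exp_nonneg _))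
  refine ⟨S, Finset.sum_nonneg fun i _ => Finset.sum_nonneg fun j _ => hnn i j,
    fun f B hB hf t ht i => ?_⟩
  calc |actVec R f t i|
      ≤ ∑ j, |act (R i j) (fun τ => f τ j) t| := Finset.abs_sum_le_sum_abs _ _
    _ ≤ ∑ j, (|K i j| + C i j * Real.exp T) * B := by
        refine Finset.sum_le_sum fun j _ => (abs_add_le _ _).trans ?_
        rw [add_mul]
        refine add_le_add ?_ ?_
        · rw [(hR.hasLim i j).gain_eq, abs_mul]
          gcongr
          exact hf t ht j
        · -- the weighted estimate with `l = 1`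
          refine (hC i j 1 one_pos _ B hB (fun τ hτ => ?_) t ht).trans ?_
          · refine (hf τ (Ioc_subset_Icc_self hτ) j).trans (le_mul_of_one_le_right hB ?_)
            rw [one_mul]
            exact Real.one_le_exp hτ.1.le
          · rw [div_one, one_mul, mul_assoc, mul_comm B]
            have := hC0 i j
            gcongr
            exact ht.2
    _ ≤ S * B := by
        rw [← Finset.sum_mul]
        refine mul_le_mul_of_nonneg_right ?_ hB
        exact Finset.single_le_sum (f := fun i => ∑ j, (|K i j| + C i j * Real.exp T))
          (fun i _ => Finset.sum_nonneg fun j _ => hnn i j) (Finset.mem_univ i)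

/-- Boundedly convergent signals are mapped to convergent signals. -/
theorem tendsto_actVec [Fintype κ] {R : Matrix ι κ (RatFunc ℝ)} {K : Matrix ι κ ℝ}
    (hR : HasLimitAtInfinity R K) {f : ℕ → ℝ → κ → ℝ} {w : ℝ → κ → ℝ} {B : ℝ}
    (hf : ∀ k, ContinuousOn (f k) (Icc 0 T)) (hB : ∀ k, ∀ t ∈ Ioc 0 T, ∀ i, |f k t i| ≤ B)
    (hlim : ∀ t ∈ Icc 0 T, Tendsto (fun k => f k t) atTop (𝓝 (w t))) {t : ℝ} (ht : t ∈ Icc 0 T) :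
    Tendsto (fun k => actVec R (f k) t) atTop (𝓝 (actVec R w t)) := by
  refine tendsto_pi_nhds.2 fun i => tendsto_finsetSum _ fun j _ => ?_
  have hlim' : ∀ τ ∈ Icc 0 T, Tendsto (fun k => f k τ j) atTop (𝓝 (w τ j)) := fun τ hτ =>
    tendsto_pi_nhds.1 (hlim τ hτ) j
  refine ((hlim' t ht).const_mul _).add ?_
  have hk := (hR.hasFiniteLim i j).isKernel.continuous
  obtain ⟨C, hC⟩ := (isCompact_Icc (a := (0 : ℝ)) (b := T)).exists_bound_of_continuousOn
    hk.continuousOn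
  refine intervalIntegral.tendsto_integral_filter_of_dominated_convergence (fun _ => C * B)
    (Eventually.of_forall fun k => ?_) (Eventually.of_forall fun k => ?_) (by simp) ?_
  · rw [uIoc_of_le ht.1]
    refine ContinuousOn.aestronglyMeasurable ?_ measurableSet_Ioc
    refine ContinuousOn.mul (by fun_prop) ((continuousOn_pi.1 (hf k) j).mono ?_)
    exact fun τ hτ => ⟨hτ.1.le, hτ.2.trans ht.2⟩
  · refine Eventually.of_forall fun τ hτ => ?_
    rw [uIoc_of_le ht.1] at hτ
    rw [norm_mul]
    have h1 := hC (t - τ) ⟨by linarith [hτ.2], by linarith [hτ.1, ht.2]⟩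
    exact mul_le_mul h1 (hB k τ ⟨hτ.1, hτ.2.trans ht.2⟩ j) (norm_nonneg _)
      ((norm_nonneg _).trans h1)
  · refine Eventually.of_forall fun τ hτ => ?_
    rw [uIoc_of_le ht.1] at hτ
    exact (hlim' τ ⟨hτ.1.le, hτ.2.trans ht.2⟩).const_mul _

/-! ### Powers of a matrix and its spectral radius -/

section Spectral

variable [Fintype ι] [DecidableEq ι]

attribute [local instance] Matrix.linftyOpNormedRing Matrix.linftyOpNormedAlgebra

theorem map_ofReal_pow (A : Matrix ι ι ℝ) (n : ℕ) :
    (A ^ n).map (algebraMap ℝ ℂ) = A.map (algebraMap ℝ ℂ) ^ n :=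
  map_pow (algebraMap ℝ ℂ).mapMatrix A n

theorem row_sum_le_norm (A : Matrix ι ι ℝ) (i : ι) :
    ∑ j, |A i j| ≤ ‖A.map (algebraMap ℝ ℂ)‖ := by
  rw [Matrix.linfty_opNorm_def]
  have h : ∑ j, ‖A.map (algebraMap ℝ ℂ) i j‖₊
      ≤ (Finset.univ : Finset ι).sup fun i => ∑ j, ‖A.map (algebraMap ℝ ℂ) i j‖₊ :=
    Finset.le_sup (f := fun i => ∑ j, ‖A.map (algebraMap ℝ ℂ) i j‖₊) (Finset.mem_univ i)
  have h' := NNReal.coe_le_coe.2 h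
  refine le_trans (le_of_eq ?_) h'
  simp

/-- By Gelfand's formula, some power of a matrix of spectral radius less than one has row sums at most
`1 / 2`. -/
theorem exists_pow_row_sum_le {A : Matrix ι ι ℝ}
    (h : spectralRadius ℂ (A.map (algebraMap ℝ ℂ)) < 1) :
    ∃ n, 0 < n ∧ ∀ i, ∑ j, |(A ^ n) i j| ≤ 1 / 2 := by
  obtain ⟨r, hr, hr1⟩ := ENNReal.lt_iff_exists_nnreal_btwn.1 h
  have hr1' : r < 1 := by exact_mod_cast hr1
  have h1 := (spectrum.pow_nnnorm_pow_one_div_tendsto_nhds_spectralRadius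
    (A.map (algebraMap ℝ ℂ))).eventually_lt_const hr
  have h2 : ∀ᶠ n : ℕ in atTop, (r : ℝ) ^ n ≤ 1 / 2 :=
    (tendsto_pow_atTop_nhds_zero_of_lt_one r.2 hr1').eventually_le_const (by norm_num)
  obtain ⟨n, ⟨h1, h2⟩, hn⟩ := ((h1.and h2).and (eventually_gt_atTop 0)).exists
  refine ⟨n, hn, fun i => ?_⟩
  have hn' : (0 : ℝ) < n := Nat.cast_pos.2 hn
  rw [one_div, ENNReal.rpow_inv_lt_iff hn', ENNReal.rpow_natCast] at h1
  have h3 : ‖A.map (algebraMap ℝ ℂ) ^ n‖₊ < r ^ n := by exact_mod_cast h1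
  have h4 : ‖A.map (algebraMap ℝ ℂ) ^ n‖ < (r : ℝ) ^ n := by exact_mod_cast h3
  rw [← map_ofReal_pow] at h4
  exact (row_sum_le_norm _ i).trans (h4.le.trans h2)

theorem spectralRadius_lt_one_of_tendsto [Nonempty ι] {A : Matrix ι ι ℝ}
    (h : ∀ c, Tendsto (fun n => A ^ n *ᵥ c) atTop (𝓝 0)) :
    spectralRadius ℂ (A.map (algebraMap ℝ ℂ)) < 1 := by
  have hA : Tendsto (fun n => (A ^ n).map (algebraMap ℝ ℂ)) atTop (𝓝 0) := by
    refine tendsto_pi_nhds.2 fun i => tendsto_pi_nhds.2 fun j => ?_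
    have := tendsto_pi_nhds.1 (h (Pi.single j 1)) i
    simp only [Matrix.mulVec_single_one, Matrix.col_apply] at this
    exact ((Complex.continuous_ofReal.tendsto 0).comp this)
  have hn := (tendsto_zero_iff_norm_tendsto_zero.1 hA).eventually_lt_const one_pos
  obtain ⟨n, hn, hn0⟩ := (hn.and (eventually_gt_atTop 0)).exists
  have h1 := spectrum.spectralRadius_pow_le (𝕜 := ℂ) (A.map (algebraMap ℝ ℂ)) n hn0.ne'
  have h2 : spectralRadius ℂ (A.map (algebraMap ℝ ℂ) ^ n) < 1 := by
    refine (spectrum.spectralRadius_le_nnnorm _).trans_lt ?_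
    rw [← map_ofReal_pow]
    exact_mod_cast hn
  by_contra! hge
  exact absurd (h1.trans_lt h2) (not_lt.2 (one_le_pow₀ hge))

/-- The eigenvalue `1` of `1 - M` is excluded, so `M` is nonsingular. -/
theorem isUnit_det_of_spectralRadius_lt_one {M : Matrix ι ι ℝ}
    (h : spectralRadius ℂ ((1 - M).map (algebraMap ℝ ℂ)) < 1) : IsUnit M.det := by
  have h1 : (1 : ℂ) ∈ resolventSet ℂ ((1 - M).map (algebraMap ℝ ℂ)) :=
    spectrum.mem_resolventSet_of_spectralRadius_lt (by simpa using h)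
  rw [spectrum.mem_resolventSet_iff, map_one] at h1
  have h2 : (1 : Matrix ι ι ℂ) - (1 - M).map (algebraMap ℝ ℂ) = M.map (algebraMap ℝ ℂ) := by
    ext i j
    by_cases hij : i = j <;> simp [hij]
  rw [h2, Matrix.isUnit_iff_isUnit_det] at h1
  rw [isUnit_iff_ne_zero] at h1 ⊢
  intro h0
  apply h1
  have := (RingHom.map_det (algebraMap ℝ ℂ) M).symm
  rw [h0, map_zero] at this
  exact this

end Spectral

/-! ### The tracking error and its derivative -/

theorem hasLimitAtInfinity_X_inv_smul_one [DecidableEq ι] :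
    HasLimitAtInfinity ((RatFunc.X : RatFunc ℝ)⁻¹ • (1 : Matrix ι ι (RatFunc ℝ))) 0 := by
  intro i j
  by_cases h : i = j
  · subst h
    simpa [evalAt] using (show Tendsto _ _ _ from HasLim.X_inv)
  · simp [evalAt, Matrix.one_apply_ne h]

theorem evalAt_X_inv_smul [Finite ι] [Fintype κ] (A : Matrix ι κ (RatFunc ℝ)) (F : ℝ → κ → ℝ) :
    (fun s => evalAt ((RatFunc.X : RatFunc ℝ)⁻¹ • A) s *ᵥ F s)
      =ᶠ[atTop] fun s => s⁻¹ • (evalAt A s *ᵥ F s) := by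
  filter_upwards [evalAt_smul (RatFunc.X : RatFunc ℝ)⁻¹ A, ev_X_inv_eventually] with s h1 h2
  rw [h1, h2, Matrix.smul_mulVec]

theorem evalAt_eq_inv_smul_X_smul [Finite ι] [Fintype κ] (A : Matrix ι κ (RatFunc ℝ))
    (F : ℝ → κ → ℝ) : (fun s => evalAt A s *ᵥ F s)
      =ᶠ[atTop] fun s => s⁻¹ • (evalAt ((RatFunc.X : RatFunc ℝ) • A) s *ᵥ F s) := by
  have h := evalAt_X_inv_smul ((RatFunc.X : RatFunc ℝ) • A) F
  rwa [inv_smul_smul₀ RatFunc.X_ne_zero] at h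

/-- The integral of a vector signal. -/
noncomputable def primitive [Fintype ι] [DecidableEq ι] (f : ℝ → ι → ℝ) : ℝ → ι → ℝ :=
  actVec ((RatFunc.X : RatFunc ℝ)⁻¹ • (1 : Matrix ι ι (RatFunc ℝ))) f

theorem VecTransOn.primitive [Fintype ι] [DecidableEq ι] {f F : ℝ → ι → ℝ}
    (h : VecTransOn T f F) : VecTransOn T (primitive f) (fun s => s⁻¹ • F s) := by
  refine (h.mulVec hasLimitAtInfinity_X_inv_smul_one).congr ?_
  refine (evalAt_X_inv_smul 1 F).trans (Eventually.of_forall fun s => ?_)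
  simp only [evalAt_one, Matrix.one_mulVec]

theorem Cong.inv_smul [Fintype ι] {F F' : ℝ → ι → ℝ} (h : Cong T F F') :
    Cong T (fun s => s⁻¹ • F s) (fun s => s⁻¹ • F' s) := by
  classical
  have key : ∀ F : ℝ → ι → ℝ, (fun s =>
      evalAt ((RatFunc.X : RatFunc ℝ)⁻¹ • (1 : Matrix ι ι (RatFunc ℝ))) s *ᵥ F s)
      =ᶠ[atTop] fun s => s⁻¹ • F s := fun F => by
    refine (evalAt_X_inv_smul 1 F).trans (Eventually.of_forall fun s => ?_)
    simp only [evalAt_one, Matrix.one_mulVec]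
  exact ((Cong.of_eventuallyEq (key F)).symm.trans (h.mulVec _)).trans
    (Cong.of_eventuallyEq (key F'))

/-- The standing data of the learning problem, for a plant `Y = G₁ U + Ψ` and a reference `yd`:
the free response `ψ` with transform `Ψ`, a right inverse `R` of `s G₁` with a finite limit at
infinity, and a function `h` with `yd - ψ = ∫ h`, that is, `Yd = Ψ + s⁻¹ H`. -/
structure TrackingData [Fintype ι] [Fintype κ] [DecidableEq ι] (T : ℝ)
    (G₁ : Matrix ι κ (RatFunc ℝ)) (Ψ : ℝ → ι → ℝ)
    (yd : ℝ → ι → ℝ) (K : Matrix ι κ ℝ) (R : Matrix κ ι (RatFunc ℝ)) (L : Matrix κ ι ℝ)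
    (ψ h H : ℝ → ι → ℝ) : Prop where
  pos : 0 < T
  strictlyProper : IsStrictlyProper G₁
  limit : HasLimitAtInfinity ((RatFunc.X : RatFunc ℝ) • G₁) K
  limit_R : HasLimitAtInfinity R L
  mul_R : (RatFunc.X : RatFunc ℝ) • G₁ * R = 1
  continuousOn_ψ : ContinuousOn ψ (Icc 0 T)
  trans_ψ : VecTransOn T ψ Ψ
  continuousOn_h : ContinuousOn h (Icc 0 T)
  trans_h : VecTransOn T h H
  continuousOn_yd : ContinuousOn yd (Icc 0 T)
  trans_yd : VecTransOn T yd (fun s => Ψ s + s⁻¹ • H s)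

/-- The derivative of the tracking error for the input `u`. -/
noncomputable def errRate [Fintype κ] (G₁ : Matrix ι κ (RatFunc ℝ)) (h : ℝ → ι → ℝ)
    (u : ℝ → κ → ℝ) (t : ℝ) : ι → ℝ :=
  h t - actVec ((RatFunc.X : RatFunc ℝ) • G₁) u t

/-- The transform of `errRate`. -/
noncomputable def errRateTrans [Fintype κ] (G₁ : Matrix ι κ (RatFunc ℝ)) (H : ℝ → ι → ℝ)
    (U : ℝ → κ → ℝ) (s : ℝ) : ι → ℝ :=
  H s - evalAt ((RatFunc.X : RatFunc ℝ) • G₁) s *ᵥ U s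

theorem Cong.errRateTrans [Fintype κ] (G₁ : Matrix ι κ (RatFunc ℝ)) (H : ℝ → ι → ℝ)
    {U U' : ℝ → κ → ℝ} (h : Cong T U U') :
    Cong T (errRateTrans G₁ H U) (errRateTrans G₁ H U') :=
  (Cong.refl H).sub (h.mulVec _)

section Run

variable {q m : ℕ} [Fintype κ] {G₁ : Matrix (Fin q) κ (RatFunc ℝ)}
  {G₂ : Matrix (Fin q) (Fin m) (RatFunc ℝ)} {D : Fin m → RatFunc ℝ} {yd : ℝ → Fin q → ℝ}
  {K : Matrix (Fin q) κ ℝ} {R : Matrix κ (Fin q) (RatFunc ℝ)} {L : Matrix κ (Fin q) ℝ}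
  {ψ h H : ℝ → Fin q → ℝ} {Γ : Matrix κ (Fin q) (RatFunc ℝ)}

variable (td : TrackingData T G₁ (fun s => evalAt G₂ s *ᵥ evalVec D s) yd K R L ψ h H)
include td

theorem TrackingData.trans_response {u U : ℝ → κ → ℝ} (hU : VecTransOn T u U) :
    VecTransOn T (fun t => actVec G₁ u t + ψ t)
      (fun s => evalAt G₁ s *ᵥ U s + evalAt G₂ s *ᵥ evalVec D s) :=
  (hU.mulVec td.strictlyProper).add td.trans_ψ

theorem TrackingData.continuousOn_response {u U : ℝ → κ → ℝ} (hU : VecTransOn T u U) :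
    ContinuousOn (fun t => actVec G₁ u t + ψ t) (Icc 0 T) :=
  (continuousOn_actVec_of_isStrictlyProper td.strictlyProper td.pos.le hU).add td.continuousOn_ψ

theorem TrackingData.isOutput_response {u U : ℝ → κ → ℝ} (hU : VecTransOn T u U) :
    IsOutput T G₁ G₂ D u (fun t => actVec G₁ u t + ψ t) := by
  obtain ⟨U', h1, h2⟩ := hU.exists_isTransformOn
  obtain ⟨Y, h3, h4⟩ := (td.trans_response hU).exists_isTransformOn
  refine ⟨td.continuousOn_response hU, U', Y, h1, h3, ?_⟩
  filter_upwards [h2, h4] with s a b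
  rw [← b, ← a]

/-- The output is determined by the input. -/
theorem TrackingData.eqOn_of_isOutput {u U : ℝ → κ → ℝ} {y : ℝ → Fin q → ℝ}
    (hU : VecTransOn T u U) (hy : IsOutput T G₁ G₂ D u y) :
    EqOn y (fun t => actVec G₁ u t + ψ t) (Icc 0 T) := by
  obtain ⟨hc, U', Y, h1, h2, h3⟩ := hy
  refine (h2.vecTransOn.congr h3).eqOn td.pos (td.trans_response hU) ?_ hc
    (td.continuousOn_response hU)
  exact ((h1.vecTransOn.cong hU).mulVec G₁).add (Cong.refl _)

theorem TrackingData.trans_error {u U : ℝ → κ → ℝ} {y : ℝ → Fin q → ℝ}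
    (hU : VecTransOn T u U) (hy : EqOn y (fun t => actVec G₁ u t + ψ t) (Icc 0 T)) :
    VecTransOn T (fun t => yd t - y t) (fun s => s⁻¹ • errRateTrans G₁ H U s) := by
  refine ((td.trans_yd.sub ((td.trans_response hU).congr_eqOn hy.symm))).congr ?_
  filter_upwards [evalAt_eq_inv_smul_X_smul G₁ U] with s hs
  rw [hs, errRateTrans, smul_sub]
  abel

theorem TrackingData.trans_errRate {u U : ℝ → κ → ℝ} (hU : VecTransOn T u U) :
    VecTransOn T (errRate G₁ h u) (errRateTrans G₁ H U) :=
  td.trans_h.sub (hU.mulVec td.limit)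

theorem TrackingData.continuousOn_errRate {u : ℝ → κ → ℝ} (hu : ContinuousOn u (Icc 0 T)) :
    ContinuousOn (errRate G₁ h u) (Icc 0 T) :=
  td.continuousOn_h.sub (continuousOn_actVec td.limit td.pos.le hu)

theorem TrackingData.error_eqOn {u : ℝ → κ → ℝ} (hu : ContinuousOn u (Icc 0 T))
    {y : ℝ → Fin q → ℝ} (hy : EqOn y (fun t => actVec G₁ u t + ψ t) (Icc 0 T)) :
    EqOn (fun t => yd t - y t) (primitive (errRate G₁ h u)) (Icc 0 T) := by
  obtain ⟨U, hU⟩ := exists_vecTransOn hu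
  refine (td.trans_error hU hy).eqOn td.pos (td.trans_errRate hU).primitive (Cong.refl _) ?_
    (continuousOn_actVec hasLimitAtInfinity_X_inv_smul_one td.pos.le (td.continuousOn_errRate hu))
  exact td.continuousOn_yd.sub ((td.continuousOn_response hU).congr hy)

/-- The updating law in terms of the error rate. -/
theorem TrackingData.cong_update {u : ℕ → ℝ → κ → ℝ} {y : ℕ → ℝ → Fin q → ℝ}
    (hrun : IsILCRun T G₁ G₂ D Γ yd u y) {U : ℕ → ℝ → κ → ℝ}
    (hU : ∀ k, VecTransOn T (u k) (U k)) (k : ℕ) :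
    Cong T (U (k + 1))
      (fun s => U k s + evalAt ((RatFunc.X : RatFunc ℝ)⁻¹ • Γ) s *ᵥ errRateTrans G₁ H (U k) s) := by
  obtain ⟨V, V', E, hV, hV', hE, hup⟩ := hrun.update k
  have h1 : Cong T E (fun s => s⁻¹ • errRateTrans G₁ H (U k) s) :=
    hE.vecTransOn.cong (td.trans_error (hU k) (td.eqOn_of_isOutput (hU k) (hrun.output k)))
  refine (((hU (k + 1)).cong hV'.vecTransOn).trans (Cong.of_eventuallyEq hup)).trans
    ((hV.vecTransOn.cong (hU k)).add ((h1.mulVec Γ).trans (Cong.of_eventuallyEq ?_)))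
  filter_upwards [evalAt_X_inv_smul Γ (errRateTrans G₁ H (U k))] with s hs
  rw [hs, Matrix.mulVec_smul]

/-- Along a run the error rate is multiplied by `1 - G₁ Γ`. -/
theorem TrackingData.cong_errRate_succ {u : ℕ → ℝ → κ → ℝ} {y : ℕ → ℝ → Fin q → ℝ}
    (hrun : IsILCRun T G₁ G₂ D Γ yd u y) {U : ℕ → ℝ → κ → ℝ}
    (hU : ∀ k, VecTransOn T (u k) (U k)) (k : ℕ) :
    Cong T (errRateTrans G₁ H (U (k + 1)))
      (fun s => evalAt (1 - G₁ * Γ) s *ᵥ errRateTrans G₁ H (U k) s) := by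
  refine ((td.cong_update hrun hU k).errRateTrans G₁ H).trans (Cong.of_eventuallyEq ?_)
  have hmul : (RatFunc.X : RatFunc ℝ) • G₁ * ((RatFunc.X : RatFunc ℝ)⁻¹ • Γ) = G₁ * Γ := by
    rw [Matrix.smul_mul, Matrix.mul_smul, smul_inv_smul₀ RatFunc.X_ne_zero]
  filter_upwards [evalAt_sub 1 (G₁ * Γ),
    evalAt_mul ((RatFunc.X : RatFunc ℝ) • G₁) ((RatFunc.X : RatFunc ℝ)⁻¹ • Γ)] with s h1 h2
  rw [hmul] at h2
  rw [h1, h2, evalAt_one, Matrix.sub_mulVec, Matrix.one_mulVec, ← Matrix.mulVec_mulVec]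
  simp only [errRateTrans, Matrix.mulVec_add]
  abel

theorem TrackingData.cong_errRate_add {u : ℕ → ℝ → κ → ℝ} {y : ℕ → ℝ → Fin q → ℝ}
    (hrun : IsILCRun T G₁ G₂ D Γ yd u y) {U : ℕ → ℝ → κ → ℝ}
    (hU : ∀ k, VecTransOn T (u k) (U k)) (k n : ℕ) :
    Cong T (errRateTrans G₁ H (U (k + n)))
      (fun s => evalAt ((1 - G₁ * Γ) ^ n) s *ᵥ errRateTrans G₁ H (U k) s) := by
  induction n with
  | zero => exact Cong.of_eventuallyEq (Eventually.of_forall fun s => by simp [evalAt_one])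
  | succ n ih =>
    refine (td.cong_errRate_succ hrun hU (k + n)).trans ((ih.mulVec _).trans ?_)
    rw [pow_succ']
    exact Cong.of_eventuallyEq (evalAt_mul_mulVec _ _ _).symm

omit td in
theorem HasLimitAtInfinity.one_sub_mul_pow {M : Matrix (Fin q) (Fin q) ℝ}
    (hM : HasLimitAtInfinity (G₁ * Γ) M) (n : ℕ) :
    HasLimitAtInfinity ((1 - G₁ * Γ) ^ n) ((1 - M) ^ n) :=
  (HasLimitAtInfinity.one.sub hM).pow n

theorem TrackingData.errRate_add_eqOn {u : ℕ → ℝ → κ → ℝ} {y : ℕ → ℝ → Fin q → ℝ}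
    (hrun : IsILCRun T G₁ G₂ D Γ yd u y) (hu : ∀ k, ContinuousOn (u k) (Icc 0 T))
    {M : Matrix (Fin q) (Fin q) ℝ} (hM : HasLimitAtInfinity (G₁ * Γ) M) (k n : ℕ) :
    EqOn (errRate G₁ h (u (k + n))) (actVec ((1 - G₁ * Γ) ^ n) (errRate G₁ h (u k)))
      (Icc 0 T) := by
  choose U hU using fun k => exists_vecTransOn (hu k)
  exact (td.trans_errRate (hU (k + n))).eqOn td.pos
    ((td.trans_errRate (hU k)).mulVec (hM.one_sub_mul_pow n)) (td.cong_errRate_add hrun hU k n)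
    (td.continuousOn_errRate (hu _))
    (continuousOn_actVec (hM.one_sub_mul_pow n) td.pos.le (td.continuousOn_errRate (hu k)))

theorem TrackingData.update_eqOn {u : ℕ → ℝ → κ → ℝ} {y : ℕ → ℝ → Fin q → ℝ}
    (hrun : IsILCRun T G₁ G₂ D Γ yd u y) (hu : ∀ k, ContinuousOn (u k) (Icc 0 T))
    {L' : Matrix κ (Fin q) ℝ} (hΓ : HasLimitAtInfinity ((RatFunc.X : RatFunc ℝ)⁻¹ • Γ) L')
    (k : ℕ) : EqOn (u (k + 1)) (fun t => u k t +
      actVec ((RatFunc.X : RatFunc ℝ)⁻¹ • Γ) (errRate G₁ h (u k)) t) (Icc 0 T) := by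
  choose U hU using fun k => exists_vecTransOn (hu k)
  exact (hU (k + 1)).eqOn td.pos ((hU k).add ((td.trans_errRate (hU k)).mulVec hΓ))
    (td.cong_update hrun hU k) (hu _)
    ((hu k).add (continuousOn_actVec hΓ td.pos.le (td.continuousOn_errRate (hu k))))

/-- Runs with continuous inputs exist for every continuous initial input. -/
theorem TrackingData.exists_run {L' : Matrix κ (Fin q) ℝ}
    (hΓ : HasLimitAtInfinity ((RatFunc.X : RatFunc ℝ)⁻¹ • Γ) L') {u₀ : ℝ → κ → ℝ}
    (hu₀ : ContinuousOn u₀ (Icc 0 T)) :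
    ∃ u y, IsILCRun T G₁ G₂ D Γ yd u y ∧ u 0 = u₀ ∧ ∀ k, ContinuousOn (u k) (Icc 0 T) := by
  let u : ℕ → ℝ → κ → ℝ := fun k => Nat.rec u₀
    (fun _ v t => v t + actVec ((RatFunc.X : RatFunc ℝ)⁻¹ • Γ) (errRate G₁ h v) t) k
  have hu : ∀ k, ContinuousOn (u k) (Icc 0 T) := fun k => by
    induction k with
    | zero => exact hu₀
    | succ k ih =>
      exact ih.add (continuousOn_actVec hΓ td.pos.le (td.continuousOn_errRate ih))
  choose U hU using fun k => exists_vecTransOn (hu k)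
  refine ⟨u, fun k t => actVec G₁ (u k) t + ψ t,
    ⟨fun k => td.isOutput_response (hU k), fun k => ?_⟩, rfl, hu⟩
  obtain ⟨V, hV, hVe⟩ := (hU k).exists_isTransformOn
  obtain ⟨V', hV', hVe'⟩ := ((hU k).add ((td.trans_errRate (hU k)).mulVec hΓ)).exists_isTransformOn
  obtain ⟨E, hE, hEe⟩ := (td.trans_error (hU k) fun t _ => rfl).exists_isTransformOn
  refine ⟨V, V', E, hV, hV', hE, ?_⟩
  filter_upwards [hVe, hVe', hEe, evalAt_X_inv_smul Γ (errRateTrans G₁ H (U k))] with s a b c d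
  rw [← a, ← b, ← c, d, Matrix.mulVec_smul]

end Run

/-! ### Sufficiency: geometric convergence of the error rate -/

theorem summable_pow_div {n : ℕ} (hn : 0 < n) : Summable fun k : ℕ => (3 / 4 : ℝ) ^ (k / n) := by
  have : NeZero n := ⟨hn.ne'⟩
  have h1 : Summable fun k : ℕ => (3 / 4 : ℝ) ^ k :=
    summable_geometric_of_lt_one (by norm_num) (by norm_num)
  have h2 : Summable fun _ : Fin n => (1 : ℝ) := Summable.of_finite
  have h3 := h1.mul_of_nonneg h2 (fun k => by positivity) (fun _ => zero_le_one)
  rw [← (Nat.divModEquiv n).summable_iff] at h3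
  refine h3.congr fun k => ?_
  simp

theorem exists_bound_of_continuousOn [Finite ι] {f : ℝ → ι → ℝ} (hf : ContinuousOn f (Icc 0 T)) :
    ∃ B, 0 ≤ B ∧ ∀ t ∈ Icc 0 T, ∀ i, |f t i| ≤ B := by
  cases nonempty_fintype ι
  obtain ⟨B, hB⟩ := isCompact_Icc.exists_bound_of_continuousOn hf
  exact ⟨max B 0, le_max_right _ _, fun t ht i =>
    (norm_le_pi_norm (f t) i).trans ((hB t ht).trans (le_max_left _ _))⟩

theorem exists_X_inv_pow_smul [Finite ι] [Finite κ] (A : Matrix ι κ (RatFunc ℝ)) :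
    ∃ (n : ℕ) (K : Matrix ι κ ℝ),
      HasLimitAtInfinity ((RatFunc.X : RatFunc ℝ)⁻¹ ^ n • A) K := by
  cases nonempty_fintype ι
  cases nonempty_fintype κ
  choose n hn using fun i j => exists_X_inv_pow_mul (A i j)
  have h : ∀ i j, HasFiniteLim ((RatFunc.X : RatFunc ℝ)⁻¹ ^ (∑ i, ∑ j, n i j) * A i j) := by
    intro i j
    have hle : n i j ≤ ∑ i, ∑ j, n i j :=
      (Finset.single_le_sum (f := fun j => n i j) (fun _ _ => Nat.zero_le _)
        (Finset.mem_univ j)).trans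
      (Finset.single_le_sum (f := fun i => ∑ j, n i j) (fun _ _ => Nat.zero_le _)
        (Finset.mem_univ i))
    obtain ⟨k, hk⟩ := Nat.exists_eq_add_of_le hle
    rw [hk, pow_add, mul_assoc, mul_left_comm]
    exact (hasFiniteLim_X_inv_pow k).mul (hn i j)
  choose K hK using h
  exact ⟨_, K, fun i j => hK i j⟩

/-- Congruences may be tested after division by a power of `s`. -/
theorem cong_of_cong_smul [Finite ι] [Fintype κ] {A : Matrix ι κ (RatFunc ℝ)} {g : RatFunc ℝ}
    (hg : g ≠ 0) {F F' : ℝ → κ → ℝ}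
    (h : Cong T (fun s => evalAt (g • A) s *ᵥ F s) (fun s => evalAt (g • A) s *ᵥ F' s)) :
    Cong T (fun s => evalAt A s *ᵥ F s) (fun s => evalAt A s *ᵥ F' s) := by
  intro i
  refine ((h i).mul g⁻¹).congr ?_
  filter_upwards [evalAt_smul g A, ev_inv g, ev_ne_zero hg] with s h1 h2 h3
  rw [h1, h2, Matrix.smul_mulVec, Matrix.smul_mulVec, Pi.smul_apply, Pi.smul_apply, smul_eq_mul,
    smul_eq_mul, ← mul_sub, inv_mul_cancel_left₀ h3]

section Run

variable {q m : ℕ} [Fintype κ] {G₁ : Matrix (Fin q) κ (RatFunc ℝ)}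
  {G₂ : Matrix (Fin q) (Fin m) (RatFunc ℝ)} {D : Fin m → RatFunc ℝ} {yd : ℝ → Fin q → ℝ}
  {K : Matrix (Fin q) κ ℝ} {R : Matrix κ (Fin q) (RatFunc ℝ)} {L : Matrix κ (Fin q) ℝ}
  {ψ h H : ℝ → Fin q → ℝ} {Γ : Matrix κ (Fin q) (RatFunc ℝ)}

variable (td : TrackingData T G₁ (fun s => evalAt G₂ s *ᵥ evalVec D s) yd K R L ψ h H)
include td

/-- Under the gain condition the error rates are summable in the sup norm: for a suitable `n`, the
power `(1 - G₁ Γ) ^ n` contracts a weighted sup norm by `3 / 4`. -/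
theorem TrackingData.exists_errRate_bound {u : ℕ → ℝ → κ → ℝ} {y : ℕ → ℝ → Fin q → ℝ}
    (hrun : IsILCRun T G₁ G₂ D Γ yd u y) (hu : ∀ k, ContinuousOn (u k) (Icc 0 T))
    {M : Matrix (Fin q) (Fin q) ℝ} (hM : HasLimitAtInfinity (G₁ * Γ) M)
    (hspec : spectralRadius ℂ ((1 - M).map (algebraMap ℝ ℂ)) < 1) :
    ∃ b : ℕ → ℝ, Summable b ∧ (∀ k, 0 ≤ b k) ∧
      ∀ k, ∀ t ∈ Icc 0 T, ∀ i, |errRate G₁ h (u k) t i| ≤ b k := by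
  obtain ⟨n, hn, hrow⟩ := exists_pow_row_sum_le hspec
  obtain ⟨l, hl, hcontr⟩ := exists_weighted_contraction (hM.one_sub_mul_pow n) hrow T
  choose B hB0 hB using fun k => exists_bound_of_continuousOn (td.continuousOn_errRate (hu k))
  set B' : ℝ := ∑ k ∈ Finset.range n, B k
  have hB' : 0 ≤ B' := Finset.sum_nonneg fun k _ => hB0 k
  have key : ∀ k, ∀ t ∈ Icc 0 T, ∀ i,
      |errRate G₁ h (u k) t i| ≤ (3 / 4) ^ (k / n) * B' * Real.exp (l * t) := by
    intro k
    induction k using Nat.strong_induction_on with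
    | _ k ih =>
    intro t ht i
    rcases lt_or_ge k n with hk | hk
    · rw [Nat.div_eq_of_lt hk, pow_zero, one_mul]
      refine (hB k t ht i).trans ((Finset.single_le_sum (fun j _ => hB0 j)
        (Finset.mem_range.2 hk)).trans (le_mul_of_one_le_right hB' ?_))
      exact Real.one_le_exp (mul_nonneg hl.le ht.1)
    · obtain ⟨j, rfl⟩ := Nat.exists_eq_add_of_le' hk
      rw [td.errRate_add_eqOn hrun hu hM j n ht, Nat.add_div_right _ hn, pow_succ]
      refine (hcontr _ ((3 / 4) ^ (j / n) * B') (by positivity)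
        (ih j (by omega)) t ht i).trans (le_of_eq ?_)
      ring
  refine ⟨fun k => (3 / 4) ^ (k / n) * (B' * Real.exp (l * T)),
    (summable_pow_div hn).mul_right _, fun k => by positivity, fun k t ht i => ?_⟩
  refine (key k t ht i).trans ?_
  rw [mul_assoc]
  have := ht.2
  change _ ≤ (3 / 4) ^ (k / n) * (B' * Real.exp (l * T))
  gcongr

/-- Under the gain condition the inputs and the outputs of every run with continuous inputs converge
uniformly: the increments of the inputs and the errors are bounded by a summable sequence. -/
theorem TrackingData.exists_uniform_limit {u : ℕ → ℝ → κ → ℝ} {y : ℕ → ℝ → Fin q → ℝ}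
    (hrun : IsILCRun T G₁ G₂ D Γ yd u y) (hu : ∀ k, ContinuousOn (u k) (Icc 0 T))
    {L' : Matrix κ (Fin q) ℝ} (hΓ : HasLimitAtInfinity ((RatFunc.X : RatFunc ℝ)⁻¹ • Γ) L')
    {M : Matrix (Fin q) (Fin q) ℝ} (hM : HasLimitAtInfinity (G₁ * Γ) M)
    (hspec : spectralRadius ℂ ((1 - M).map (algebraMap ℝ ℂ)) < 1) :
    ∃ w : ℝ → κ → ℝ, ContinuousOn w (Icc 0 T) ∧ TendstoUniformlyOn u w atTop (Icc 0 T) ∧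
      TendstoUniformlyOn y yd atTop (Icc 0 T) ∧
      ∃ B, ∀ k, ∀ t ∈ Icc 0 T, ∀ i, |u k t i| ≤ B := by
  obtain ⟨b, hbs, hb0, hb⟩ := td.exists_errRate_bound hrun hu hM hspec
  obtain ⟨C, hC0, hC⟩ := exists_actVec_bound hΓ T
  set d : ℕ → ℝ → κ → ℝ := fun k => actVec ((RatFunc.X : RatFunc ℝ)⁻¹ • Γ) (errRate G₁ h (u k))
  have hd : ∀ k, ∀ t ∈ Icc 0 T, ‖d k t‖ ≤ C * b k := fun k t ht =>
    (pi_norm_le_iff_of_nonneg (mul_nonneg hC0 (hb0 k))).2 (hC _ _ (hb0 k) (hb k) t ht)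
  have hsum : ∀ k, EqOn (fun t => u 0 t + ∑ j ∈ Finset.range k, d j t) (u k) (Icc 0 T) := by
    intro k
    induction k with
    | zero => intro t _; simp
    | succ k ih =>
      intro t ht
      have h1 := td.update_eqOn hrun hu hΓ k ht
      have h2 := ih ht
      simp only at h1 h2 ⊢
      rw [h1, Finset.sum_range_succ, ← add_assoc, h2]
  have hunif : TendstoUniformlyOn (fun k t => u 0 t + ∑ j ∈ Finset.range k, d j t)
      (fun t => u 0 t + ∑' j, d j t) atTop (Icc 0 T) := by
    have h1 := tendstoUniformlyOn_tsum_nat (hbs.mul_left C) hd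
    rw [Metric.tendstoUniformlyOn_iff] at h1 ⊢
    simpa only [dist_add_left] using h1
  have hunif' : TendstoUniformlyOn u (fun t => u 0 t + ∑' j, d j t) atTop (Icc 0 T) :=
    hunif.congr (Eventually.of_forall hsum)
  refine ⟨_, hunif'.continuousOn (Eventually.of_forall hu).frequently, hunif', ?_, ?_⟩
  · obtain ⟨C', hC'0, hC'⟩ := exists_actVec_bound
      (hasLimitAtInfinity_X_inv_smul_one (ι := Fin q)) T
    rw [Metric.tendstoUniformlyOn_iff]
    intro ε hε
    have hlim : Tendsto (fun k => C' * b k) atTop (𝓝 0) := by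
      simpa using hbs.tendsto_atTop_zero.const_mul C'
    filter_upwards [hlim.eventually_lt_const hε] with k hk t ht
    refine lt_of_le_of_lt ?_ hk
    rw [dist_eq_norm]
    obtain ⟨U, hU⟩ := exists_vecTransOn (hu k)
    have h1 := td.error_eqOn (hu k) (td.eqOn_of_isOutput hU (hrun.output k)) ht
    simp only at h1
    rw [h1]
    exact (pi_norm_le_iff_of_nonneg (mul_nonneg hC'0 (hb0 k))).2 (hC' _ _ (hb0 k) (hb k) t ht)
  · obtain ⟨B₀, hB₀, hB⟩ := exists_bound_of_continuousOn (hu 0)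
    refine ⟨B₀ + ∑' j, C * b j, fun k t ht i => ?_⟩
    rw [← hsum k ht]
    refine (abs_add_le _ _).trans (add_le_add (hB t ht i) ?_)
    refine (norm_le_pi_norm (∑ j ∈ Finset.range k, d j t) i).trans ((norm_sum_le _ _).trans ?_)
    exact (Finset.sum_le_sum fun j _ => hd j t ht).trans
      ((hbs.mul_left C).sum_le_tsum _ fun j _ => mul_nonneg hC0 (hb0 j))

/-- If the inputs of a run converge boundedly and the outputs converge to `yd`, the limit input
satisfies `G₁ W ≡ Yd - Ψ`. -/
theorem TrackingData.cong_of_tendsto {u : ℕ → ℝ → κ → ℝ} {y : ℕ → ℝ → Fin q → ℝ}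
    (hrun : IsILCRun T G₁ G₂ D Γ yd u y) (hu : ∀ k, ContinuousOn (u k) (Icc 0 T)) {B : ℝ}
    (hB : ∀ k, ∀ t ∈ Ioc 0 T, ∀ i, |u k t i| ≤ B) {w W : ℝ → κ → ℝ}
    (hw : ∀ t ∈ Icc 0 T, Tendsto (fun k => u k t) atTop (𝓝 (w t)))
    (hy : ∀ t ∈ Icc 0 T, Tendsto (fun k => y k t) atTop (𝓝 (yd t))) (hW : VecTransOn T w W) :
    Cong T (fun s => evalAt G₁ s *ᵥ W s) (fun s => s⁻¹ • H s) := by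
  have heq : EqOn (fun t => actVec G₁ w t + ψ t) yd (Icc 0 T) := by
    intro t ht
    refine tendsto_nhds_unique ?_ (hy t ht)
    refine ((tendsto_actVec td.strictlyProper hu hB hw ht).add_const (ψ t)).congr fun k => ?_
    obtain ⟨U, hU⟩ := exists_vecTransOn (hu k)
    exact (td.eqOn_of_isOutput hU (hrun.output k) ht).symm
  have h1 := ((td.trans_response hW).congr_eqOn heq).cong td.trans_yd
  have h2 := h1.sub (Cong.refl fun s => evalAt G₂ s *ᵥ evalVec D s)
  simpa using h2

/-- Passing to the limit in a run, the component of the input annihilated by `Γ` is unchanged. -/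
theorem TrackingData.cong_of_mul_eq_zero {P : Matrix κ κ (RatFunc ℝ)} (hP : P * Γ = 0)
    {u : ℕ → ℝ → κ → ℝ} {y : ℕ → ℝ → Fin q → ℝ}
    (hrun : IsILCRun T G₁ G₂ D Γ yd u y) (hu : ∀ k, ContinuousOn (u k) (Icc 0 T)) {B : ℝ}
    (hB : ∀ k, ∀ t ∈ Ioc 0 T, ∀ i, |u k t i| ≤ B) {w W U₀ : ℝ → κ → ℝ}
    (hw : ∀ t ∈ Icc 0 T, Tendsto (fun k => u k t) atTop (𝓝 (w t)))
    (hW : VecTransOn T w W) (hU₀ : VecTransOn T (u 0) U₀) :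
    Cong T (fun s => evalAt P s *ᵥ W s) (fun s => evalAt P s *ᵥ U₀ s) := by
  choose U hU using fun k => exists_vecTransOn (hu k)
  -- `P` need not have a finite limit; after division by a power of `s` it acts on signals
  obtain ⟨n, K', hK'⟩ := exists_X_inv_pow_smul P
  set Q := (RatFunc.X : RatFunc ℝ)⁻¹ ^ n • P
  have hQΓ : Q * ((RatFunc.X : RatFunc ℝ)⁻¹ • Γ) = 0 := by
    rw [Matrix.smul_mul, Matrix.mul_smul, hP, smul_zero, smul_zero]
  have hinv : ∀ k, Cong T (fun s => evalAt Q s *ᵥ U k s) (fun s => evalAt Q s *ᵥ U₀ s) := by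
    intro k
    induction k with
    | zero => exact ((hU 0).cong hU₀).mulVec Q
    | succ k ih =>
      refine (((td.cong_update hrun hU k).mulVec Q).trans (Cong.of_eventuallyEq ?_)).trans ih
      filter_upwards [evalAt_mul Q ((RatFunc.X : RatFunc ℝ)⁻¹ • Γ)] with s hs
      rw [Matrix.mulVec_add, Matrix.mulVec_mulVec, ← hs, hQΓ, evalAt_zero, Matrix.zero_mulVec, add_zero]
  have heq : EqOn (actVec Q w) (actVec Q (u 0)) (Icc 0 T) := by
    intro t ht
    refine tendsto_nhds_unique (tendsto_actVec hK' hu hB hw ht) ?_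
    refine tendsto_const_nhds.congr fun k => ?_
    exact (((hU k).mulVec hK').eqOn td.pos (hU₀.mulVec hK') (hinv k)
      (continuousOn_actVec hK' td.pos.le (hu k))
      (continuousOn_actVec hK' td.pos.le (hu 0)) ht).symm
  refine cong_of_cong_smul (pow_ne_zero n (inv_ne_zero RatFunc.X_ne_zero)) ?_
  exact ((hW.mulVec hK').congr_eqOn heq).cong (hU₀.mulVec hK')

/-- The limit of a run with continuous inputs is given by the formula for the learned input. -/
theorem TrackingData.exists_uniform_limit_formula [DecidableEq κ]
    {u : ℕ → ℝ → κ → ℝ} {y : ℕ → ℝ → Fin q → ℝ}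
    (hrun : IsILCRun T G₁ G₂ D Γ yd u y) (hu : ∀ k, ContinuousOn (u k) (Icc 0 T))
    {L' : Matrix κ (Fin q) ℝ} (hΓ : HasLimitAtInfinity ((RatFunc.X : RatFunc ℝ)⁻¹ • Γ) L')
    {M : Matrix (Fin q) (Fin q) ℝ} (hM : HasLimitAtInfinity (G₁ * Γ) M)
    (hspec : spectralRadius ℂ ((1 - M).map (algebraMap ℝ ℂ)) < 1) :
    ∃ w : ℝ → κ → ℝ, ContinuousOn w (Icc 0 T) ∧ TendstoUniformlyOn u w atTop (Icc 0 T) ∧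
      TendstoUniformlyOn y yd atTop (Icc 0 T) ∧
      ∃ U₀ W Yd, IsTransformOn T (u 0) U₀ ∧ IsTransformOn T w W ∧ IsTransformOn T yd Yd ∧
        ∀ᶠ s in atTop, W s = evalAt (Γ * (G₁ * Γ)⁻¹) s *ᵥ (Yd s - evalAt G₂ s *ᵥ evalVec D s)
          + evalAt (1 - Γ * (G₁ * Γ)⁻¹ * G₁) s *ᵥ U₀ s := by
  obtain ⟨w, hwc, hwu, hyu, B, hB⟩ := td.exists_uniform_limit hrun hu hΓ hM hspec
  refine ⟨w, hwc, hwu, hyu, ?_⟩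
  have hMdet := isUnit_det_of_spectralRadius_lt_one hspec
  have hdet := hM.isUnit_det hMdet
  have hS := hM.inv hMdet
  set S := (G₁ * Γ)⁻¹
  have hPΓ : (1 - Γ * S * G₁) * Γ = 0 := by
    rw [Matrix.sub_mul, Matrix.one_mul, Matrix.mul_assoc, Matrix.mul_assoc,
      Matrix.nonsing_inv_mul _ hdet, Matrix.mul_one, sub_self]
  obtain ⟨W', hW'⟩ := exists_vecTransOn hwc
  obtain ⟨U₀', hU₀'⟩ := exists_vecTransOn (hu 0)
  obtain ⟨U₀, hU₀, hU₀e⟩ := hU₀'.exists_isTransformOn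
  replace hU₀' := hU₀.vecTransOn
  obtain ⟨Yd, hYd, hYde⟩ := td.trans_yd.exists_isTransformOn
  have hB' : ∀ k, ∀ t ∈ Ioc 0 T, ∀ i, |u k t i| ≤ B := fun k t ht =>
    hB k t (Ioc_subset_Icc_self ht)
  have hw : ∀ t ∈ Icc 0 T, Tendsto (fun k => u k t) atTop (𝓝 (w t)) := fun t ht =>
    hwu.tendsto_at ht
  have hy : ∀ t ∈ Icc 0 T, Tendsto (fun k => y k t) atTop (𝓝 (yd t)) := fun t ht =>
    hyu.tendsto_at ht
  have h1 := td.cong_of_tendsto hrun hu hB' hw hy hW'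
  have h2 := td.cong_of_mul_eq_zero hPΓ hrun hu hB' hw hW' hU₀'
  have hcong : Cong T W' (fun s => evalAt (Γ * S) s *ᵥ (s⁻¹ • H s)
      + evalAt (1 - Γ * S * G₁) s *ᵥ U₀ s) := by
    refine (Cong.of_eventuallyEq ?_).trans ((h1.mulVec (Γ * S)).add h2)
    filter_upwards [evalAt_mul (Γ * S) G₁, evalAt_sub 1 (Γ * S * G₁)] with s a b
    rw [Matrix.mulVec_mulVec, ← a, b, evalAt_one, Matrix.sub_mulVec, Matrix.one_mulVec]
    abel
  -- the right-hand side is the transform of `u 0 + (s⁻¹ Γ S) e₀'`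
  have hrhs : VecTransOn T (fun t => u 0 t +
      actVec ((RatFunc.X : RatFunc ℝ)⁻¹ • Γ * S) (errRate G₁ h (u 0)) t)
      (fun s => evalAt (Γ * S) s *ᵥ (s⁻¹ • H s) + evalAt (1 - Γ * S * G₁) s *ᵥ U₀ s) := by
    refine (hU₀'.add ((td.trans_errRate hU₀').mulVec (hΓ.mul hS))).congr ?_
    rw [Matrix.smul_mul]
    filter_upwards [evalAt_mul (Γ * S) G₁, evalAt_sub 1 (Γ * S * G₁),
      evalAt_X_inv_smul (Γ * S) (errRateTrans G₁ H U₀), evalAt_eq_inv_smul_X_smul G₁ U₀]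
      with s a b c d
    rw [c, b, a, evalAt_one, Matrix.sub_mulVec, Matrix.one_mulVec, ← Matrix.mulVec_mulVec, d,
      errRateTrans, Matrix.mulVec_sub, smul_sub, Matrix.mulVec_smul, Matrix.mulVec_smul]
    abel
  obtain ⟨W, hW, hWe⟩ := (hW'.of_cong td.pos.le hrhs hcong).exists_isTransformOn
  refine ⟨U₀, W, Yd, hU₀, hW, hYd, ?_⟩
  filter_upwards [hWe, hYde] with s a b
  rw [← a, ← b, add_sub_cancel_left]

end Run

/-! ### Necessity: uniform boundedness of the learning operators -/

theorem conv_add {k f f' : ℝ → ℝ} (hk : Continuous k) (hf : Continuous f) (hf' : Continuous f')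
    (t : ℝ) : conv k (fun τ => f τ + f' τ) t = conv k f t + conv k f' t := by
  simp only [conv, mul_add]
  exact intervalIntegral.integral_add (by apply Continuous.intervalIntegrable; fun_prop)
    (by apply Continuous.intervalIntegrable; fun_prop)

theorem conv_const_mul (k f : ℝ → ℝ) (c t : ℝ) :
    conv k (fun τ => c * f τ) t = c * conv k f t := by
  simp only [conv, ← intervalIntegral.integral_const_mul]
  congr 1
  ext τ
  ring

theorem actVec_add [Fintype κ] {R : Matrix ι κ (RatFunc ℝ)} {K : Matrix ι κ ℝ}
    (hR : HasLimitAtInfinity R K) {f f' : ℝ → κ → ℝ} (hf : Continuous f) (hf' : Continuous f')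
    (t : ℝ) : actVec R (fun τ => f τ + f' τ) t = actVec R f t + actVec R f' t := by
  ext i
  simp only [actVec, Pi.add_apply, ← Finset.sum_add_distrib]
  refine Finset.sum_congr rfl fun j _ => ?_
  simp only [act]
  rw [conv_add (hR.hasFiniteLim i j).isKernel.continuous (by fun_prop) (by fun_prop)]
  ring

theorem actVec_smul [Fintype κ] (R : Matrix ι κ (RatFunc ℝ)) (c : ℝ) (f : ℝ → κ → ℝ) (t : ℝ) :
    actVec R (fun τ => c • f τ) t = c • actVec R f t := by
  ext i
  simp only [actVec, Pi.smul_apply, smul_eq_mul, Finset.mul_sum]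
  refine Finset.sum_congr rfl fun j _ => ?_
  simp only [act]
  rw [conv_const_mul]
  ring

/-- The continuous approximations `min 1 (n (τ - a))₊` of the indicator function of `(a, ∞)`. -/
noncomputable def ramp (a : ℝ) (n : ℕ) (τ : ℝ) : ℝ := max 0 (min 1 (n * (τ - a)))

theorem continuous_ramp (a : ℝ) (n : ℕ) : Continuous (ramp a n) := by
  unfold ramp
  fun_prop

theorem abs_ramp_le (a : ℝ) (n : ℕ) (τ : ℝ) : |ramp a n τ| ≤ 1 := by
  rw [abs_of_nonneg (le_max_left _ _)]
  exact max_le zero_le_one (min_le_left _ _)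

theorem tendsto_ramp (a τ : ℝ) :
    Tendsto (fun n => ramp a n τ) atTop (𝓝 ((Ioi a).indicator (fun _ => 1) τ)) := by
  by_cases h : a < τ
  · rw [indicator_of_mem (mem_Ioi.2 h)]
    have h1 : Tendsto (fun n : ℕ => (n : ℝ) * (τ - a)) atTop atTop :=
      tendsto_natCast_atTop_atTop.atTop_mul_const (sub_pos.2 h)
    refine tendsto_const_nhds.congr' ?_
    filter_upwards [h1.eventually_ge_atTop 1] with n hn
    rw [ramp, min_eq_left hn, max_eq_right zero_le_one]
  · rw [indicator_of_notMem (by simpa using h)]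
    refine tendsto_const_nhds.congr fun n => ?_
    have : (n : ℝ) * (τ - a) ≤ 0 :=
      mul_nonpos_of_nonneg_of_nonpos (Nat.cast_nonneg n) (sub_nonpos.2 (not_lt.1 h))
    rw [ramp, max_eq_left ((min_le_right _ _).trans this)]

/-- Shift invariance: the response at time `t` to a step at time `0` is the response at time `T` to
a step at time `T - t`, which is a limit of responses to continuous signals. -/
theorem tendsto_act_ramp {g : RatFunc ℝ} (hg : HasFiniteLim g) {t : ℝ} (ht0 : 0 < t) (ht : t ≤ T)
    (c : ℝ) : Tendsto (fun n => act g (fun τ => ramp (T - t) n τ * c) T) atTop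
      (𝓝 (act g (fun _ => c) t)) := by
  have hk := hg.isKernel.continuous
  have h1 : Tendsto (fun n => gain g * (ramp (T - t) n T * c)) atTop (𝓝 (gain g * c)) := by
    have := tendsto_ramp (T - t) T
    rw [indicator_of_mem (by simpa using ht0)] at this
    simpa using (this.mul_const c).const_mul (gain g)
  obtain ⟨C, hC⟩ := (isCompact_Icc (a := (0 : ℝ)) (b := T)).exists_bound_of_continuousOn
    hk.continuousOn
  have h2 : Tendsto (fun n => conv (kernel g) (fun τ => ramp (T - t) n τ * c) T) atTop
      (𝓝 (∫ τ in (0 : ℝ)..T,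
        kernel g (T - τ) * ((Ioi (T - t)).indicator (fun _ => 1) τ * c))) := by
    refine intervalIntegral.tendsto_integral_filter_of_dominated_convergence (fun _ => C * |c|)
      (Eventually.of_forall fun k => ?_) (Eventually.of_forall fun k => ?_) (by simp) ?_
    · have := continuous_ramp (T - t) k
      exact (by fun_prop : Continuous fun τ =>
        kernel g (T - τ) * (ramp (T - t) k τ * c)).aestronglyMeasurable
    · refine Eventually.of_forall fun τ hτ => ?_
      rw [uIoc_of_le (ht0.le.trans ht)] at hτ
      have h3 := hC (T - τ) ⟨by linarith [hτ.2], by linarith [hτ.1]⟩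
      rw [norm_mul]
      refine mul_le_mul h3 ?_ (norm_nonneg _) ((norm_nonneg _).trans h3)
      rw [norm_mul, Real.norm_eq_abs, Real.norm_eq_abs]
      exact mul_le_of_le_one_left (abs_nonneg _) (abs_ramp_le _ _ _)
    · exact Eventually.of_forall fun τ _ => ((tendsto_ramp _ τ).mul_const c).const_mul _
  have h3 : ∫ τ in (0 : ℝ)..T, kernel g (T - τ) * ((Ioi (T - t)).indicator (fun _ => 1) τ * c)
      = conv (kernel g) (fun _ => c) t := by
    have h4 : ∀ τ, kernel g (T - τ) * ((Ioi (T - t)).indicator (fun _ => 1) τ * c)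
        = (Ioi (T - t)).indicator (fun τ => kernel g (T - τ) * c) τ := by
      intro τ
      by_cases h : τ ∈ Ioi (T - t)
      · simp only [indicator_of_mem h, one_mul]
      · simp only [indicator_of_notMem h, zero_mul, mul_zero]
    simp only [h4]
    rw [intervalIntegral.integral_of_le (ht0.le.trans ht), setIntegral_indicator measurableSet_Ioi,
      Ioc_inter_Ioi, max_eq_right (sub_nonneg.2 ht),
      ← intervalIntegral.integral_of_le (by linarith), conv]
    have h5 := intervalIntegral.integral_comp_add_right (a := 0) (b := t)
      (fun τ => kernel g (T - τ) * c) (T - t)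
    rw [zero_add, add_sub_cancel] at h5
    rw [← h5]
    congr 1
    ext τ
    congr 2
    ring
  rw [h3] at h2
  exact h1.add h2

/-- If the operators given by a sequence of rational matrices are bounded at time `T` on every
continuous signal, then their step responses are uniformly bounded on `(0, T]`: by the uniform
boundedness principle the evaluations at time `T` are bounded in norm, and by shift invariance this
controls earlier times. -/
theorem exists_step_response_bound {ι κ : Type*} [Fintype ι] [Fintype κ] (hT : 0 ≤ T)
    {R : ℕ → Matrix ι κ (RatFunc ℝ)} {K : ℕ → Matrix ι κ ℝ}
    (hR : ∀ k, HasLimitAtInfinity (R k) (K k))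
    (hbdd : ∀ f : ℝ → κ → ℝ, Continuous f → ∃ C, ∀ k, ‖actVec (R k) f T‖ ≤ C) (c : κ → ℝ) :
    ∃ B, ∀ k, ∀ t ∈ Ioc 0 T, ‖actVec (R k) (fun _ => c) t‖ ≤ B := by
  have hTm : T ∈ Icc 0 T := ⟨hT, le_rfl⟩
  have hext : ∀ f : C(Icc 0 T, κ → ℝ), Continuous (IccExtend hT f) := fun f => f.continuous.Icc_extend'
  choose C hC0 hC using fun k => exists_actVec_bound (hR k) T
  let Λ : ℕ → C(Icc 0 T, κ → ℝ) →L[ℝ] (ι → ℝ) := fun k =>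
    LinearMap.mkContinuous
      { toFun := fun f => actVec (R k) (IccExtend hT f) T
        map_add' := fun f f' => actVec_add (hR k) (hext f) (hext f') T
        map_smul' := fun a f => actVec_smul (R k) a (IccExtend hT f) T } (C k) (fun f => by
      refine (pi_norm_le_iff_of_nonneg (mul_nonneg (hC0 k) (norm_nonneg f))).2 fun i => ?_
      refine hC k _ _ (norm_nonneg f) (fun t _ j => ?_) T hTm i
      exact (norm_le_pi_norm (IccExtend hT f t) j).trans (f.norm_coe_le_norm _))
  obtain ⟨B, hB⟩ := banach_steinhaus (g := Λ) fun f => hbdd _ (hext f)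
  refine ⟨B * ‖c‖, fun k t ht => ?_⟩
  have hB0 : 0 ≤ B := (norm_nonneg _).trans (hB k)
  have hlim : Tendsto (fun n => actVec (R k) (fun τ => ramp (T - t) n τ • c) T) atTop
      (𝓝 (actVec (R k) (fun _ => c) t)) := by
    refine tendsto_pi_nhds.2 fun i => tendsto_finsetSum _ fun j _ => ?_
    exact tendsto_act_ramp ((hR k).hasFiniteLim i j) ht.1 ht.2 (c j)
  refine le_of_tendsto hlim.norm (Eventually.of_forall fun n => ?_)
  let f : C(Icc 0 T, κ → ℝ) := ⟨fun τ => ramp (T - t) n τ • c, by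
    have := continuous_ramp (T - t) n
    fun_prop⟩
  have hf : EqOn (fun τ => ramp (T - t) n τ • c) (IccExtend hT f) (Icc 0 T) := fun τ hτ => by
    rw [IccExtend_of_mem hT _ hτ]
    rfl
  rw [actVec_congr hf hTm]
  refine ((Λ k).le_of_opNorm_le (hB k) f).trans (mul_le_mul_of_nonneg_left ?_ hB0)
  refine (ContinuousMap.norm_le f (norm_nonneg c)).2 fun τ => ?_
  change ‖ramp (T - t) n τ • c‖ ≤ ‖c‖
  rw [norm_smul]
  exact mul_le_of_le_one_left (norm_nonneg c) (abs_ramp_le _ _ _)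

section Run

variable {q m : ℕ} [Fintype κ] {G₁ : Matrix (Fin q) κ (RatFunc ℝ)}
  {G₂ : Matrix (Fin q) (Fin m) (RatFunc ℝ)} {D : Fin m → RatFunc ℝ} {yd : ℝ → Fin q → ℝ}
  {K : Matrix (Fin q) κ ℝ} {R : Matrix κ (Fin q) (RatFunc ℝ)} {L : Matrix κ (Fin q) ℝ}
  {ψ h H : ℝ → Fin q → ℝ} {Γ : Matrix κ (Fin q) (RatFunc ℝ)}

variable (td : TrackingData T G₁ (fun s => evalAt G₂ s *ᵥ evalVec D s) yd K R L ψ h H)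
include td

/-- Every continuous function is the error rate of a continuous input. -/
theorem TrackingData.exists_errRate_eqOn {f : ℝ → Fin q → ℝ} (hf : ContinuousOn f (Icc 0 T)) :
    ∃ u, ContinuousOn u (Icc 0 T) ∧ EqOn (errRate G₁ h u) f (Icc 0 T) := by
  obtain ⟨F, hF⟩ := exists_vecTransOn hf
  have hc : ContinuousOn (fun t => h t - f t) (Icc 0 T) := td.continuousOn_h.sub hf
  -- the input `R (h - f)`
  have hu := continuousOn_actVec td.limit_R td.pos.le hc
  refine ⟨_, hu, ?_⟩
  refine (td.trans_errRate ((td.trans_h.sub hF).mulVec td.limit_R)).eqOn td.pos hF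
    (Cong.of_eventuallyEq ?_) (td.continuousOn_errRate hu) hf
  filter_upwards [evalAt_mul ((RatFunc.X : RatFunc ℝ) • G₁) R] with s hs
  rw [errRateTrans, Matrix.mulVec_mulVec, ← hs, td.mul_R, evalAt_one, Matrix.one_mulVec,
    sub_sub_cancel]

omit td in
theorem errRate_congr {u u' : ℝ → κ → ℝ} (hu : EqOn u u' (Icc 0 T)) :
    EqOn (errRate G₁ h u) (errRate G₁ h u') (Icc 0 T) := fun t ht => by
  rw [errRate, errRate, actVec_congr hu ht]

/-- Convergence from every initial input forces `s⁻¹ Γ` to have a finite limit. Take the `j`-th unit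
step as initial error rate: the first increment `v` of the `i`-th input satisfies `γ⁻¹ V ≡ s⁻¹` with
`γ` the `(i, j)` entry of `s⁻¹ Γ`. If `γ` had no finite limit, `γ⁻¹` would be strictly proper, and
the response of `γ⁻¹` to the continuous signal `v` would vanish at `0` instead of being `1`. -/
theorem TrackingData.hasFiniteLim_of_isLearnedInput
    (hall : ∀ u₀ : ℝ → κ → ℝ, ContinuousOn u₀ (Icc 0 T) →
      ∃ w, IsLearnedInput T G₁ G₂ D Γ yd u₀ w) :
    ∃ L', HasLimitAtInfinity ((RatFunc.X : RatFunc ℝ)⁻¹ • Γ) L' := by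
  suffices hfin : ∀ i j, HasFiniteLim (((RatFunc.X : RatFunc ℝ)⁻¹ • Γ) i j) by
    choose L' hL' using hfin
    exact ⟨L', hL'⟩
  intro i j
  by_contra hnot
  set γ := ((RatFunc.X : RatFunc ℝ)⁻¹ • Γ) i j with hγ
  have hinv := hasLim_inv_of_not_hasFiniteLim hnot
  have hγ0 : γ ≠ 0 := by
    intro h0
    exact hnot ⟨0, by rw [h0]; simpa using HasLim.const 0⟩
  have hstep : VecTransOn T (fun _ => Pi.single j (1 : ℝ)) (fun s => s⁻¹ • Pi.single j 1) := by
    intro l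
    refine ((transOn_one.const_mul ((Pi.single j (1 : ℝ) : Fin q → ℝ) l)).congr_eqOn
      fun t _ => mul_one _).congr (Eventually.of_forall fun s => mul_comm _ _)
  obtain ⟨u₀, hu₀, heq⟩ := td.exists_errRate_eqOn (f := fun _ => Pi.single j (1 : ℝ))
    continuousOn_const
  obtain ⟨w, -, u, y, hrun, h0, hu, -, -⟩ := hall u₀ hu₀
  choose U hU using fun k => exists_vecTransOn (hu k)
  have hrate := ((td.trans_errRate (hU 0)).congr_eqOn
    (fun t ht => (errRate_congr h0 ht).trans (heq ht))).cong hstep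
  have h1 := ((td.cong_update hrun hU 0).trans
    ((Cong.refl (U 0)).add (hrate.mulVec ((RatFunc.X : RatFunc ℝ)⁻¹ • Γ)))) i
  have h2 : Negl T (fun s => ev γ⁻¹ s * (U 1 s i - U 0 s i) - s⁻¹) := by
    refine (h1.mul γ⁻¹).congr ?_
    filter_upwards [ev_inv γ, ev_ne_zero hγ0] with s a b
    have h3 : (evalAt ((RatFunc.X : RatFunc ℝ)⁻¹ • Γ) s *ᵥ (s⁻¹ • Pi.single j 1)) i
        = s⁻¹ * ev γ s := by
      rw [Matrix.mulVec_smul, Matrix.mulVec_single_one]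
      rfl
    rw [a, Pi.add_apply, h3]
    field_simp
    ring
  have hcont : ContinuousOn (fun t => u 1 t i - u 0 t i) (Icc 0 T) :=
    (continuousOn_pi.1 (hu 1) i).sub (continuousOn_pi.1 (hu 0) i)
  have h4 := ((((hU 1 i).sub (hU 0 i)).act ⟨0, hinv⟩).eqOn td.pos transOn_one h2
    (continuousOn_act ⟨0, hinv⟩ td.pos.le hcont) continuousOn_const) ⟨le_rfl, td.pos.le⟩
  rw [act_apply_zero, hinv.gain_eq, zero_mul] at h4
  exact zero_ne_one h4

/-- The inputs of a run, in terms of the initial error rate. -/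
theorem TrackingData.input_eqOn {u : ℕ → ℝ → κ → ℝ} {y : ℕ → ℝ → Fin q → ℝ}
    (hrun : IsILCRun T G₁ G₂ D Γ yd u y) (hu : ∀ k, ContinuousOn (u k) (Icc 0 T))
    {Q : ℕ → Matrix κ (Fin q) (RatFunc ℝ)} (hQ0 : Q 0 = 0)
    (hQ : ∀ k, Q (k + 1) = Q k + (RatFunc.X : RatFunc ℝ)⁻¹ • Γ * (1 - G₁ * Γ) ^ k)
    {KQ : ℕ → Matrix κ (Fin q) ℝ} (hKQ : ∀ k, HasLimitAtInfinity (Q k) (KQ k)) (k : ℕ) :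
    EqOn (u k) (fun t => u 0 t + actVec (Q k) (errRate G₁ h (u 0)) t) (Icc 0 T) := by
  choose U hU using fun k => exists_vecTransOn (hu k)
  have hcong : ∀ k, Cong T (U k)
      (fun s => U 0 s + evalAt (Q k) s *ᵥ errRateTrans G₁ H (U 0) s) := by
    intro k
    induction k with
    | zero =>
      refine Cong.of_eventuallyEq (Eventually.of_forall fun s => ?_)
      simp only [hQ0, evalAt_zero, Matrix.zero_mulVec, add_zero]
    | succ k ih =>
      have h1 := td.cong_errRate_add hrun hU 0 k
      rw [zero_add] at h1
      refine ((td.cong_update hrun hU k).trans (ih.add (h1.mulVec _))).trans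
        (Cong.of_eventuallyEq ?_)
      rw [hQ]
      filter_upwards [evalAt_add (Q k) ((RatFunc.X : RatFunc ℝ)⁻¹ • Γ * (1 - G₁ * Γ) ^ k),
        evalAt_mul ((RatFunc.X : RatFunc ℝ)⁻¹ • Γ) ((1 - G₁ * Γ) ^ k)] with s a b
      rw [a, b, Matrix.add_mulVec, Matrix.mulVec_mulVec, add_assoc]
  exact (hU k).eqOn td.pos ((hU 0).add ((td.trans_errRate (hU 0)).mulVec (hKQ k))) (hcong k)
    (hu k) ((hu 0).add (continuousOn_actVec (hKQ k) td.pos.le (td.continuousOn_errRate (hu 0))))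

/-- Convergence from every initial input forces the gain condition. Start with a constant error rate
`c`. The inputs are bounded by the uniform boundedness principle, so their limit has error rate
zero, and at `t = 0`, where operators act by their gains, the error rates `(1 - M) ^ k c` tend
to zero. -/
theorem TrackingData.spectralRadius_lt_one [NeZero q]
    (hall : ∀ u₀ : ℝ → κ → ℝ, ContinuousOn u₀ (Icc 0 T) →
      ∃ w, IsLearnedInput T G₁ G₂ D Γ yd u₀ w) {L' : Matrix κ (Fin q) ℝ}
    (hΓ : HasLimitAtInfinity ((RatFunc.X : RatFunc ℝ)⁻¹ • Γ) L')
    {M : Matrix (Fin q) (Fin q) ℝ} (hM : HasLimitAtInfinity (G₁ * Γ) M) :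
    spectralRadius ℂ ((1 - M).map (algebraMap ℝ ℂ)) < 1 := by
  refine spectralRadius_lt_one_of_tendsto fun c => ?_
  set Q : ℕ → Matrix κ (Fin q) (RatFunc ℝ) := fun k =>
    ∑ j ∈ Finset.range k, (RatFunc.X : RatFunc ℝ)⁻¹ • Γ * (1 - G₁ * Γ) ^ j
  have hQ0 : Q 0 = 0 := Finset.sum_range_zero _
  have hQ : ∀ k, Q (k + 1) = Q k + (RatFunc.X : RatFunc ℝ)⁻¹ • Γ * (1 - G₁ * Γ) ^ k := fun k =>
    Finset.sum_range_succ _ k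
  have hKQ : ∀ k, ∃ KQ, HasLimitAtInfinity (Q k) KQ := by
    intro k
    induction k with
    | zero => exact ⟨0, fun i j => by simp [hQ0, evalAt]⟩
    | succ k ih =>
      obtain ⟨KQ, h1⟩ := ih
      exact ⟨_, by rw [hQ]; exact h1.add (hΓ.mul (hM.one_sub_mul_pow k))⟩
  choose KQ hKQ using hKQ
  have hTm : T ∈ Icc 0 T := ⟨td.pos.le, le_rfl⟩
  have h0m : (0 : ℝ) ∈ Icc 0 T := ⟨le_rfl, td.pos.le⟩
  obtain ⟨B, hB⟩ := exists_step_response_bound td.pos.le hKQ (fun f hf => by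
    obtain ⟨u₀, hu₀, heq⟩ := td.exists_errRate_eqOn (f := f) hf.continuousOn
    obtain ⟨w, -, u, y, hrun, h0, hu, hw, -⟩ := hall u₀ hu₀
    obtain ⟨C, hC⟩ := ((hw T hTm).sub_const (u 0 T)).norm.bddAbove_range
    refine ⟨C, fun k => hC ⟨k, ?_⟩⟩
    simp only
    rw [td.input_eqOn hrun hu hQ0 hQ hKQ k hTm, add_sub_cancel_left,
      actVec_congr (fun t ht => (errRate_congr h0 ht).trans (heq ht)) hTm]) c
  obtain ⟨u₀, hu₀, heq⟩ := td.exists_errRate_eqOn (f := fun _ => c) continuousOn_const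
  obtain ⟨w, hwc, u, y, hrun, h0, hu, hw, hy⟩ := hall u₀ hu₀
  have hrate0 : EqOn (errRate G₁ h (u 0)) (fun _ => c) (Icc 0 T) := fun t ht =>
    (errRate_congr h0 ht).trans (heq ht)
  obtain ⟨B₀, hB₀, hB₀'⟩ := exists_bound_of_continuousOn (hu 0)
  have hbound : ∀ k, ∀ t ∈ Ioc 0 T, ∀ i, |u k t i| ≤ B₀ + B := by
    intro k t ht i
    have htm := Ioc_subset_Icc_self ht
    rw [td.input_eqOn hrun hu hQ0 hQ hKQ k htm]
    simp only
    rw [actVec_congr hrate0 htm]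
    refine (abs_add_le _ _).trans (add_le_add (hB₀' t htm i) ?_)
    exact (norm_le_pi_norm (actVec (Q k) (fun _ => c) t) i).trans (hB k t ht)
  obtain ⟨W, hW⟩ := exists_vecTransOn hwc
  have hcong := td.cong_of_tendsto hrun hu hbound hw hy hW
  -- the limit input has error rate zero
  have hcong' : Cong T (fun s => evalAt ((RatFunc.X : RatFunc ℝ) • G₁) s *ᵥ W s) H := by
    intro i
    refine ((hcong i).mul RatFunc.X).congr ?_
    filter_upwards [evalAt_smul (RatFunc.X : RatFunc ℝ) G₁, eventually_ne_atTop 0] with s a b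
    rw [a, Matrix.smul_mulVec, Pi.smul_apply, Pi.smul_apply, smul_eq_mul, smul_eq_mul, mul_sub]
    simp only [ev, RatFunc.eval_X]
    rw [mul_inv_cancel_left₀ b]
  have hwh := (hW.mulVec td.limit).eqOn td.pos td.trans_h hcong'
    (continuousOn_actVec td.limit td.pos.le hwc) td.continuousOn_h h0m
  rw [actVec_apply_zero td.limit] at hwh
  have hzero : Tendsto (fun k => errRate G₁ h (u k) 0) atTop (𝓝 0) := by
    have h1 : Tendsto (fun k => h 0 - K *ᵥ u k 0) atTop (𝓝 (h 0 - K *ᵥ w 0)) := by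
      refine tendsto_const_nhds.sub ?_
      exact ((by fun_prop : Continuous fun v : κ → ℝ => K *ᵥ v).tendsto (w 0)).comp (hw 0 h0m)
    rw [hwh, sub_self] at h1
    refine h1.congr fun k => ?_
    rw [errRate, actVec_apply_zero td.limit]
  refine hzero.congr fun k => ?_
  have h1 := td.errRate_add_eqOn hrun hu hM 0 k h0m
  rw [zero_add] at h1
  rw [h1, actVec_apply_zero (hM.one_sub_mul_pow k), hrate0 h0m]

end Run

/-! ### Verification of the standing data -/

/-- A strictly proper rational function is the transform of a continuous function, whose value at
`0` is `lim s g(s)`. -/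
theorem transOn_of_hasLim_zero {g : RatFunc ℝ} (hg : HasLim g 0) :
    TransOn T (act (RatFunc.X * g) (fun _ => 1)) (ev g) := by
  refine (transOn_one.act hg.X_mul).congr ?_
  filter_upwards [ev_mul RatFunc.X g, eventually_ne_atTop 0] with s h1 h2
  rw [h1]
  simp only [ev, RatFunc.eval_X]
  field_simp

/-- The initial value theorem. -/
theorem IsImpulseResponse.apply_zero {ι κ : Type*} (hT : 0 < T) {G : Matrix ι κ (RatFunc ℝ)}
    {Φ : ℝ → Matrix ι κ ℝ} {K : Matrix ι κ ℝ} (hG : IsStrictlyProper G)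
    (hΦ : IsImpulseResponse G Φ) (hK : HasLimitAtInfinity ((RatFunc.X : RatFunc ℝ) • G) K) :
    Φ 0 = K := by
  ext i j
  obtain ⟨hc, htr, hev⟩ := hΦ i j
  have hKij : HasLim (RatFunc.X * G i j) (K i j) := hK i j
  have h1 : TransOn T (fun t => Φ t i j) (ev (G i j)) :=
    ⟨_, htr, fun _ _ => rfl, hev.mono fun s hs => hs.symm⟩
  have h2 := h1.eqOn hT (transOn_of_hasLim_zero (hG i j))
    (negl_zero.congr (Eventually.of_forall fun s => (sub_self _).symm))
    (hc.mono Icc_subset_Ici_self) (continuousOn_act ⟨_, hKij⟩ hT.le continuousOn_const)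
    ⟨le_rfl, hT.le⟩
  rw [act_apply_zero, hKij.gain_eq, mul_one] at h2
  exact h2

/-- The transform of a continuously differentiable function. -/
theorem transOn_of_contDiffOn {f : ℝ → ℝ} (hT : 0 < T) (hf : ContDiffOn ℝ 1 f (Icc 0 T))
    {F : ℝ → ℝ} (hF : TransOn T (derivWithin f (Icc 0 T)) F) :
    TransOn T f (fun s => f 0 * s⁻¹ + s⁻¹ * F s) := by
  have h1 := (transOn_one.const_mul (f 0)).add (hF.act ⟨0, HasLim.X_inv⟩)
  refine (h1.congr_eqOn fun t ht => ?_).congr ?_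
  · simp only [mul_one]
    have hsub : Icc 0 t ⊆ Icc 0 T := Icc_subset_Icc_right ht.2
    have hd : ∀ x ∈ Ioo 0 t, HasDerivAt f (derivWithin f (Icc 0 T) x) x := fun x hx => by
      have hx' : x ∈ Icc 0 T := hsub (Ioo_subset_Icc_self hx)
      have hn : Icc 0 T ∈ 𝓝 x := Icc_mem_nhds hx.1 (hx.2.trans_le ht.2)
      exact ((hf.differentiableOn one_ne_zero x hx').hasDerivWithinAt).hasDerivAt hn
    have hc : ContinuousOn (derivWithin f (Icc 0 T)) (Icc 0 T) :=
      hf.continuousOn_derivWithin (uniqueDiffOn_Icc hT) le_rfl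
    rw [act_X_inv ht.1, intervalIntegral.integral_eq_sub_of_hasDerivAt_of_le ht.1
      (hf.continuousOn.mono hsub) hd ((hc.mono hsub).intervalIntegrable_of_Icc ht.1)]
    ring
  · filter_upwards [ev_X_inv_eventually] with s hs
    rw [hs]

section System

variable {q r m : ℕ}

/-- The constant limit of `s G₁` has a nonsingular block of columns, so `s G₁` has a right inverse
supported in these columns. -/
theorem exists_right_inverse {A : Matrix (Fin q) (Fin q ⊕ Fin r) (RatFunc ℝ)}
    {K : Matrix (Fin q) (Fin q ⊕ Fin r) ℝ} (hA : HasLimitAtInfinity A K)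
    (hK : IsUnit K.toCols₁.det) :
    ∃ (R : Matrix (Fin q ⊕ Fin r) (Fin q) (RatFunc ℝ)) (L : Matrix (Fin q ⊕ Fin r) (Fin q) ℝ),
      HasLimitAtInfinity R L ∧ A * R = 1 := by
  have h1 : HasLimitAtInfinity A.toCols₁ K.toCols₁ := fun i j => hA i (Sum.inl j)
  have hu := h1.isUnit_det hK
  refine ⟨Matrix.fromRows A.toCols₁⁻¹ 0, Matrix.fromRows K.toCols₁⁻¹ 0, ?_, ?_⟩
  · rintro (i | i) j
    · exact h1.inv hK i j
    · simp [evalAt]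
  · have h2 := Matrix.fromCols_mul_fromRows A.toCols₁ A.toCols₂ A.toCols₁⁻¹ 0
    rwa [Matrix.fromCols_toCols, Matrix.mul_zero, add_zero, Matrix.mul_nonsing_inv _ hu] at h2

/-- The hypotheses on the plant and on the reference provide the standing data. The initial condition
enters through the output for the zero input, which is the free response `ψ`: it gives
`yd(0) = ψ(0)`, so that `yd - ψ` is the integral of a continuous function. -/
theorem exists_trackingData (hT : 0 < T)
    {G₁ : Matrix (Fin q) (Fin q ⊕ Fin r) (RatFunc ℝ)} {G₂ : Matrix (Fin q) (Fin m) (RatFunc ℝ)}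
    {D : Fin m → RatFunc ℝ} {K : Matrix (Fin q) (Fin q ⊕ Fin r) ℝ}
    (hG₁ : IsStrictlyProper G₁) (hG₂ : IsStrictlyProper G₂)
    (hD : IsImpulsePlusStrictlyProper D)
    (hK : HasLimitAtInfinity ((RatFunc.X : RatFunc ℝ) • G₁) K) (hKdet : IsUnit K.toCols₁.det)
    {yd : ℝ → Fin q → ℝ} (hyd : ContDiffOn ℝ 1 yd (Icc 0 T))
    (hinit : InitialCondition T G₁ G₂ D yd) :
    ∃ R L ψ h H, TrackingData T G₁ (fun s => evalAt G₂ s *ᵥ evalVec D s) yd K R L ψ h H := by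
  obtain ⟨R, L, hR, hmul⟩ := exists_right_inverse hK hKdet
  obtain ⟨d₀, Dhat, -, hDhat, hDeq⟩ := hD
  have hDlim : ∀ j, HasLim (D j) (d₀ j) := fun j => by
    rw [hDeq]
    simpa using (HasLim.const (d₀ j)).add (hDhat j)
  -- the forced term `g = G₂ D`, and the strictly proper part `g'` of `s g`
  set g : Fin q → RatFunc ℝ := fun i => ∑ j, G₂ i j * D j with hgdef
  have hg : ∀ i, HasLim (g i) 0 := fun i => by
    have := HasLim.sum (S := Finset.univ) fun j _ =>
      (show HasLim (G₂ i j) 0 from hG₂ i j).mul (hDlim j)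
    simpa using this
  have hgev : (fun s i => ev (g i) s) =ᶠ[atTop] fun s => evalAt G₂ s *ᵥ evalVec D s := by
    filter_upwards [eventually_all.2 fun i => ev_sum Finset.univ fun j => G₂ i j * D j,
      eventually_all.2 fun i => eventually_all.2 fun j => ev_mul (G₂ i j) (D j)] with s h1 h2
    ext i
    simp only [hgdef, h1, h2]
    rfl
  have hXg : ∀ i, HasFiniteLim (RatFunc.X * g i) := fun i => (hg i).X_mul
  set ψ : ℝ → Fin q → ℝ := fun t i => act (RatFunc.X * g i) (fun _ => 1) t with hψdef
  have hψtr : VecTransOn T ψ (fun s => evalAt G₂ s *ᵥ evalVec D s) :=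
    VecTransOn.congr (F := fun s i => ev (g i) s) (fun i => transOn_of_hasLim_zero (hg i)) hgev
  have hψc : ContinuousOn ψ (Icc 0 T) := continuousOn_pi.2 fun i =>
    continuousOn_act (hXg i) hT.le continuousOn_const
  have hyd0 : ∀ i, yd 0 i = gain (RatFunc.X * g i) := by
    intro i
    have hout : IsOutput T G₁ G₂ D (fun _ => 0) ψ := by
      obtain ⟨Y, hY, hYe⟩ := hψtr.exists_isTransformOn
      obtain ⟨U, hU, hUe⟩ := VecTransOn.exists_isTransformOn (T := T)
        (f := fun _ => (0 : Fin q ⊕ Fin r → ℝ)) (F := fun _ => 0) fun i => transOn_zero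
      refine ⟨hψc, U, Y, hU, hY, ?_⟩
      filter_upwards [hYe, hUe] with s a b
      rw [← a, ← b, Matrix.mulVec_zero, zero_add]
    rw [hinit _ _ hout, hψdef]
    simp only [act_apply_zero, mul_one]
  set g' : Fin q → RatFunc ℝ := fun i => RatFunc.X * g i - RatFunc.C (gain (RatFunc.X * g i))
  have hg' : ∀ i, HasLim (g' i) 0 := fun i => by
    have h1 := (hXg i).hasLim_gain.sub (HasLim.const (gain (RatFunc.X * g i)))
    rwa [sub_self] at h1
  have hydi : ∀ i, ContDiffOn ℝ 1 (fun t => yd t i) (Icc 0 T) := contDiffOn_pi.1 hyd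
  set yd' : ℝ → Fin q → ℝ := fun t i => derivWithin (fun t => yd t i) (Icc 0 T) t
  have hyd'c : ContinuousOn yd' (Icc 0 T) := continuousOn_pi.2 fun i =>
    (hydi i).continuousOn_derivWithin (uniqueDiffOn_Icc hT) le_rfl
  obtain ⟨Yd', hYd'⟩ := exists_vecTransOn hyd'c
  refine ⟨R, L, ψ, fun t i => yd' t i - act (RatFunc.X * g' i) (fun _ => 1) t,
    fun s i => Yd' s i - ev (g' i) s, hT, hG₁, hK, hR, hmul, hψc, hψtr, ?_, ?_, ?_, ?_⟩
  · exact continuousOn_pi.2 fun i => (continuousOn_pi.1 hyd'c i).sub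
      (continuousOn_act (hg' i).X_mul hT.le continuousOn_const)
  · exact fun i => (hYd' i).sub (transOn_of_hasLim_zero (hg' i))
  · exact hyd.continuousOn
  · intro i
    refine (transOn_of_contDiffOn hT (hydi i) (hYd' i)).congr ?_
    filter_upwards [hgev, ev_sub (RatFunc.X * g i) (RatFunc.C (gain (RatFunc.X * g i))),
      ev_mul RatFunc.X (g i), eventually_ne_atTop 0] with s h1 h2 h3 h4
    rw [Pi.add_apply, ← congrFun h1 i, Pi.smul_apply, h2, h3, ev_C, hyd0, smul_eq_mul]
    simp only [ev, RatFunc.eval_X]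
    field_simp
    ring

/-- The block matrix `Γ̃` is the projection `1 - Γ (G₁ Γ)⁻¹ G₁`. -/
theorem gammaTilde_eq {G₁ : Matrix (Fin q) (Fin q ⊕ Fin r) (RatFunc ℝ)}
    {Γ : Matrix (Fin q ⊕ Fin r) (Fin q) (RatFunc ℝ)} (h11 : IsUnit G₁.toCols₁.det)
    (hdet : IsUnit (G₁ * Γ).det) :
    gammaTilde G₁ Γ = 1 - Γ * (G₁ * Γ)⁻¹ * G₁ := by
  set S := (G₁ * Γ)⁻¹
  set A := G₁.toCols₁
  set B := G₁.toCols₂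
  set C₁ := Γ.toRows₁
  set C₂ := Γ.toRows₂
  have hG : G₁ = Matrix.fromCols A B := (Matrix.fromCols_toCols G₁).symm
  have hΓ : Γ = Matrix.fromRows C₁ C₂ := (Matrix.fromRows_toRows Γ).symm
  have hA : A⁻¹ * A = 1 := Matrix.nonsing_inv_mul _ h11
  have hsum : (A * C₁ + B * C₂) * S = 1 := by
    rw [← Matrix.fromCols_mul_fromRows, ← hG, ← hΓ]
    exact Matrix.mul_nonsing_inv _ hdet
  -- `Γ₁ (G₁ Γ)⁻¹` in terms of the other blocks
  have hC₁ : C₁ * S = A⁻¹ - A⁻¹ * B * C₂ * S := by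
    have h1 : A⁻¹ * ((A * C₁ + B * C₂) * S) = A⁻¹ := by rw [hsum, Matrix.mul_one]
    rw [Matrix.add_mul, Matrix.mul_add, Matrix.mul_assoc A, ← Matrix.mul_assoc A⁻¹ A, hA,
      Matrix.one_mul] at h1
    rw [eq_sub_iff_add_eq]
    simpa only [Matrix.mul_assoc] using h1
  have hblock : Γ * S * G₁
      = Matrix.fromBlocks (C₁ * S * A) (C₁ * S * B) (C₂ * S * A) (C₂ * S * B) := by
    conv_lhs => rw [hG, hΓ]
    rw [Matrix.fromRows_mul, Matrix.fromRows_mul_fromCols]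
  rw [hblock, ← Matrix.fromBlocks_one, sub_eq_add_neg, Matrix.fromBlocks_neg,
    Matrix.fromBlocks_add, hC₁, Matrix.sub_mul, Matrix.sub_mul, hA]
  simp only [gammaTilde]
  congr 1
  · rw [neg_sub, add_sub_cancel]
  · rw [zero_add, Matrix.mul_sub, Matrix.mul_one]
    simp only [Matrix.mul_assoc]
    rfl
  · rw [zero_add]
  · rw [sub_eq_add_neg]

/-- The formula describes exactly the desired inputs: `G₁ Γ̃ = 0` gives one inclusion, and a desired
input reproduces itself when it is taken as the initial input. -/
theorem setOf_learnedInputFormula_eq {G₁ : Matrix (Fin q) (Fin q ⊕ Fin r) (RatFunc ℝ)}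
    {G₂ : Matrix (Fin q) (Fin m) (RatFunc ℝ)} {D : Fin m → RatFunc ℝ}
    {Γ : Matrix (Fin q ⊕ Fin r) (Fin q) (RatFunc ℝ)} (h11 : IsUnit G₁.toCols₁.det)
    (hdet : IsUnit (G₁ * Γ).det) (yd : ℝ → Fin q → ℝ) :
    {w | ∃ u₀, LearnedInputFormula T G₁ G₂ D Γ yd u₀ w} =
      {w | IsDesiredInput T G₁ G₂ D yd w} := by
  have hGΓ : G₁ * (Γ * (G₁ * Γ)⁻¹) = 1 := by
    rw [← Matrix.mul_assoc, Matrix.mul_nonsing_inv _ hdet]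
  have hGP : G₁ * (1 - Γ * (G₁ * Γ)⁻¹ * G₁) = 0 := by
    rw [Matrix.mul_sub, ← Matrix.mul_assoc G₁, hGΓ, Matrix.one_mul, Matrix.mul_one, sub_self]
  ext w
  simp only [mem_ofPred_eq, LearnedInputFormula, gammaTilde_eq h11 hdet]
  constructor
  · rintro ⟨u₀, U₀, W, Yd, -, hW, hYd, hform⟩
    refine ⟨W, Yd, hW, hYd, ?_⟩
    filter_upwards [hform, evalAt_mul G₁ (Γ * (G₁ * Γ)⁻¹),
      evalAt_mul G₁ (1 - Γ * (G₁ * Γ)⁻¹ * G₁)] with s h1 h2 h3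
    rw [h1, Matrix.mulVec_add, Matrix.mulVec_mulVec, Matrix.mulVec_mulVec, ← h2, ← h3, hGΓ, hGP,
      evalAt_one, evalAt_zero, Matrix.one_mulVec, Matrix.zero_mulVec, add_zero]
  · rintro ⟨U, Yd, hU, hYd, hdes⟩
    refine ⟨w, U, U, Yd, hU, hU, hYd, ?_⟩
    filter_upwards [hdes, evalAt_mul (Γ * (G₁ * Γ)⁻¹) G₁,
      evalAt_sub 1 (Γ * (G₁ * Γ)⁻¹ * G₁)] with s h1 h2 h3
    rw [← h1, h3, Matrix.mulVec_mulVec, ← h2, evalAt_one, Matrix.sub_mulVec, Matrix.one_mulVec,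
      add_sub_cancel]

theorem learnedInputFormula_congr {G₁ : Matrix (Fin q) (Fin q ⊕ Fin r) (RatFunc ℝ)}
    {G₂ : Matrix (Fin q) (Fin m) (RatFunc ℝ)} {D : Fin m → RatFunc ℝ}
    {Γ : Matrix (Fin q ⊕ Fin r) (Fin q) (RatFunc ℝ)} {yd : ℝ → Fin q → ℝ}
    {u₀ w w' : ℝ → Fin q ⊕ Fin r → ℝ} (h : LearnedInputFormula T G₁ G₂ D Γ yd u₀ w)
    (hw : EqOn w w' (Icc 0 T)) : LearnedInputFormula T G₁ G₂ D Γ yd u₀ w' := by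
  obtain ⟨U₀, W, Yd, h1, ⟨g, hg1, hg2, hg3⟩, h3, h4⟩ := h
  exact ⟨U₀, W, Yd, h1, ⟨g, hg1, hg2.trans hw, hg3⟩, h3, h4⟩

/-- A continuous desired input is learned from itself, in a constant run. -/
theorem IsDesiredInput.isLearnedInput {κ : Type*} [Fintype κ] {G₁ : Matrix (Fin q) κ (RatFunc ℝ)}
    {G₂ : Matrix (Fin q) (Fin m) (RatFunc ℝ)} {D : Fin m → RatFunc ℝ}
    {Γ : Matrix κ (Fin q) (RatFunc ℝ)} {yd : ℝ → Fin q → ℝ} {w : ℝ → κ → ℝ}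
    (hyd : ContinuousOn yd (Icc 0 T)) (hw : ContinuousOn w (Icc 0 T))
    (h : IsDesiredInput T G₁ G₂ D yd w) : IsLearnedInput T G₁ G₂ D Γ yd w w := by
  obtain ⟨U, Yd, hU, hYd, hdes⟩ := h
  refine ⟨hw, fun _ => w, fun _ => yd, ⟨fun _ => ⟨hyd, U, Yd, hU, hYd, ?_⟩, fun _ => ?_⟩,
    fun _ _ => rfl, fun _ => hw, fun _ _ => tendsto_const_nhds, fun _ _ => tendsto_const_nhds⟩
  · filter_upwards [hdes] with s hs
    rw [hs, sub_add_cancel]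
  · obtain ⟨E, hE, hEe⟩ := VecTransOn.exists_isTransformOn (T := T)
      (f := fun _ => (0 : Fin q → ℝ)) (F := fun _ => 0) fun i => transOn_zero
    simp only [sub_self]
    refine ⟨U, U, E, hU, hU, hE, ?_⟩
    filter_upwards [hEe] with s hs
    rw [← hs, Matrix.mulVec_zero, add_zero]

/-- A continuous input with error rate zero is a desired input. -/
theorem TrackingData.isDesiredInput {κ : Type*} [Fintype κ]
    {G₁ : Matrix (Fin q) κ (RatFunc ℝ)}
    {G₂ : Matrix (Fin q) (Fin m) (RatFunc ℝ)} {D : Fin m → RatFunc ℝ} {yd : ℝ → Fin q → ℝ}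
    {K : Matrix (Fin q) κ ℝ} {R : Matrix κ (Fin q) (RatFunc ℝ)} {L : Matrix κ (Fin q) ℝ}
    {ψ h H : ℝ → Fin q → ℝ}
    (td : TrackingData T G₁ (fun s => evalAt G₂ s *ᵥ evalVec D s) yd K R L ψ h H)
    {u : ℝ → κ → ℝ} (hu : ContinuousOn u (Icc 0 T))
    (h0 : EqOn (errRate G₁ h u) (fun _ => 0) (Icc 0 T)) : IsDesiredInput T G₁ G₂ D yd u := by
  obtain ⟨U, hU⟩ := exists_vecTransOn hu
  have hc : Cong T (errRateTrans G₁ H U) (fun _ => 0) :=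
    ((td.trans_errRate hU).congr_eqOn h0).cong fun i => transOn_zero
  have hyd : Cong T (fun s => evalAt G₂ s *ᵥ evalVec D s + s⁻¹ • H s)
      (fun s => evalAt G₁ s *ᵥ U s + evalAt G₂ s *ᵥ evalVec D s) := by
    refine (Cong.of_eventuallyEq ?_).trans (((Cong.refl fun s => evalAt G₁ s *ᵥ U s +
      evalAt G₂ s *ᵥ evalVec D s).add hc.inv_smul).trans
      (Cong.of_eventuallyEq (Eventually.of_forall fun s => ?_)))
    · filter_upwards [evalAt_eq_inv_smul_X_smul G₁ U] with s hs
      rw [hs, errRateTrans, smul_sub]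
      abel
    · simp
  obtain ⟨Yd, hYd, hYde⟩ := (td.trans_yd.of_cong td.pos.le (td.trans_response hU)
    hyd).exists_isTransformOn
  obtain ⟨V, hV, hVe⟩ := hU.exists_isTransformOn
  refine ⟨V, Yd, hV, hYd, ?_⟩
  filter_upwards [hYde, hVe] with s a b
  rw [← a, ← b, add_sub_cancel_right]

/-- If there are more inputs than outputs, the plant has two different continuous desired
inputs. -/
theorem TrackingData.exists_ne_desiredInput (hr : 0 < r)
    {G₁ : Matrix (Fin q) (Fin q ⊕ Fin r) (RatFunc ℝ)}
    {G₂ : Matrix (Fin q) (Fin m) (RatFunc ℝ)} {D : Fin m → RatFunc ℝ} {yd : ℝ → Fin q → ℝ}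
    {K : Matrix (Fin q) (Fin q ⊕ Fin r) ℝ} {R : Matrix (Fin q ⊕ Fin r) (Fin q) (RatFunc ℝ)}
    {L : Matrix (Fin q ⊕ Fin r) (Fin q) ℝ} {ψ h H : ℝ → Fin q → ℝ}
    (td : TrackingData T G₁ (fun s => evalAt G₂ s *ᵥ evalVec D s) yd K R L ψ h H)
    (hKdet : IsUnit K.toCols₁.det) :
    ∃ w w', ContinuousOn w (Icc 0 T) ∧ ContinuousOn w' (Icc 0 T) ∧
      IsDesiredInput T G₁ G₂ D yd w ∧ IsDesiredInput T G₁ G₂ D yd w' ∧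
      ¬ EqOn w w' (Icc 0 T) := by
  obtain ⟨w, hwc, hw⟩ := td.exists_errRate_eqOn (f := fun _ => 0) continuousOn_const
  have hwd := td.isDesiredInput hwc hw
  -- a null input of the plant: `(-G₁₁⁻¹ G₁₂ v, v)` with a constant `v ≠ 0`
  set A := (RatFunc.X : RatFunc ℝ) • G₁
  have hA1 : HasLimitAtInfinity A.toCols₁ K.toCols₁ := fun i j => td.limit i (Sum.inl j)
  have hA2 : HasLimitAtInfinity A.toCols₂ K.toCols₂ := fun i j => td.limit i (Sum.inr j)
  have hu := hA1.isUnit_det hKdet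
  set Z : Matrix (Fin q ⊕ Fin r) (Fin r) (RatFunc ℝ) :=
    Matrix.fromRows (0 - A.toCols₁⁻¹ * A.toCols₂) 1
  have hZ : HasLimitAtInfinity Z (Matrix.fromRows (0 - K.toCols₁⁻¹ * K.toCols₂) 1) := by
    have h0 : HasLimitAtInfinity (0 : Matrix (Fin q) (Fin r) (RatFunc ℝ)) 0 := fun i j => by
      simp [evalAt]
    rintro (i | i) j
    · exact (h0.sub ((hA1.inv hKdet).mul hA2)) i j
    · exact HasLimitAtInfinity.one i j
  have hAZ : A * Z = 0 := by
    have h2 := Matrix.fromCols_mul_fromRows A.toCols₁ A.toCols₂ (0 - A.toCols₁⁻¹ * A.toCols₂) 1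
    rwa [Matrix.fromCols_toCols, zero_sub, Matrix.mul_neg, ← Matrix.mul_assoc,
      Matrix.mul_nonsing_inv _ hu, Matrix.one_mul, Matrix.mul_one, neg_add_cancel,
      ← zero_sub] at h2
  let v : ℝ → Fin r → ℝ := fun _ _ => 1
  have hv : ContinuousOn v (Icc 0 T) := continuousOn_const
  have hzc := continuousOn_actVec hZ td.pos.le hv
  obtain ⟨V, hV⟩ := exists_vecTransOn hv
  obtain ⟨W, hW⟩ := exists_vecTransOn hwc
  have hw'c : ContinuousOn (fun t => w t + actVec Z v t) (Icc 0 T) := hwc.add hzc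
  refine ⟨w, fun t => w t + actVec Z v t, hwc, hw'c, hwd, td.isDesiredInput hw'c ?_, ?_⟩
  · refine EqOn.trans ?_ hw
    refine (td.trans_errRate (hW.add (hV.mulVec hZ))).eqOn td.pos (td.trans_errRate hW)
      (Cong.of_eventuallyEq ?_) (td.continuousOn_errRate hw'c) (td.continuousOn_errRate hwc)
    filter_upwards [evalAt_mul A Z] with s hs
    rw [errRateTrans, errRateTrans, Matrix.mulVec_add, Matrix.mulVec_mulVec, ← hs, hAZ,
      evalAt_zero, Matrix.zero_mulVec, add_zero]
  · intro heq
    have h0m : (0 : ℝ) ∈ Icc 0 T := ⟨le_rfl, td.pos.le⟩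
    have h00 : w 0 = w 0 + actVec Z v 0 := heq h0m
    have h0 := congrFun h00 (Sum.inr ⟨0, hr⟩)
    simp only [Pi.add_apply] at h0
    rw [actVec_apply_zero hZ] at h0
    have h1 : (Matrix.fromRows (0 - K.toCols₁⁻¹ * K.toCols₂) (1 : Matrix (Fin r) (Fin r) ℝ)
        *ᵥ v 0) (Sum.inr ⟨0, hr⟩) = 1 := by
      rw [Matrix.fromRows_mulVec, Sum.elim_inr, Matrix.one_mulVec]
    rw [h1] at h0
    linarith

end System

end ILC

/-! ### The learning theorem -/

open ILC
theorem theorem4 {q r m : ℕ} (hq : 0 < q) (T : ℝ) (hT : 0 < T)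
    (G₁ : Matrix (Fin q) (Fin q ⊕ Fin r) (RatFunc ℝ)) (G₂ : Matrix (Fin q) (Fin m) (RatFunc ℝ))
    (D : Fin m → RatFunc ℝ) (Φ₁ : ℝ → Matrix (Fin q) (Fin q ⊕ Fin r) ℝ)
    (hG₁ : IsStrictlyProper G₁) (hG₂ : IsStrictlyProper G₂)
    (hD : IsImpulsePlusStrictlyProper D)
    (hdeg : HasRelativeDegreeOne G₁)
    (hΦ₁ : IsImpulseResponse G₁ Φ₁) (hΦ₁₁ : IsUnit (Φ₁ 0).toCols₁.det)
    (Γ : Matrix (Fin q ⊕ Fin r) (Fin q) (RatFunc ℝ))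
    (yd : ℝ → Fin q → ℝ) (hyd : ContDiffOn ℝ 1 yd (Set.Icc 0 T))
    (hinit : InitialCondition T G₁ G₂ D yd) :
    -- convergence to a continuous input with perfect tracking, from every initial input
    ((∀ u₀ : ℝ → (Fin q ⊕ Fin r) → ℝ, ContinuousOn u₀ (Set.Icc 0 T) →
        ∃ w, IsLearnedInput T G₁ G₂ D Γ yd u₀ w) ↔
      (IsProper ((RatFunc.X : RatFunc ℝ)⁻¹ • Γ) ∧ IsProper (G₁ * Γ) ∧
        ∃ M : Matrix (Fin q) (Fin q) ℝ, HasLimitAtInfinity (G₁ * Γ) M ∧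
          spectralRadius ℂ ((1 - M).map (algebraMap ℝ ℂ)) < 1)) ∧
    -- the gain condition makes `G₁ Γ` nonsingular, and the inputs given by the formula are exactly
    -- the desired inputs
    ((∃ M : Matrix (Fin q) (Fin q) ℝ, HasLimitAtInfinity (G₁ * Γ) M ∧
        spectralRadius ℂ ((1 - M).map (algebraMap ℝ ℂ)) < 1) →
      IsUnit (G₁ * Γ).det ∧
      {w | ∃ u₀, LearnedInputFormula T G₁ G₂ D Γ yd u₀ w} =
        {w | IsDesiredInput T G₁ G₂ D yd w}) ∧
    ((∀ u₀ : ℝ → (Fin q ⊕ Fin r) → ℝ, ContinuousOn u₀ (Set.Icc 0 T) →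
        ∃ w, IsLearnedInput T G₁ G₂ D Γ yd u₀ w) →
      -- every learning process with continuous inputs converges uniformly, and its limit is
      -- given by the formula
      (∀ (u : ℕ → ℝ → (Fin q ⊕ Fin r) → ℝ) (y : ℕ → ℝ → Fin q → ℝ),
        IsILCRun T G₁ G₂ D Γ yd u y → (∀ k, ContinuousOn (u k) (Set.Icc 0 T)) →
        ∃ w : ℝ → (Fin q ⊕ Fin r) → ℝ, ContinuousOn w (Set.Icc 0 T) ∧
          TendstoUniformlyOn u w Filter.atTop (Set.Icc 0 T) ∧
          TendstoUniformlyOn y yd Filter.atTop (Set.Icc 0 T) ∧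
          LearnedInputFormula T G₁ G₂ D Γ yd (u 0) w) ∧
      -- the learned input depends on the initial input
      (0 < r → ∃ u₀ u₀' w w' : ℝ → (Fin q ⊕ Fin r) → ℝ,
        ContinuousOn u₀ (Set.Icc 0 T) ∧ ContinuousOn u₀' (Set.Icc 0 T) ∧
        IsLearnedInput T G₁ G₂ D Γ yd u₀ w ∧ IsLearnedInput T G₁ G₂ D Γ yd u₀' w' ∧
        ¬ Set.EqOn w w' (Set.Icc 0 T)) ∧
      -- the limits learned from continuous initial inputs are exactly the continuous desired inputs
      {w | ∃ u₀, ContinuousOn u₀ (Set.Icc 0 T) ∧ IsLearnedInput T G₁ G₂ D Γ yd u₀ w} =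
        {w | ContinuousOn w (Set.Icc 0 T) ∧ IsDesiredInput T G₁ G₂ D yd w}) := by
  -- `Φ₁(0) = lim s G₁(s)`, so the gain of `s G₁` has a nonsingular first block
  obtain ⟨K, hK, -⟩ := hdeg
  rw [hΦ₁.apply_zero hT hG₁ hK] at hΦ₁₁
  obtain ⟨R, L, ψ, h, H, td⟩ := exists_trackingData hT hG₁ hG₂ hD hK hΦ₁₁ hyd hinit
  have hblock : HasLimitAtInfinity ((RatFunc.X : RatFunc ℝ) • G₁.toCols₁) K.toCols₁ :=
    fun i j => hK i (Sum.inl j)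
  have h11 : IsUnit G₁.toCols₁.det := by
    have h1 := (hblock.isUnit_det hΦ₁₁).ne_zero
    rw [Matrix.det_smul] at h1
    exact isUnit_iff_ne_zero.2 (right_ne_zero_of_mul h1)
  have hne : NeZero q := ⟨hq.ne'⟩
  have hmul : (RatFunc.X : RatFunc ℝ) • G₁ * ((RatFunc.X : RatFunc ℝ)⁻¹ • Γ) = G₁ * Γ := by
    rw [Matrix.smul_mul, Matrix.mul_smul, smul_inv_smul₀ RatFunc.X_ne_zero]
  have hnec : (∀ u₀ : ℝ → (Fin q ⊕ Fin r) → ℝ, ContinuousOn u₀ (Set.Icc 0 T) →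
      ∃ w, IsLearnedInput T G₁ G₂ D Γ yd u₀ w) →
      ∃ L', HasLimitAtInfinity ((RatFunc.X : RatFunc ℝ)⁻¹ • Γ) L' ∧
        HasLimitAtInfinity (G₁ * Γ) (K * L') ∧
        spectralRadius ℂ ((1 - K * L').map (algebraMap ℝ ℂ)) < 1 := by
    intro hall
    obtain ⟨L', hL'⟩ := td.hasFiniteLim_of_isLearnedInput hall
    have hM := hK.mul hL'
    rw [hmul] at hM
    exact ⟨L', hL', hM, td.spectralRadius_lt_one hall hL' hM⟩
  refine ⟨⟨fun hall => ?_, ?_⟩, ?_, fun hall => ?_⟩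
  · obtain ⟨L', hL', hM, hspec⟩ := hnec hall
    have hM0 : K * L' ≠ 0 := by
      intro h0
      have h1 := isUnit_det_of_spectralRadius_lt_one hspec
      rw [h0, Matrix.det_zero] at h1
      exact not_isUnit_zero h1
    refine ⟨⟨L', ?_, hL'⟩, ⟨_, hM0, hM⟩, _, hM, hspec⟩
    rintro rfl
    exact hM0 (Matrix.mul_zero K)
  · rintro ⟨⟨L', -, hL'⟩, -, M, hM, hspec⟩ u₀ hu₀
    obtain ⟨u, y, hrun, h0, hu⟩ := td.exists_run hL' hu₀
    obtain ⟨w, hwc, hwu, hyu, -⟩ := td.exists_uniform_limit hrun hu hL' hM hspec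
    exact ⟨w, hwc, u, y, hrun, fun t _ => by rw [h0], hu, fun t ht => hwu.tendsto_at ht,
      fun t ht => hyu.tendsto_at ht⟩
  · rintro ⟨M, hM, hspec⟩
    have hdet := hM.isUnit_det (isUnit_det_of_spectralRadius_lt_one hspec)
    exact ⟨hdet, setOf_learnedInputFormula_eq h11 hdet yd⟩
  · obtain ⟨L', hL', hM, hspec⟩ := hnec hall
    have hdet := hM.isUnit_det (isUnit_det_of_spectralRadius_lt_one hspec)
    have hconv : ∀ (u : ℕ → ℝ → (Fin q ⊕ Fin r) → ℝ) (y : ℕ → ℝ → Fin q → ℝ),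
        IsILCRun T G₁ G₂ D Γ yd u y → (∀ k, ContinuousOn (u k) (Set.Icc 0 T)) →
        ∃ w : ℝ → (Fin q ⊕ Fin r) → ℝ, ContinuousOn w (Set.Icc 0 T) ∧
          TendstoUniformlyOn u w Filter.atTop (Set.Icc 0 T) ∧
          TendstoUniformlyOn y yd Filter.atTop (Set.Icc 0 T) ∧
          LearnedInputFormula T G₁ G₂ D Γ yd (u 0) w := by
      intro u y hrun hu
      simp only [LearnedInputFormula, gammaTilde_eq h11 hdet]
      exact td.exists_uniform_limit_formula hrun hu hL' hM hspec
    refine ⟨hconv, fun hr => ?_, ?_⟩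
    · obtain ⟨w, w', hw, hw', hd, hd', hne⟩ := td.exists_ne_desiredInput hr hΦ₁₁
      exact ⟨w, w', w, w', hw, hw', hd.isLearnedInput hyd.continuousOn hw,
        hd'.isLearnedInput hyd.continuousOn hw', hne⟩
    · ext w
      constructor
      · rintro ⟨u₀, hu₀, hwc, u, y, hrun, h0, hu, hw, hy⟩
        obtain ⟨w', hwc', hwu, -, hform⟩ := hconv u y hrun hu
        have heq : Set.EqOn w' w (Set.Icc 0 T) := fun t ht =>
          tendsto_nhds_unique (hwu.tendsto_at ht) (hw t ht)
        refine ⟨hwc, ?_⟩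
        have hmem : w ∈ {w | ∃ u₀, LearnedInputFormula T G₁ G₂ D Γ yd u₀ w} :=
          ⟨u 0, learnedInputFormula_congr hform heq⟩
        rwa [setOf_learnedInputFormula_eq h11 hdet yd] at hmem
      · rintro ⟨hw, hd⟩
        exact ⟨w, hw, hd.isLearnedInput hyd.continuousOn hw⟩
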